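/- **Conventions.** A divided power (DP) pair $(R,I)$ is a commutative ring with an ideal $I$ carrying divided powers $\gamma_n$; $X^{[n]}$ denotes the ideal generated by the products $\gamma_{n_1}(x_1)\cdots\gamma_{n_k}(x_k)$ with $x_i\in X\subseteq I$ and $\sum n_i\ge n$; $I^{(p)}$ is the ideal generated by the $p$-th powers of the elements of $I$. The DP hull $\Gamma(B,I)$ of a pair over a base DP pair is the universal DP pair under $(B,I)$ compatible with the base. For a local ring $R$, $\widehat\Gamma(R)$ is the pro-artinian completion of the DP hull $\Gamma(R,\mathfrak m_R)$ over $(\mathbb Z,0)$, i.e. the limit of its artinian local quotients by sub-DP ideals. A local homomorphism $\Lambda\to\Lambda_1$ is slightly ramified if $\Lambda\to\widehat\Gamma(\Lambda_1)$ is injective. $T^{DP}_{R/\Lambda}$ is the $R$-module of continuous $\Lambda$-derivations $D$ of $R$ with $D\gamma_n(x)=\gamma_{n-1}(x)D(x)$ for $n\ge 1$, $x\in I$ (no continuity condition if $R$ carries no topology). Let $R$ be a ring with one relevant closed point $\mathfrak m$. A *smooth DP foliation transverse to $V(Y)$* ($Y\subseteq\mathfrak m$ an ideal) is a finitely generated submodule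 $\mathcal F\subseteq T^{DP}_{R/\Lambda}$, closed under commutators, for which $\mathcal F/\mathfrak m\mathcal F\to \mathrm{Hom}(Y/\mathfrak mY,R/\mathfrak m)$ is injective. $R$, with divided powers on the maximal ideal $\mathfrak m$, is *DP tangent smooth* over $\Lambda$ if $T^{DP}_{R/\Lambda}$ is a smooth DP foliation (with $Y=\mathfrak m$) of maximal rank, that is, if moreover every (continuous) linear map $\mathfrak m/(\mathfrak m^2+\mathfrak m^{[2]}+\mathfrak m_\Lambda R)\to R/\mathfrak m$ is induced by an element of $T^{DP}_{R/\Lambda}$. Let $\Lambda$ be a local ring with divided powers on $\mathfrak m_\Lambda$ that is pro-DP-artinian (as a topological ring, the limit of its quotients by the open sub-DP ideals of finite colength). Let $\mathcal C$ be the category of local pro-DP-artinian $\Lambda$-algebras $R$ (divided powers on $\mathfrak m_R$, continuous DP structure map) with a continuous DP $\Lambda$-algebra map $\pi:R\to\Lambda$ such that $\ker\pi$ is topologically DP-nilpotent (each open ideal contains some $(\ker\pi)^{[N]}$). For $A\in\mathcal C$, $A\langle\langle t_1,\dots,t_n\rangle\rangle$ is the pro-DP-artinian completion, with the $t_i$ topologically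 DP-nilpotent, of the DP hull of $(A[t_1,\dots,t_n],(\mathfrak m_A,t_1,\dots,t_n))$ over $(A,\mathfrak m_A)$. **Theorem.** (i) Let $R\in\mathcal C$ and let $\mathcal F$ be a smooth DP foliation on $R$ over $\Lambda$ transverse to the section $\mathrm{Spf}\,\Lambda\subseteq\mathrm{Spf}\,R$ (i.e. $Y=\ker\pi$). Put $\Lambda'=R^{\mathcal F}=\{r: Dr=0 \text{ for all } D\in\mathcal F\}$, with the topology, divided powers and section induced from $R$. Then $\Lambda'\in\mathcal C$, and for some $n$ there is an isomorphism $R\cong\Lambda'\langle\langle t_1,\dots,t_n\rangle\rangle$ of topological $\Lambda'$-algebras with divided powers, under which the $t_i$ correspond to elements of $\ker\pi$. (ii) Let $k$ be a perfect field of characteristic $p>0$ and $\Lambda$ a local $k$-algebra with finitely generated maximal ideal whose residue field $\kappa$ is a finite extension of $k$. If the DP hull $\Gamma(\Lambda,\mathfrak m_\Lambda)$ is DP tangent smooth over $k$, then $\Lambda$ is height $1$ smooth: for some $n$, $\Lambda/\mathfrak m_\Lambda^{(p)}\cong\kappa[t_1,\dots,t_n]/(t_1,\dots,t_n)^{(p)}$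 as $k$-algebras. (iii) Let $\Lambda_0\xrightarrow{f}R\to\Lambda_1$ be local homomorphisms of noetherian local rings with finite residue field extensions, where $\Lambda_0$ is complete and torsion-free (over $\mathbb Z$), $R$ has the same residue field as $\Lambda_0$, and $\Lambda_0\to\Lambda_1$ is slightly ramified. If the induced map $\hat f:\widehat\Gamma(\Lambda_0)\to\widehat\Gamma(R)$ is DP tangent smooth, then $f$ is formally smooth for the $\mathfrak m_R$-adic topology. -/

import Mathlib

universe u v w

/-! ### The divided power hull -/

/-- Formal expressions in the elements of a ring and formal divided power operations `gam n`. -/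
inductive DPTerm (B : Type u) : Type u
  | of (b : B) : DPTerm B
  | add (s t : DPTerm B) : DPTerm B
  | mul (s t : DPTerm B) : DPTerm B
  | neg (t : DPTerm B) : DPTerm B
  | gam (n : ℕ) (t : DPTerm B) : DPTerm B

namespace DPTerm

/-- The expression `t ^ n`. -/
def pow {B : Type u} [CommRing B] (t : DPTerm B) : ℕ → DPTerm B
  | 0 => of 1
  | n + 1 => mul (pow t n) t

/-- The expression `∑ (i, j) ∈ l, gam i s * gam j t`. -/
def conv {B : Type u} [CommRing B] (s t : DPTerm B) : List (ℕ × ℕ) → DPTerm B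
  | [] => of 0
  | q :: l => add (mul (gam q.1 s) (gam q.2 t)) (conv s t l)

/-- The expressions that denote elements of the divided power ideal generated by `I`. -/
inductive Mem {B : Type u} [CommRing B] (I : Ideal B) : DPTerm B → Prop
  | of {b : B} (hb : b ∈ I) : Mem I (of b)
  | add {s t : DPTerm B} (hs : Mem I s) (ht : Mem I t) : Mem I (add s t)
  | mul (s : DPTerm B) {t : DPTerm B} (ht : Mem I t) : Mem I (mul s t)
  | gam {n : ℕ} (hn : n ≠ 0) {t : DPTerm B} (ht : Mem I t) : Mem I (gam n t)

/-- The smallest congruence for which the expressions form a commutative ring receiving `B`, the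
operations `gam n` are divided powers on the ideal of the expressions in `Mem I` and are zero on
all other expressions, and these divided powers restrict to the given ones on the base
`(S, J₀)`. -/
inductive Rel {S : Type v} {B : Type u} [CommRing S] [CommRing B] [Algebra S B] {J₀ : Ideal S}
    (γ₀ : DividedPowers J₀) (I : Ideal B) : DPTerm B → DPTerm B → Prop
  | refl (t : DPTerm B) : Rel γ₀ I t t
  | symm {s t : DPTerm B} (h : Rel γ₀ I s t) : Rel γ₀ I t s
  | trans {s t r : DPTerm B} (h : Rel γ₀ I s t) (h' : Rel γ₀ I t r) : Rel γ₀ I s r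
  | add_congr {s s' t t' : DPTerm B} (h : Rel γ₀ I s s') (h' : Rel γ₀ I t t') :
      Rel γ₀ I (add s t) (add s' t')
  | mul_congr {s s' t t' : DPTerm B} (h : Rel γ₀ I s s') (h' : Rel γ₀ I t t') :
      Rel γ₀ I (mul s t) (mul s' t')
  | neg_congr {s s' : DPTerm B} (h : Rel γ₀ I s s') : Rel γ₀ I (neg s) (neg s')
  | gam_congr (n : ℕ) {s s' : DPTerm B} (hs : Mem I s) (hs' : Mem I s') (h : Rel γ₀ I s s') :
      Rel γ₀ I (gam n s) (gam n s')
  | of_add (a b : B) : Rel γ₀ I (of (a + b)) (add (of a) (of b))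
  | of_mul (a b : B) : Rel γ₀ I (of (a * b)) (mul (of a) (of b))
  | add_assoc (r s t : DPTerm B) : Rel γ₀ I (add (add r s) t) (add r (add s t))
  | add_comm (s t : DPTerm B) : Rel γ₀ I (add s t) (add t s)
  | zero_add (t : DPTerm B) : Rel γ₀ I (add (of 0) t) t
  | neg_add (t : DPTerm B) : Rel γ₀ I (add (neg t) t) (of 0)
  | mul_assoc (r s t : DPTerm B) : Rel γ₀ I (mul (mul r s) t) (mul r (mul s t))
  | mul_comm (s t : DPTerm B) : Rel γ₀ I (mul s t) (mul t s)
  | one_mul (t : DPTerm B) : Rel γ₀ I (mul (of 1) t) t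
  | mul_add (r s t : DPTerm B) : Rel γ₀ I (mul r (add s t)) (add (mul r s) (mul r t))
  | gam_null (n : ℕ) {t : DPTerm B} (ht : ¬ Mem I t) : Rel γ₀ I (gam n t) (of 0)
  | gam_zero {t : DPTerm B} (ht : Mem I t) : Rel γ₀ I (gam 0 t) (of 1)
  | gam_one {t : DPTerm B} (ht : Mem I t) : Rel γ₀ I (gam 1 t) t
  | gam_add (n : ℕ) {s t : DPTerm B} (hs : Mem I s) (ht : Mem I t) :
      Rel γ₀ I (gam n (add s t)) (conv s t (List.Nat.antidiagonal n))
  | gam_mul (n : ℕ) (s : DPTerm B) {t : DPTerm B} (ht : Mem I t) :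
      Rel γ₀ I (gam n (mul s t)) (mul (pow s n) (gam n t))
  | gam_mul_gam (m n : ℕ) {t : DPTerm B} (ht : Mem I t) :
      Rel γ₀ I (mul (gam m t) (gam n t)) (mul (of ((m + n).choose m : B)) (gam (m + n) t))
  | gam_gam (m : ℕ) {n : ℕ} (hn : n ≠ 0) {t : DPTerm B} (ht : Mem I t) :
      Rel γ₀ I (gam m (gam n t)) (mul (of (Nat.uniformBell m n : B)) (gam (m * n) t))
  | base (n : ℕ) {a : S} (ha : a ∈ J₀) (ha' : algebraMap S B a ∈ I) :
      Rel γ₀ I (gam n (of (algebraMap S B a))) (of (algebraMap S B (γ₀.dpow n a)))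

/-- `Rel` as a setoid. -/
def setoid {S : Type v} {B : Type u} [CommRing S] [CommRing B] [Algebra S B] {J₀ : Ideal S}
    (γ₀ : DividedPowers J₀) (I : Ideal B) : Setoid (DPTerm B) :=
  ⟨Rel γ₀ I, ⟨Rel.refl, Rel.symm, Rel.trans⟩⟩

end DPTerm

/-- The divided power hull `Γ(B, I)` of the pair `(B, I)` over the divided power pair
`(S, J₀, γ₀)`: the ring freely generated by `B` and by divided powers on `I` that extend those of
the base. -/
def DPHull {S : Type v} {B : Type u} [CommRing S] [CommRing B] [Algebra S B] {J₀ : Ideal S}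
    (γ₀ : DividedPowers J₀) (I : Ideal B) : Type u :=
  Quotient (DPTerm.setoid γ₀ I)

namespace DPHull

open DPTerm

section

variable {S : Type v} {B : Type u} [CommRing S] [CommRing B] [Algebra S B] {J₀ : Ideal S}
    (γ₀ : DividedPowers J₀) (I : Ideal B)

/-- The class of an expression. -/
def mk (t : DPTerm B) : DPHull γ₀ I := Quotient.mk (DPTerm.setoid γ₀ I) t

variable {γ₀ I}

theorem sound {s t : DPTerm B} (h : Rel γ₀ I s t) : mk γ₀ I s = mk γ₀ I t :=
  Quotient.sound (s := DPTerm.setoid γ₀ I) h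

theorem rel_of_mk_eq {s t : DPTerm B} (h : mk γ₀ I s = mk γ₀ I t) : Rel γ₀ I s t :=
  Quotient.exact (s := DPTerm.setoid γ₀ I) h

theorem ind {P : DPHull γ₀ I → Prop} (h : ∀ t, P (mk γ₀ I t)) (x : DPHull γ₀ I) : P x :=
  Quotient.ind (s := DPTerm.setoid γ₀ I) h x

instance : Add (DPHull γ₀ I) :=
  ⟨Quotient.map₂ (sa := DPTerm.setoid γ₀ I) (sb := DPTerm.setoid γ₀ I)
    (sc := DPTerm.setoid γ₀ I) DPTerm.add fun _ _ h _ _ h' => Rel.add_congr h h'⟩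

instance : Mul (DPHull γ₀ I) :=
  ⟨Quotient.map₂ (sa := DPTerm.setoid γ₀ I) (sb := DPTerm.setoid γ₀ I)
    (sc := DPTerm.setoid γ₀ I) DPTerm.mul fun _ _ h _ _ h' => Rel.mul_congr h h'⟩

instance : Neg (DPHull γ₀ I) :=
  ⟨Quotient.map (sa := DPTerm.setoid γ₀ I) (sb := DPTerm.setoid γ₀ I)
    DPTerm.neg fun _ _ h => Rel.neg_congr h⟩

instance : Zero (DPHull γ₀ I) := ⟨mk γ₀ I (DPTerm.of 0)⟩

instance : One (DPHull γ₀ I) := ⟨mk γ₀ I (DPTerm.of 1)⟩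

theorem mk_add (s t : DPTerm B) : mk γ₀ I (DPTerm.add s t) = mk γ₀ I s + mk γ₀ I t := rfl

theorem mk_mul (s t : DPTerm B) : mk γ₀ I (DPTerm.mul s t) = mk γ₀ I s * mk γ₀ I t := rfl

theorem mk_neg (s : DPTerm B) : mk γ₀ I (DPTerm.neg s) = - mk γ₀ I s := rfl

theorem add_comm_aux (a b : DPHull γ₀ I) : a + b = b + a := by
  induction a using ind; induction b using ind; exact sound (Rel.add_comm _ _)

theorem mul_comm_aux (a b : DPHull γ₀ I) : a * b = b * a := by
  induction a using ind; induction b using ind; exact sound (Rel.mul_comm _ _)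

theorem zero_add_aux (a : DPHull γ₀ I) : 0 + a = a := by
  induction a using ind; exact sound (Rel.zero_add _)

theorem one_mul_aux (a : DPHull γ₀ I) : 1 * a = a := by
  induction a using ind; exact sound (Rel.one_mul _)

theorem mul_add_aux (a b c : DPHull γ₀ I) : a * (b + c) = a * b + a * c := by
  induction a using ind; induction b using ind; induction c using ind
  exact sound (Rel.mul_add _ _ _)

theorem neg_add_aux (a : DPHull γ₀ I) : -a + a = 0 := by
  induction a using ind; exact sound (Rel.neg_add _)

theorem add_assoc_aux (a b c : DPHull γ₀ I) : a + b + c = a + (b + c) := by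
  induction a using ind; induction b using ind; induction c using ind
  exact sound (Rel.add_assoc _ _ _)

theorem mul_assoc_aux (a b c : DPHull γ₀ I) : a * b * c = a * (b * c) := by
  induction a using ind; induction b using ind; induction c using ind
  exact sound (Rel.mul_assoc _ _ _)

theorem zero_mul_aux (a : DPHull γ₀ I) : 0 * a = 0 := by
  have h : 0 * a + 0 * a = 0 * a := by
    rw [mul_comm_aux 0 a, ← mul_add_aux, zero_add_aux]
  calc 0 * a = (-(0 * a) + 0 * a) + 0 * a := by rw [neg_add_aux, zero_add_aux]
    _ = -(0 * a) + (0 * a + 0 * a) := add_assoc_aux _ _ _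
    _ = 0 := by rw [h, neg_add_aux]

instance : CommRing (DPHull γ₀ I) where
  add_assoc := add_assoc_aux
  zero_add := zero_add_aux
  add_zero a := by rw [add_comm_aux, zero_add_aux]
  add_comm := add_comm_aux
  mul_assoc := mul_assoc_aux
  one_mul := one_mul_aux
  mul_one a := by rw [mul_comm_aux, one_mul_aux]
  mul_comm := mul_comm_aux
  left_distrib := mul_add_aux
  right_distrib a b c := by
    rw [mul_comm_aux, mul_add_aux, mul_comm_aux c a, mul_comm_aux c b]
  zero_mul := zero_mul_aux
  mul_zero a := by rw [mul_comm_aux, zero_mul_aux]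
  neg_add_cancel := neg_add_aux
  nsmul := nsmulRec
  zsmul := zsmulRec

variable (γ₀ I)

/-- The structure map `B → Γ(B, I)`. -/
def of : B →+* DPHull γ₀ I where
  toFun b := mk γ₀ I (DPTerm.of b)
  map_one' := rfl
  map_zero' := rfl
  map_add' a b := sound (Rel.of_add a b)
  map_mul' a b := sound (Rel.of_mul a b)

instance : Algebra B (DPHull γ₀ I) := (of γ₀ I).toAlgebra

instance : Algebra S (DPHull γ₀ I) := ((of γ₀ I).comp (algebraMap S B)).toAlgebra

instance : IsScalarTower S B (DPHull γ₀ I) := IsScalarTower.of_algebraMap_eq' rfl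

/-- The divided power ideal of `Γ(B, I)`. -/
def ideal : Ideal (DPHull γ₀ I) where
  carrier := {x | ∃ t, Mem I t ∧ mk γ₀ I t = x}
  zero_mem' := ⟨DPTerm.of 0, Mem.of I.zero_mem, rfl⟩
  add_mem' := by
    rintro _ _ ⟨s, hs, rfl⟩ ⟨t, ht, rfl⟩
    exact ⟨_, Mem.add hs ht, rfl⟩
  smul_mem' c x := by
    rintro ⟨t, ht, rfl⟩
    induction c using ind with
    | h s => exact ⟨_, Mem.mul s ht, rfl⟩

variable {γ₀ I}

theorem mk_mem {t : DPTerm B} (ht : Mem I t) : mk γ₀ I t ∈ ideal γ₀ I := ⟨t, ht, rfl⟩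

theorem of_mem {b : B} (hb : b ∈ I) : of γ₀ I b ∈ ideal γ₀ I := mk_mem (Mem.of hb)

theorem mk_pow (s : DPTerm B) (n : ℕ) : mk γ₀ I (DPTerm.pow s n) = mk γ₀ I s ^ n := by
  induction n with
  | zero => rw [pow_zero]; rfl
  | succ n ih => rw [pow_succ, ← ih]; rfl

theorem mk_conv (s t : DPTerm B) (l : List (ℕ × ℕ)) :
    mk γ₀ I (DPTerm.conv s t l) =
      (l.map fun q => mk γ₀ I (DPTerm.gam q.1 s) * mk γ₀ I (DPTerm.gam q.2 t)).sum := by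
  induction l with
  | nil => rfl
  | cons q l ih => rw [List.map_cons, List.sum_cons, ← ih]; rfl

open Classical in
/-- The divided power operations of `Γ(B, I)`. -/
noncomputable def dpow (n : ℕ) (x : DPHull γ₀ I) : DPHull γ₀ I :=
  if h : x ∈ ideal γ₀ I then mk γ₀ I (DPTerm.gam n h.choose) else 0

theorem dpow_mk (n : ℕ) {t : DPTerm B} (ht : Mem I t) :
    dpow n (mk γ₀ I t) = mk γ₀ I (DPTerm.gam n t) := by
  have h : mk γ₀ I t ∈ ideal γ₀ I := mk_mem ht
  rw [dpow, dif_pos h]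
  exact sound (Rel.gam_congr n h.choose_spec.1 ht (rel_of_mk_eq h.choose_spec.2))

variable (γ₀ I)

/-- The divided power structure of `Γ(B, I)`. -/
noncomputable def dividedPowers : DividedPowers (ideal γ₀ I) where
  dpow := dpow
  dpow_null h := dif_neg h
  dpow_zero := by
    rintro _ ⟨t, ht, rfl⟩
    rw [dpow_mk 0 ht]; exact sound (Rel.gam_zero ht)
  dpow_one := by
    rintro _ ⟨t, ht, rfl⟩
    rw [dpow_mk 1 ht]; exact sound (Rel.gam_one ht)
  dpow_mem := by
    rintro n _ hn ⟨t, ht, rfl⟩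
    rw [dpow_mk n ht]; exact mk_mem (Mem.gam hn ht)
  dpow_add := by
    rintro n _ _ ⟨s, hs, rfl⟩ ⟨t, ht, rfl⟩
    rw [← mk_add, dpow_mk n (Mem.add hs ht), sound (Rel.gam_add n hs ht), mk_conv]
    simp only [dpow_mk _ hs, dpow_mk _ ht]
    rfl
  dpow_mul := by
    rintro n c _ ⟨t, ht, rfl⟩
    induction c using ind with
    | h s =>
      rw [← mk_mul, dpow_mk n (Mem.mul s ht), dpow_mk n ht, sound (Rel.gam_mul n s ht), mk_mul,
        mk_pow]
  mul_dpow := by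
    rintro m n _ ⟨t, ht, rfl⟩
    rw [dpow_mk m ht, dpow_mk n ht, dpow_mk _ ht, ← mk_mul, sound (Rel.gam_mul_gam m n ht), mk_mul,
      ← map_natCast (of γ₀ I)]
    rfl
  dpow_comp := by
    rintro m n _ hn ⟨t, ht, rfl⟩
    rw [dpow_mk n ht, dpow_mk m (Mem.gam hn ht), dpow_mk _ ht, sound (Rel.gam_gam m hn ht), mk_mul,
      ← map_natCast (of γ₀ I)]
    rfl

variable {γ₀ I}

section lift

variable {C : Type w} [CommRing C] {K : Ideal C} (δ : DividedPowers K) (g : B →+* C)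

variable (I) in
open Classical in
/-- The value of an expression in a divided power ring. -/
noncomputable def eval : DPTerm B → C
  | .of b => g b
  | .add s t => eval s + eval t
  | .mul s t => eval s * eval t
  | .neg t => - eval t
  | .gam n t => if DPTerm.Mem I t then δ.dpow n (eval t) else 0

theorem eval_mem (hg : I ≤ K.comap g) {t : DPTerm B} (ht : Mem I t) : eval I δ g t ∈ K := by
  induction ht with
  | of hb => exact hg hb
  | add _ _ h h' => exact K.add_mem h h'
  | mul s _ h => exact K.mul_mem_left _ h
  | gam hn ht h => rw [eval, if_pos ht]; exact δ.dpow_mem hn h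

theorem eval_pow (s : DPTerm B) (n : ℕ) : eval I δ g (DPTerm.pow s n) = eval I δ g s ^ n := by
  induction n with
  | zero => simp [DPTerm.pow, eval]
  | succ n ih => simp [DPTerm.pow, eval, ih, pow_succ]

theorem eval_gam (n : ℕ) {t : DPTerm B} (ht : Mem I t) :
    eval I δ g (DPTerm.gam n t) = δ.dpow n (eval I δ g t) := by
  rw [eval, if_pos ht]

theorem eval_conv {s t : DPTerm B} (hs : Mem I s) (ht : Mem I t) (l : List (ℕ × ℕ)) :
    eval I δ g (DPTerm.conv s t l) =
      (l.map fun q => δ.dpow q.1 (eval I δ g s) * δ.dpow q.2 (eval I δ g t)).sum := by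
  induction l with
  | nil => simp [DPTerm.conv, eval]
  | cons q l ih => simp [DPTerm.conv, eval, ih, hs, ht]

theorem eval_rel (hg : I ≤ K.comap g)
    (hb : ∀ n, ∀ a ∈ J₀, δ.dpow n (g (algebraMap S B a)) = g (algebraMap S B (γ₀.dpow n a)))
    {s t : DPTerm B} (h : Rel γ₀ I s t) : eval I δ g s = eval I δ g t := by
  have hm : ∀ {t : DPTerm B}, Mem I t → eval I δ g t ∈ K := eval_mem δ g hg
  induction h with
  | refl => rfl
  | symm _ h => exact h.symm
  | trans _ _ h h' => exact h.trans h'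
  | add_congr _ _ h h' => simp only [eval, h, h']
  | mul_congr _ _ h h' => simp only [eval, h, h']
  | neg_congr _ h => simp only [eval, h]
  | gam_congr n hs hs' _ h => rw [eval_gam δ g n hs, eval_gam δ g n hs', h]
  | gam_null n ht => simp only [eval, if_neg ht, map_zero]
  | gam_zero ht => rw [eval_gam δ g 0 ht, δ.dpow_zero (hm ht), eval, map_one]
  | gam_one ht => rw [eval_gam δ g 1 ht, δ.dpow_one (hm ht)]
  | gam_add n hs ht =>
    rw [eval_conv δ g hs ht, eval_gam δ g n (Mem.add hs ht), eval, δ.dpow_add (hm hs) (hm ht)]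
    rfl
  | gam_mul n s ht =>
    rw [eval_gam δ g n (Mem.mul s ht), eval, δ.dpow_mul (hm ht), eval, eval_pow, eval_gam δ g n ht]
  | gam_mul_gam m n ht =>
    rw [eval, eval, eval, map_natCast, eval_gam δ g m ht, eval_gam δ g n ht,
      eval_gam δ g (m + n) ht, δ.mul_dpow (hm ht)]
  | gam_gam m hn ht =>
    rw [eval_gam δ g m (Mem.gam hn ht), eval_gam δ g _ ht, eval, eval, map_natCast,
      eval_gam δ g _ ht, δ.dpow_comp hn (hm ht)]
  | base n ha ha' => rw [eval_gam δ g n (Mem.of ha'), eval, eval]; exact hb n _ ha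
  | of_add a b => simp only [eval, map_add]
  | of_mul a b => simp only [eval, map_mul]
  | add_assoc => simp only [eval]; ring
  | add_comm => simp only [eval]; ring
  | zero_add => simp only [eval, map_zero]; ring
  | neg_add => simp only [eval, map_zero]; ring
  | mul_assoc => simp only [eval]; ring
  | mul_comm => simp only [eval]; ring
  | one_mul => simp only [eval, map_one]; ring
  | mul_add => simp only [eval]; ring

/-- The universal property of the hull: a ring map `B → C` that maps `I` into a divided power
ideal of `C`, compatibly with the base, extends to `Γ(B, I)`. -/
noncomputable def lift (hg : I ≤ K.comap g)
    (hb : ∀ n, ∀ a ∈ J₀, δ.dpow n (g (algebraMap S B a)) = g (algebraMap S B (γ₀.dpow n a))) :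
    DPHull γ₀ I →+* C where
  toFun := Quotient.lift (s := DPTerm.setoid γ₀ I) (eval I δ g) fun _ _ h => eval_rel δ g hg hb h
  map_one' := map_one g
  map_zero' := map_zero g
  map_add' a b := by induction a using ind; induction b using ind; rfl
  map_mul' a b := by induction a using ind; induction b using ind; rfl

theorem lift_mk (hg : I ≤ K.comap g)
    (hb : ∀ n, ∀ a ∈ J₀, δ.dpow n (g (algebraMap S B a)) = g (algebraMap S B (γ₀.dpow n a)))
    (t : DPTerm B) : lift δ g hg hb (mk γ₀ I t) = eval I δ g t := rfl

theorem lift_of (hg : I ≤ K.comap g)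
    (hb : ∀ n, ∀ a ∈ J₀, δ.dpow n (g (algebraMap S B a)) = g (algebraMap S B (γ₀.dpow n a)))
    (b : B) : lift δ g hg hb (of γ₀ I b) = g b := rfl

theorem lift_isDPMorphism (hg : I ≤ K.comap g)
    (hb : ∀ n, ∀ a ∈ J₀, δ.dpow n (g (algebraMap S B a)) = g (algebraMap S B (γ₀.dpow n a))) :
    (dividedPowers γ₀ I).IsDPMorphism δ (lift δ g hg hb) := by
  refine ⟨Ideal.map_le_iff_le_comap.2 ?_, ?_⟩
  · rintro _ ⟨t, ht, rfl⟩
    exact eval_mem δ g hg ht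
  · rintro n _ ⟨t, ht, rfl⟩
    refine Eq.trans ?_ (congrArg (lift δ g hg hb) (dpow_mk n ht)).symm
    exact (eval_gam δ g n ht).symm

end lift

end

end DPHull

/-! ### Divided power ideals, completions -/

namespace DividedPowers

variable {R : Type u} [CommRing R] {I : Ideal R} (γ : DividedPowers I)

/-- The divided power ideal `X^[n]`: the ideal generated by the products
`γ_{n₁}(x₁) ⋯ γ_{n_k}(x_k)` with all `x_i ∈ X` and `n₁ + ⋯ + n_k ≥ n`. -/
def dpPower (X : Set R) (n : ℕ) : Ideal R :=
  Ideal.span {y | ∃ l : List (ℕ × R), (∀ q ∈ l, q.2 ∈ X) ∧ n ≤ (l.map Prod.fst).sum ∧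
    y = (l.map fun q => γ.dpow q.1 q.2).prod}

/-- The completion of `R` for the topology defined by the divided power ideals `J ⊆ I` that
satisfy `P`: the families in `∏ R ⧸ J` that are compatible with the projections. -/
def Completion (P : Ideal R → Prop) : 
    Subring (∀ J : {J : Ideal R // γ.IsSubDPIdeal J ∧ P J}, R ⧸ J.1) where
  carrier := {f | ∀ (J J' : {J : Ideal R // γ.IsSubDPIdeal J ∧ P J}) (h : J.1 ≤ J'.1),
    Ideal.Quotient.factor h (f J) = f J'}
  mul_mem' {f g} hf hg J J' h :=
    (map_mul (Ideal.Quotient.factor h) (f J) (g J)).trans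
      (congrArg₂ (· * ·) (hf J J' h) (hg J J' h))
  one_mem' _ _ h := map_one (Ideal.Quotient.factor h)
  add_mem' {f g} hf hg J J' h :=
    (map_add (Ideal.Quotient.factor h) (f J) (g J)).trans
      (congrArg₂ (· + ·) (hf J J' h) (hg J J' h))
  zero_mem' _ _ h := map_zero (Ideal.Quotient.factor h)
  neg_mem' {f} hf J J' h :=
    (map_neg (Ideal.Quotient.factor h) (f J)).trans (congrArg (- ·) (hf J J' h))

namespace Completion

variable {γ} {P : Ideal R → Prop}

/-- The limit topology, where all the quotients `R ⧸ J` are discrete. -/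
instance : TopologicalSpace (γ.Completion P) :=
  @instTopologicalSpaceSubtype _ _ (@Pi.topologicalSpace _ _ fun _ => ⊥)

instance : IsTopologicalRing (γ.Completion P) := by
  let _ : ∀ J : {J : Ideal R // γ.IsSubDPIdeal J ∧ P J}, TopologicalSpace (R ⧸ J.1) := fun _ => ⊥
  have _ : ∀ J : {J : Ideal R // γ.IsSubDPIdeal J ∧ P J}, DiscreteTopology (R ⧸ J.1) :=
    fun _ => ⟨rfl⟩
  have _ : ∀ J : {J : Ideal R // γ.IsSubDPIdeal J ∧ P J}, IsTopologicalRing (R ⧸ J.1) :=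
    fun _ => inferInstance
  exact inferInstanceAs (IsTopologicalRing (γ.Completion P))

variable (γ P)

/-- The canonical map from `R` to its completion. -/
def of : R →+* γ.Completion P where
  toFun r := ⟨fun J => Ideal.Quotient.mk J.1 r, fun _ _ _ => rfl⟩
  map_one' := rfl
  map_zero' := rfl
  map_add' _ _ := rfl
  map_mul' _ _ := rfl

/-- The ideal `Î` of the completion: the limit of the ideals `I / J`. -/
def ideal : Ideal (γ.Completion P) where
  carrier := {f | ∀ J, f.1 J ∈ I.map (Ideal.Quotient.mk J.1)}
  zero_mem' _ := Ideal.zero_mem _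
  add_mem' hf hg J := Ideal.add_mem _ (hf J) (hg J)
  smul_mem' c _ hf J := Ideal.mul_mem_left _ (c.1 J) (hf J)

variable {γ P}

theorem inf_isSubDPIdeal {J : Ideal R} (hJ : γ.IsSubDPIdeal J) : γ.IsSubDPIdeal (J ⊓ I) := by
  rwa [inf_eq_left.2 hJ.isSubideal]

variable (γ P) in
/-- The divided powers on the factor `R ⧸ J`. -/
noncomputable def quotDP (J : {J : Ideal R // γ.IsSubDPIdeal J ∧ P J}) :
    DividedPowers (I.map (Ideal.Quotient.mk J.1)) :=
  Quotient.dividedPowers γ (inf_isSubDPIdeal J.2.1)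

theorem factor_dpow {J J' : {J : Ideal R // γ.IsSubDPIdeal J ∧ P J}} (h : J.1 ≤ J'.1) (n : ℕ)
    {x : R ⧸ J.1} (hx : x ∈ I.map (Ideal.Quotient.mk J.1)) :
    Ideal.Quotient.factor h ((quotDP γ P J).dpow n x) =
      (quotDP γ P J').dpow n (Ideal.Quotient.factor h x) := by
  obtain ⟨a, ha, rfl⟩ := (Ideal.mem_map_iff_of_surjective _ Ideal.Quotient.mk_surjective).1 hx
  have h1 := Quotient.dpow_apply γ (inf_isSubDPIdeal J.2.1) (n := n) ha
  have h2 := Quotient.dpow_apply γ (inf_isSubDPIdeal J'.2.1) (n := n) ha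
  rw [quotDP, quotDP, h1, Ideal.Quotient.factor_mk, Ideal.Quotient.factor_mk, h2]

open Classical in
/-- The componentwise divided power operations. -/
noncomputable def dpow (n : ℕ) (f : γ.Completion P) : γ.Completion P :=
  if h : f ∈ ideal γ P then
    ⟨fun J => (quotDP γ P J).dpow n (f.1 J), fun J J' hJ => by
      rw [factor_dpow hJ n (h J), f.2 J J' hJ]⟩
  else 0

theorem dpow_apply (n : ℕ) {f : γ.Completion P} (h : f ∈ ideal γ P)
    (J : {J : Ideal R // γ.IsSubDPIdeal J ∧ P J}) :
    (dpow n f).1 J = (quotDP γ P J).dpow n (f.1 J) := by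
  rw [dpow, dif_pos h]

theorem ext {f g : γ.Completion P} (h : ∀ J, f.1 J = g.1 J) : f = g := Subtype.ext (funext h)

theorem dpow_mem_ideal {n : ℕ} (hn : n ≠ 0) {f : γ.Completion P} (hf : f ∈ ideal γ P) :
    dpow n f ∈ ideal γ P := fun J => by
  rw [dpow_apply n hf J]; exact (quotDP γ P J).dpow_mem hn (hf J)

variable (γ P)

/-- The divided power structure of the completion. -/
noncomputable def dividedPowers : DividedPowers (ideal γ P) where
  dpow := dpow
  dpow_null h := dif_neg h
  dpow_zero h := ext fun J => by rw [dpow_apply _ h]; exact (quotDP γ P J).dpow_zero (h J)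
  dpow_one h := ext fun J => by rw [dpow_apply _ h]; exact (quotDP γ P J).dpow_one (h J)
  dpow_mem hn h := dpow_mem_ideal hn h
  dpow_add {n x y} hx hy := ext fun J => by
    have e := (quotDP γ P J).dpow_add (n := n) (hx J) (hy J)
    rw [dpow_apply _ (Ideal.add_mem _ hx hy)]
    refine e.trans ?_
    simp only [AddSubmonoidClass.coe_finsetSum, Finset.sum_apply, Subring.coe_mul, Pi.mul_apply,
      dpow_apply _ hx, dpow_apply _ hy]
  dpow_mul {n a x} hx := ext fun J => by
    rw [dpow_apply _ (Ideal.mul_mem_left _ a hx)]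
    refine ((quotDP γ P J).dpow_mul (n := n) (a := a.1 J) (hx J)).trans ?_
    rw [← dpow_apply _ hx]; rfl
  mul_dpow {m n x} hx := ext fun J => by
    have e := (quotDP γ P J).mul_dpow (m := m) (n := n) (hx J)
    rw [← dpow_apply _ hx, ← dpow_apply _ hx, ← dpow_apply _ hx] at e
    exact e
  dpow_comp {m n x} hn hx := ext fun J => by
    have e := (quotDP γ P J).dpow_comp (m := m) (n := n) hn (hx J)
    rw [dpow_apply _ (dpow_mem_ideal hn hx), dpow_apply _ hx]
    rw [← dpow_apply (m * n) hx] at e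
    exact e

variable {γ P}

/-- The map between completions induced by a ring map that is continuous for the topologies. -/
def map {R' : Type v} [CommRing R'] {I' : Ideal R'} {γ' : DividedPowers I'} {P' : Ideal R' → Prop}
    (h : R →+* R')
    (hP : ∀ J, γ'.IsSubDPIdeal J ∧ P' J → γ.IsSubDPIdeal (J.comap h) ∧ P (J.comap h)) :
    γ.Completion P →+* γ'.Completion P' where
  toFun f := ⟨fun J => Ideal.quotientMap J.1 h le_rfl (f.1 ⟨J.1.comap h, hP J.1 J.2⟩),
    fun J J' hJ => by
      have e := f.2 ⟨_, hP J.1 J.2⟩ ⟨_, hP J'.1 J'.2⟩ (Ideal.comap_mono hJ)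
      obtain ⟨a, ha⟩ := Ideal.Quotient.mk_surjective (f.1 ⟨_, hP J.1 J.2⟩)
      change Ideal.Quotient.factor hJ (Ideal.quotientMap J.1 h le_rfl (f.1 ⟨_, hP J.1 J.2⟩)) =
        Ideal.quotientMap J'.1 h le_rfl (f.1 ⟨_, hP J'.1 J'.2⟩)
      rw [← e, ← ha]; rfl⟩
  map_one' := ext fun _ => map_one _
  map_zero' := ext fun _ => map_zero _
  map_add' _ _ := ext fun _ => map_add _ _ _
  map_mul' _ _ := ext fun _ => map_mul _ _ _

end Completion

end DividedPowers

/-! ### Pro-artinian divided power completions of local rings -/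

open IsLocalRing

/-- The divided power hull `Γ(R, 𝔪_R)` of a local ring, over the base `(ℤ, 0)`. -/
abbrev LocalDPHull (R : Type u) [CommRing R] [IsLocalRing R] : Type u :=
  DPHull (dividedPowersBot ℤ) (maximalIdeal R)

/-- The divided power structure of `Γ(R, 𝔪_R)`. -/
noncomputable abbrev localDP (R : Type u) [CommRing R] [IsLocalRing R] :
    DividedPowers (DPHull.ideal (dividedPowersBot ℤ) (maximalIdeal R)) :=
  DPHull.dividedPowers (dividedPowersBot ℤ) (maximalIdeal R)

/-- The quotient by the ideal is an artinian local ring. -/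
def IsLocalArtinQuotient {A : Type u} [CommRing A] (J : Ideal A) : Prop :=
  IsLocalRing (A ⧸ J) ∧ IsArtinianRing (A ⧸ J)

/-- The pro-artinian divided power completion `Γ̂(R, 𝔪_R)`: the limit of the artinian local
quotients of `Γ(R, 𝔪_R)` by divided power ideals. -/
noncomputable abbrev ProArtinDP (R : Type u) [CommRing R] [IsLocalRing R] :
    Subring (∀ J : {J : Ideal (LocalDPHull R) //
      (localDP R).IsSubDPIdeal J ∧ IsLocalArtinQuotient J}, LocalDPHull R ⧸ J.1) :=
  (localDP R).Completion IsLocalArtinQuotient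

/-- The canonical map `R → Γ̂(R, 𝔪_R)`. -/
noncomputable def toProArtinDP (R : Type u) [CommRing R] [IsLocalRing R] : R →+* ProArtinDP R :=
  (DividedPowers.Completion.of (localDP R) IsLocalArtinQuotient).comp
    (DPHull.of (dividedPowersBot ℤ) (maximalIdeal R))

/-- A local homomorphism `f : Λ → Λ₁` is slightly ramified if `Λ → Λ₁ → Γ̂(Λ₁, 𝔪)` is
injective. -/
def IsSlightlyRamified {Λ : Type u} {Λ₁ : Type v} [CommRing Λ] [CommRing Λ₁] [IsLocalRing Λ₁]
    (f : Λ →+* Λ₁) : Prop :=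
  Function.Injective ((toProArtinDP Λ₁).comp f)

namespace DPHull

open DPTerm

variable {S : Type v} {B : Type u} [CommRing S] [CommRing B] [Algebra S B] {J₀ : Ideal S}
    {γ₀ : DividedPowers J₀} {I : Ideal B}

/-- Modulo its divided power ideal, the hull is generated by `B`. -/
theorem exists_sub_of_mem (x : DPHull γ₀ I) : ∃ b, x - of γ₀ I b ∈ ideal γ₀ I := by
  induction x using ind with
  | h t =>
    induction t with
    | of b => exact ⟨b, by rw [show mk γ₀ I (.of b) = of γ₀ I b from rfl, sub_self]; exact zero_mem _⟩
    | add s t hs ht =>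
      obtain ⟨a, ha⟩ := hs
      obtain ⟨b, hb⟩ := ht
      exact ⟨a + b, by rw [mk_add, map_add, add_sub_add_comm]; exact add_mem ha hb⟩
    | mul s t hs ht =>
      obtain ⟨a, ha⟩ := hs
      obtain ⟨b, hb⟩ := ht
      refine ⟨a * b, ?_⟩
      have : mk γ₀ I (.mul s t) - of γ₀ I (a * b) =
          mk γ₀ I s * (mk γ₀ I t - of γ₀ I b) + of γ₀ I b * (mk γ₀ I s - of γ₀ I a) := by
        rw [mk_mul, map_mul]; ring
      rw [this]
      exact add_mem (Ideal.mul_mem_left _ _ hb) (Ideal.mul_mem_left _ _ ha)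
    | neg t ht =>
      obtain ⟨b, hb⟩ := ht
      exact ⟨-b, by
        rw [mk_neg, map_neg, ← neg_sub', neg_mem_iff]; exact hb⟩
    | gam n t ht =>
      by_cases hm : Mem I t
      · rcases eq_or_ne n 0 with rfl | hn
        · refine ⟨1, ?_⟩
          rw [sound (Rel.gam_zero hm), show mk γ₀ I (.of 1) = of γ₀ I 1 from rfl, sub_self]
          exact zero_mem _
        · exact ⟨0, by rw [map_zero, sub_zero]; exact mk_mem (Mem.gam hn hm)⟩
      · refine ⟨0, ?_⟩
        rw [sound (Rel.gam_null n hm), show mk γ₀ I (.of 0) = of γ₀ I 0 from rfl, sub_self]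
        exact zero_mem _

variable (γ₀) in
/-- The ideal of the hull lies over `I`. -/
theorem of_mem_iff (hJ : J₀ ≤ I.comap (algebraMap S B)) {b : B} :
    of γ₀ I b ∈ ideal γ₀ I ↔ b ∈ I := by
  refine ⟨fun h => ?_, of_mem⟩
  have hb : ∀ n, ∀ a ∈ J₀, (dividedPowersBot (B ⧸ I)).dpow n
      (Ideal.Quotient.mk I (algebraMap S B a)) =
      Ideal.Quotient.mk I (algebraMap S B (γ₀.dpow n a)) := by
    intro n a ha
    have h0 : ∀ a ∈ J₀, Ideal.Quotient.mk I (algebraMap S B a) = 0 := fun a ha =>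
      Ideal.Quotient.eq_zero_iff_mem.2 (hJ ha)
    rw [h0 a ha]
    rcases eq_or_ne n 0 with rfl | hn
    · rw [γ₀.dpow_zero ha, map_one, map_one]
      exact (dividedPowersBot (B ⧸ I)).dpow_zero (zero_mem _)
    · rw [h0 _ (γ₀.dpow_mem hn ha)]
      exact (dividedPowersBot (B ⧸ I)).dpow_eval_zero hn
  have hg : I ≤ (⊥ : Ideal (B ⧸ I)).comap (Ideal.Quotient.mk I) := by
    rw [← RingHom.ker_eq_comap_bot, Ideal.mk_ker]
  have := (lift_isDPMorphism (dividedPowersBot (B ⧸ I)) (Ideal.Quotient.mk I) hg hb).ideal_comp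
    (Ideal.mem_map_of_mem _ h)
  rw [lift_of, Ideal.mem_bot] at this
  exact Ideal.Quotient.eq_zero_iff_mem.1 this

theorem ideal_isMaximal (hI : I.IsMaximal) (hJ : J₀ ≤ I.comap (algebraMap S B)) :
    (ideal γ₀ I).IsMaximal := by
  have h1 : Function.Surjective ((Ideal.Quotient.mk (ideal γ₀ I)).comp (of γ₀ I)) := by
    intro y
    obtain ⟨x, rfl⟩ := Ideal.Quotient.mk_surjective y
    obtain ⟨b, hb⟩ := exists_sub_of_mem x
    exact ⟨b, (Ideal.Quotient.eq.2 hb).symm⟩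
  have h2 : RingHom.ker ((Ideal.Quotient.mk (ideal γ₀ I)).comp (of γ₀ I)) = I := by
    ext b
    rw [RingHom.mem_ker, RingHom.comp_apply, Ideal.Quotient.eq_zero_iff_mem,
      of_mem_iff γ₀ hJ]
  rw [← h2] at hI
  exact Ideal.Quotient.maximal_of_isField _
    ((RingHom.quotientKerEquivOfSurjective h1).symm.toMulEquiv.isField
      ((Ideal.Quotient.maximal_ideal_iff_isField_quotient _).1 hI))

end DPHull

theorem IsFiniteLength.isArtinian_restrict {A : Type u} {B : Type v} [CommRing A] [CommRing B]
    [Algebra A B] [IsLocalRing B] (hk : IsArtinian A (B ⧸ maximalIdeal B)) {M : Type w}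
    [AddCommGroup M] [Module B M] (h : IsFiniteLength B M) :
    ∀ [Module A M] [IsScalarTower A B M], IsArtinian A M := by
  induction h with
  | of_subsingleton => intros; infer_instance
  | @of_simple_quotient M _ _ N _ h ih =>
    intro _ _
    have hs : IsSimpleModule B (M ⧸ N) := inferInstance
    obtain ⟨m, hm, ⟨e⟩⟩ := isSimpleModule_iff_quot_maximal.1 hs
    obtain rfl := IsLocalRing.eq_maximalIdeal hm
    have h1 : IsArtinian A (M ⧸ N) :=
      isArtinian_of_linearEquiv (e.restrictScalars A).symm
    have h2 : IsArtinian A N := ih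
    exact isArtinian_of_range_eq_ker (N.subtype.restrictScalars A) (N.mkQ.restrictScalars A) (by
      ext x; simp)

theorem isArtinian_residue {R : Type u} {R' : Type v} {B : Type w} [CommRing R] [CommRing R']
    [CommRing B] [IsLocalRing R] [IsLocalRing R'] [IsLocalRing B] (f : R →+* R') [IsLocalHom f]
    (hf : (ResidueField.map f).Finite) (g : R' →+* B) [Algebra R B]
    (halg : algebraMap R B = g.comp f)
    (hg : Function.Surjective ((Ideal.Quotient.mk (maximalIdeal B)).comp g)) :
    IsArtinian R (B ⧸ maximalIdeal B) := by
  let _ : Field (B ⧸ maximalIdeal B) := Ideal.Quotient.field _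
  set φ := (Ideal.Quotient.mk (maximalIdeal B)).comp g
  have hker : RingHom.ker φ = maximalIdeal R' :=
    IsLocalRing.eq_maximalIdeal (RingHom.ker_isMaximal_of_surjective φ hg)
  let ψ : ResidueField R' →+* B ⧸ maximalIdeal B :=
    Ideal.Quotient.lift (maximalIdeal R') φ fun a ha => by rwa [← hker] at ha
  have hψ : Function.Surjective ψ := Ideal.Quotient.lift_surjective_of_surjective _ _ hg
  have hfin : (ψ.comp (ResidueField.map f)).Finite := (RingHom.Finite.of_surjective ψ hψ).comp hf
  let _ : Algebra (ResidueField R) (B ⧸ maximalIdeal B) := (ψ.comp (ResidueField.map f)).toAlgebra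
  have : Module.Finite (ResidueField R) (B ⧸ maximalIdeal B) := hfin
  have : IsScalarTower R (ResidueField R) (B ⧸ maximalIdeal B) :=
    IsScalarTower.of_algebraMap_eq fun x => by
      change Ideal.Quotient.mk _ (algebraMap R B x) = _
      rw [halg]; rfl
  have : IsArtinian (ResidueField R) (B ⧸ maximalIdeal B) := inferInstance
  exact isArtinian_of_surjective_algebraMap (R := ResidueField R) Ideal.Quotient.mk_surjective

section induced

variable {R : Type u} {R' : Type v} [CommRing R] [CommRing R'] [IsLocalRing R] [IsLocalRing R']
  (f : R →+* R') [IsLocalHom f]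

/-- The map `Γ(R, 𝔪) → Γ(R', 𝔪')` induced by a local homomorphism. -/
noncomputable def LocalDPHull.map : LocalDPHull R →+* LocalDPHull R' :=
  DPHull.lift (localDP R') ((DPHull.of _ _).comp f)
    (fun a ha => DPHull.of_mem (by
      rw [mem_maximalIdeal, mem_nonunits_iff] at ha ⊢
      exact fun h => ha (isUnit_of_map_unit f a h)))
    (fun n a ha => by
      rw [Ideal.mem_bot] at ha
      subst ha
      rcases eq_or_ne n 0 with rfl | hn
      · rw [(dividedPowersBot ℤ).dpow_zero (zero_mem _)]
        simp only [map_zero, map_one]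
        exact (localDP R').dpow_zero (zero_mem _)
      · rw [(dividedPowersBot ℤ).dpow_eval_zero hn]
        simp only [map_zero]
        exact (localDP R').dpow_eval_zero hn)

theorem LocalDPHull.map_isDPMorphism : (localDP R).IsDPMorphism (localDP R') (LocalDPHull.map f) :=
  DPHull.lift_isDPMorphism _ _ _ _

theorem LocalDPHull.ideal_isMaximal (R : Type u) [CommRing R] [IsLocalRing R] :
    (DPHull.ideal (dividedPowersBot ℤ) (maximalIdeal R)).IsMaximal :=
  DPHull.ideal_isMaximal inferInstance bot_le

theorem LocalDPHull.comap_ideal : (DPHull.ideal (dividedPowersBot ℤ) (maximalIdeal R')).comap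
    (LocalDPHull.map f) = DPHull.ideal (dividedPowersBot ℤ) (maximalIdeal R) := by
  symm
  refine (LocalDPHull.ideal_isMaximal R).eq_of_le ?_
    (Ideal.map_le_iff_le_comap.1 (LocalDPHull.map_isDPMorphism f).ideal_comp)
  exact Ideal.comap_ne_top _ (LocalDPHull.ideal_isMaximal R').ne_top

/-- If the residue field extension is finite, the map between the hulls is continuous for the
topologies that define the pro-artinian divided power completions. -/
theorem LocalDPHull.comap_open (hf : (ResidueField.map f).Finite) (J : Ideal (LocalDPHull R'))
    (hJ : (localDP R').IsSubDPIdeal J ∧ IsLocalArtinQuotient J) :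
    (localDP R).IsSubDPIdeal (J.comap (LocalDPHull.map f)) ∧
      IsLocalArtinQuotient (J.comap (LocalDPHull.map f)) := by
  obtain ⟨hJ, hl, ha⟩ := hJ
  have hle : J.comap (LocalDPHull.map f) ≤ DPHull.ideal (dividedPowersBot ℤ) (maximalIdeal R) := by
    rw [← LocalDPHull.comap_ideal f]; exact Ideal.comap_mono hJ.isSubideal
  set h := LocalDPHull.map f with hh
  set q := Ideal.quotientMap J h le_rfl with hq
  have hq_inj : Function.Injective q := Ideal.quotientMap_injective
  -- the image of the ideal of the hull is the maximal ideal
  have hmax : (DPHull.ideal (dividedPowersBot ℤ) (maximalIdeal R')).map (Ideal.Quotient.mk J) =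
      maximalIdeal _ := by
    apply IsLocalRing.eq_maximalIdeal
    have := LocalDPHull.ideal_isMaximal R'
    refine Ideal.IsMaximal.map_of_surjective_of_ker_le Ideal.Quotient.mk_surjective ?_
    rw [Ideal.mk_ker]; exact hJ.isSubideal
  have hloc : IsLocalHom q := by
    constructor
    intro x hx
    obtain ⟨x, rfl⟩ := Ideal.Quotient.mk_surjective x
    have hx1 : x ∉ DPHull.ideal (dividedPowersBot ℤ) (maximalIdeal R) := by
      rw [← LocalDPHull.comap_ideal f]
      intro h1
      have h2 := Ideal.mem_map_of_mem (Ideal.Quotient.mk J) (Ideal.mem_comap.1 h1)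
      rw [hmax] at h2
      exact h2 hx
    obtain ⟨y, i, hi, hy⟩ := (LocalDPHull.ideal_isMaximal R).exists_inv hx1
    have h3 : IsNilpotent (q (Ideal.Quotient.mk _ i)) := by
      obtain ⟨k, hk⟩ := IsArtinianRing.isNilpotent_jacobson_bot (R := LocalDPHull R' ⧸ J)
      rw [IsLocalRing.jacobson_eq_maximalIdeal _ bot_ne_top] at hk
      refine ⟨k, ?_⟩
      have h4 : Ideal.Quotient.mk J (h i) ∈ maximalIdeal (LocalDPHull R' ⧸ J) := by
        rw [← hmax]
        refine Ideal.mem_map_of_mem _ (Ideal.mem_comap.1 ?_)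
        rw [LocalDPHull.comap_ideal f]; exact hi
      have h5 := Ideal.pow_mem_pow h4 k
      rw [hk] at h5
      exact h5
    have h6 : IsNilpotent (Ideal.Quotient.mk (J.comap h) i) := by
      obtain ⟨k, hk⟩ := h3
      exact ⟨k, hq_inj (by rw [map_pow, hk, map_zero])⟩
    have h7 : Ideal.Quotient.mk (J.comap h) y * Ideal.Quotient.mk (J.comap h) x =
        1 - Ideal.Quotient.mk (J.comap h) i := by
      rw [← map_mul, ← map_one (Ideal.Quotient.mk (J.comap h)), ← map_sub, ← hy]; ring_nf
    exact isUnit_of_mul_isUnit_right (h7 ▸ h6.isUnit_one_sub)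
  refine ⟨⟨hle, fun n hn j hj => ?_⟩, ?_, ?_⟩
  · have := (LocalDPHull.map_isDPMorphism f).map_dpow (n := n) (hle hj)
    rw [Ideal.mem_comap, hh, this]
    exact hJ.dpow_mem n hn hj
  · exact RingHom.domain_isLocalRing q
  · let _ : Algebra R (LocalDPHull R' ⧸ J) :=
      ((Ideal.Quotient.mk J).comp ((DPHull.of _ _).comp f)).toAlgebra
    have hart : IsArtinian R (LocalDPHull R' ⧸ J) := by
      refine IsFiniteLength.isArtinian_restrict
        (isArtinian_residue f hf ((Ideal.Quotient.mk J).comp (DPHull.of _ _)) rfl ?_)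
        ((isArtinianRing_iff_isFiniteLength _).1 ha)
      intro y
      obtain ⟨y, rfl⟩ := Ideal.Quotient.mk_surjective y
      obtain ⟨y, rfl⟩ := Ideal.Quotient.mk_surjective y
      obtain ⟨b, hb⟩ := DPHull.exists_sub_of_mem y
      refine ⟨b, (Ideal.Quotient.eq.2 ?_).symm⟩
      rw [← hmax]
      exact Ideal.mem_map_of_mem (Ideal.Quotient.mk J) hb
    let _ : Algebra R (LocalDPHull R ⧸ J.comap h) :=
      ((Ideal.Quotient.mk (J.comap h)).comp (DPHull.of _ _)).toAlgebra
    let l : (LocalDPHull R ⧸ J.comap h) →ₐ[R] (LocalDPHull R' ⧸ J) :=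
      { q with commutes' := fun _ => rfl }
    have h8 : IsArtinian R (LocalDPHull R ⧸ J.comap h) :=
      isArtinian_of_injective l.toLinearMap hq_inj
    exact isArtinian_of_tower R h8

/-- The map `Γ̂(R, 𝔪) → Γ̂(R', 𝔪')` induced by a local homomorphism whose residue field extension
is finite. -/
noncomputable def ProArtinDP.map (hf : (ResidueField.map f).Finite) :
    ProArtinDP R →+* ProArtinDP R' :=
  DividedPowers.Completion.map (LocalDPHull.map f) (LocalDPHull.comap_open f hf)

end induced

/-! ### Divided power foliations -/

/-- The divided power hull carries the discrete topology. -/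
instance DPHull.topologicalSpace {S : Type v} {B : Type u} [CommRing S] [CommRing B] [Algebra S B]
    {J₀ : Ideal S} (γ₀ : DividedPowers J₀) (I : Ideal B) : TopologicalSpace (DPHull γ₀ I) := ⊥

instance DPHull.discreteTopology {S : Type v} {B : Type u} [CommRing S] [CommRing B] [Algebra S B]
    {J₀ : Ideal S} (γ₀ : DividedPowers J₀) (I : Ideal B) : DiscreteTopology (DPHull γ₀ I) := ⟨rfl⟩

section foliations

variable (Λ : Type v) {R : Type u} [CommRing Λ] [CommRing R] [Algebra Λ R] [TopologicalSpace R]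
  [IsTopologicalRing R] {I : Ideal R}

/-- The module `T^DP_{R/Λ}` of continuous divided power `Λ`-derivations of `R`. -/
def dpTangent (γ : DividedPowers I) : Submodule R (Derivation Λ R R) where
  carrier := {D | Continuous D ∧ ∀ n, ∀ x ∈ I, D (γ.dpow (n + 1) x) = γ.dpow n x * D x}
  zero_mem' := ⟨continuous_const, fun n x _ => by simp⟩
  add_mem' {D E} hD hE := ⟨hD.1.add hE.1, fun n x hx => by
    rw [Derivation.add_apply, Derivation.add_apply, hD.2 n x hx, hE.2 n x hx, mul_add]⟩
  smul_mem' c D hD := ⟨continuous_const.mul hD.1, fun n x hx => by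
    rw [Derivation.smul_apply, Derivation.smul_apply, hD.2 n x hx, smul_eq_mul, smul_eq_mul]
    ring⟩

/-- `F` is a smooth divided power foliation on `Spec R` (or `Spf R`) over `Λ`, where `𝔪` is the
only closed point, which is transverse to the closed subscheme defined by `Y ⊆ 𝔪`: a finitely
generated module of divided power derivations that is closed under commutators and for which
`F / 𝔪F → Hom(Y / 𝔪Y, R / 𝔪)`, `D ↦ (x ↦ D x mod 𝔪)`, is injective. -/
structure IsSmoothDPFoliation (γ : DividedPowers I) (Y 𝔪 : Ideal R)
    (F : Submodule R (Derivation Λ R R)) : Prop where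
  le : F ≤ dpTangent Λ γ
  fg : F.FG
  lie : ∀ D ∈ F, ∀ E ∈ F, ⁅D, E⁆ ∈ F
  inj : ∀ D ∈ F, (∀ x ∈ Y, D x ∈ 𝔪) → D ∈ 𝔪 • F

/-- Let `I` be a maximal ideal of `R` with divided powers, lying over the ideal `J` of `Λ`. Then
`R` is divided power tangent smooth over `Λ` if `T = T^DP_{R/Λ}` is a smooth divided power
foliation of maximal rank, that is, if `T / I T → Hom(I / (I² + I^[2] + J R), R / I)` is bijective:
`T` is a smooth foliation (so that the map is injective) and every (continuous) tangent vector
lifts to a divided power derivation. -/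
structure IsDPTangentSmooth (J : Ideal Λ) (γ : DividedPowers I) : Prop where
  foliation : IsSmoothDPFoliation Λ γ I I (dpTangent Λ γ)
  lifts : ∀ φ : I →ₗ[R] R ⧸ I, IsOpen {x : I | φ x = 0} →
    (∀ x : I, (x : R) ∈ γ.dpPower (I : Set R) 2 → φ x = 0) →
    (∀ a ∈ J, ∀ x : I, (x : R) = algebraMap Λ R a → φ x = 0) →
    ∃ D ∈ dpTangent Λ γ, ∀ x : I, φ x = Ideal.Quotient.mk I (D x)

variable {Λ} in
/-- The ring of `F`-invariants `R^F`. -/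
def invariants (F : Submodule R (Derivation Λ R R)) : Subalgebra Λ R where
  carrier := {r | ∀ D ∈ F, D r = 0}
  mul_mem' {a b} ha hb D hD := by simp [ha D hD, hb D hD]
  add_mem' {a b} ha hb D hD := by simp [ha D hD, hb D hD]
  algebraMap_mem' a D _ := D.map_algebraMap a

end foliations

/-- Divided power tangent smoothness of a ring homomorphism. -/
def RingHom.IsDPTangentSmooth {Λ : Type v} {R : Type u} [CommRing Λ] [CommRing R]
    [TopologicalSpace R] [IsTopologicalRing R] {I : Ideal R} (f : Λ →+* R) (J : Ideal Λ)
    (γ : DividedPowers I) : Prop :=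
  letI := f.toAlgebra
  _root_.IsDPTangentSmooth Λ J γ

/-! ### The category of pro-DP-artinian algebras with a section -/

/-- The local ring `R` with divided powers on its maximal ideal is pro-DP-artinian: it is, as a
topological ring, the limit of its quotients by the open divided power ideals of finite
colength. -/
structure IsProDPArtin {R : Type u} [CommRing R] [IsLocalRing R] [TopologicalSpace R]
    (γ : DividedPowers (maximalIdeal R)) : Prop where
  basis : ∀ U ∈ nhds (0 : R), ∃ J : Ideal R, (J : Set R) ⊆ U ∧ γ.IsSubDPIdeal J ∧
    IsArtinianRing (R ⧸ J) ∧ IsOpen (J : Set R)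
  complete : Function.Bijective (DividedPowers.Completion.of γ fun J : Ideal R =>
    IsArtinianRing (R ⧸ J) ∧ IsOpen (J : Set R))

/-- The `Λ`-algebra `R` with the section `π : R → Λ` is an object of the category of local
pro-DP-artinian `Λ`-algebras with a section with topologically DP-nilpotent kernel. -/
structure IsDPNilpotentAlgebra {Λ : Type v} {R : Type u} [CommRing Λ] [IsLocalRing Λ]
    [TopologicalSpace Λ] [CommRing R] [IsLocalRing R] [TopologicalSpace R] [Algebra Λ R]
    (γΛ : DividedPowers (maximalIdeal Λ)) (γR : DividedPowers (maximalIdeal R))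
    (π : R →ₐ[Λ] Λ) : Prop where
  proDPArtin : IsProDPArtin γR
  continuous_algebraMap : Continuous (algebraMap Λ R)
  algebraMap_dp : γΛ.IsDPMorphism γR (algebraMap Λ R)
  continuous_section : Continuous π
  section_dp : γR.IsDPMorphism γΛ π.toRingHom
  nilpotent : ∀ J : Ideal R, IsOpen (J : Set R) →
    ∃ N, γR.dpPower (RingHom.ker π : Set R) N ≤ J

section series

variable {A : Type u} [CommRing A] [IsLocalRing A] [TopologicalSpace A]
  (γ : DividedPowers (maximalIdeal A)) (n : ℕ)

/-- The divided power polynomial ring over `A`: the divided power hull of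
`(A[t₁, …, t_n], (𝔪_A, t₁, …, t_n))` over the base `(A, 𝔪_A, γ)`. -/
abbrev DPPolynomial : Type u :=
  DPHull γ ((maximalIdeal A).map (MvPolynomial.C : A →+* MvPolynomial (Fin n) A) ⊔
    Ideal.span (Set.range MvPolynomial.X))

/-- The divided power structure of the divided power polynomial ring. -/
noncomputable abbrev DPPolynomial.dp :
    DividedPowers (DPHull.ideal γ ((maximalIdeal A).map
      (MvPolynomial.C : A →+* MvPolynomial (Fin n) A) ⊔ Ideal.span (Set.range MvPolynomial.X))) :=
  DPHull.dividedPowers γ _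

/-- The variable `t_i`. -/
noncomputable def DPPolynomial.X (i : Fin n) : DPPolynomial γ n :=
  DPHull.of γ _ (MvPolynomial.X i)

/-- The topology of the divided power polynomial ring: the ideals with artinian local quotient
which are open on `A` and contain some `(t₁, …, t_n)^[N]`. -/
def DPPolynomial.IsAdmissible (J : Ideal (DPPolynomial γ n)) : Prop :=
  IsLocalArtinQuotient J ∧ IsOpen (J.comap (algebraMap A (DPPolynomial γ n)) : Set A) ∧
    ∃ N, (DPPolynomial.dp γ n).dpPower (Set.range (DPPolynomial.X γ n)) N ≤ J

/-- The ring `A⟨⟨t₁, …, t_n⟩⟩`: the pro-DP-artinian completion of the divided power polynomial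
ring in which the `t_i` are topologically DP-nilpotent. -/
abbrev DPSeries : Type u := (DPPolynomial.dp γ n).Completion (DPPolynomial.IsAdmissible γ n)

/-- The divided power structure of `A⟨⟨t₁, …, t_n⟩⟩`. -/
noncomputable abbrev DPSeries.dp : DividedPowers (DividedPowers.Completion.ideal
    (DPPolynomial.dp γ n) (DPPolynomial.IsAdmissible γ n)) :=
  DividedPowers.Completion.dividedPowers _ _

/-- The canonical map `A → A⟨⟨t₁, …, t_n⟩⟩`. -/
noncomputable def DPSeries.C : A →+* DPSeries γ n :=
  (DividedPowers.Completion.of _ _).comp (algebraMap A (DPPolynomial γ n))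

/-- The variable `t_i` in `A⟨⟨t₁, …, t_n⟩⟩`. -/
noncomputable def DPSeries.X (i : Fin n) : DPSeries γ n :=
  DividedPowers.Completion.of _ _ (DPPolynomial.X γ n i)

end series

/-! ### Height one smoothness and formal smoothness -/

/-- The ideal `I^(p)` generated by the `p`-th powers of the elements of `I`. -/
def Ideal.powIdeal {R : Type u} [CommRing R] (I : Ideal R) (p : ℕ) : Ideal R :=
  Ideal.span ((fun x => x ^ p) '' (I : Set R))

/-- The local `k`-algebra `R` with residue field `κ` is height one smooth: for some `n` there is
an isomorphism `R / 𝔪^(p) ≅ κ[t₁, …, t_n] / (t₁, …, t_n)^(p)` of `k`-algebras. -/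
def IsHeightOneSmooth (p : ℕ) (k : Type v) (R : Type u) [Field k] [CommRing R] [IsLocalRing R]
    [Algebra k R] : Prop :=
  ∃ n : ℕ, Nonempty ((R ⧸ (maximalIdeal R).powIdeal p) ≃ₐ[k]
    (MvPolynomial (Fin n) (ResidueField R) ⧸
      (Ideal.span (Set.range (MvPolynomial.X : Fin n → MvPolynomial (Fin n) (ResidueField R)))).powIdeal p))

/-- Formal smoothness of `f : A → R` for the adic topology of the local ring `R`: every continuous
`A`-homomorphism from `R` to a discrete ring `C / N` with `N² = 0` lifts to `C`. -/
def IsAdicFormallySmooth {A : Type v} {R : Type u} [CommRing A] [CommRing R] [IsLocalRing R]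
    (f : A →+* R) : Prop :=
  ∀ (C : Type (max u v)) [CommRing C] (a : A →+* C) (N : Ideal C), N ^ 2 = ⊥ →
    ∀ g : R →+* C ⧸ N, g.comp f = (Ideal.Quotient.mk N).comp a →
      (∃ m : ℕ, ∀ x ∈ maximalIdeal R ^ m, g x = 0) →
      ∃ h : R →+* C, h.comp f = a ∧ (Ideal.Quotient.mk N).comp h = g

/-! ### Coordinates and derivations -/

section coordinates

/-! All three parts rest on coordinates `x_j` dual to divided power derivations `D_i`, that is `D_i
x_j = δ_ij`. Derivations that are dual to the `x_j` only modulo the maximal ideal are corrected by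
the inverse of the Jacobian matrix (`exists_dual_derivations`).

(i) Transversality and Nakayama give a frame `D_i` of the foliation dual to elements `t_i` of `ker
π` (`exists_dual_frame`). Evaluating `[D_i, D_j] = ∑ c_l D_l` at `t_l` gives `c_l = 0`, so the frame
commutes. For a single `D` with `D t = 1`, the Taylor series `P r = ∑ γ_m(-t) D^m r` converges since
`t` is topologically DP-nilpotent. It is a continuous ring projection onto `ker D` that kills
`γ_m(t)` for `m ≠ 0` (`IsProDPArtin.exists_projection`). Composing over the frame gives a divided
power retraction of `R` onto the invariants, which therefore inherit the structure of `R`. As `r - P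
r` lies in the ideal of the `γ_m(t_i)` up to small elements, every `r` is a limit of divided power
polynomials over the invariants. The functionals `P ∘ D^β` read off the coefficients continuously,
so these expansions are unique and the topologies agree (`IsDPCoordinates.exists_equiv`).

(ii) In the hull over `k` one has `x^p = p! γ_p(x) = 0` on the divided power ideal, so `A = Λ/𝔪^(p)`
maps to it. As `κ` is separable over `k`, it lifts to `A` and is killed by all `k`-derivations.
Coordinates give a surjection `κ[t] → A`. If `f` is in its kernel, then `f` vanishes at `x` in the
hull; applying the `D_i` shows that all partial derivatives of `f` vanish there, hence so do their
constant terms `β! c_β`. When all `β_i < p` the factor `β!` is invertible, and what is left of `f`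
lies in `(t)^(p)`.

(iii) Coordinates of `R` over `Λ₀` give `φ : Λ₀[t] → R`, surjective modulo every power of `𝔪_R`. If
`φ p ∈ 𝔪^s`, successive corrections from `𝔫^s`, with `𝔫 = (𝔪_{Λ₀}, t)`, give polynomials `P_k` with
`φ (P_k) → 0`. The `D_i` are continuous, so all derivatives of the `P_k` tend to zero at `x` in the
completed hull of `R`, hence also in that of `Λ₁`. There the Taylor formula with divided powers
moves the point to the origin: `β!` times the limit `L` of the coefficients at `β` is zero. Slight
ramification brings this back to `Λ₀`, torsion-freeness gives `L = 0`, and so `p ∈ 𝔫^s`. Thus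
`Λ₀[t]/𝔫^s ≅ R/𝔪^s` for all `s`, and formal smoothness follows by lifting the coordinates
(`isAdicFormallySmooth_of_pow`). -/

/-- The chain rule; with dual coordinates it turns `D j` into the partial derivative `∂_j`. -/
theorem Derivation.map_mvPolynomial_aeval {ι S Λ G : Type*} [Fintype ι] [DecidableEq ι]
    [CommRing S] [CommRing Λ] [CommRing G] [Algebra S G] [Algebra Λ G] (D : Derivation Λ G G)
    (hD : ∀ s : S, D (algebraMap S G s) = 0) (x : ι → G) (f : MvPolynomial ι S) :
    D (MvPolynomial.aeval x f) = ∑ j, MvPolynomial.aeval x (MvPolynomial.pderiv j f) * D (x j) := by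
  induction f using MvPolynomial.induction_on with
  | C a => simp [hD]
  | add p q hp hq => simp only [map_add, hp, hq, add_mul, Finset.sum_add_distrib]
  | mul_X p i hp =>
    rw [map_mul, Derivation.leibniz, hp, MvPolynomial.aeval_X, smul_eq_mul, smul_eq_mul,
      Finset.mul_sum]
    simp only [Derivation.leibniz, MvPolynomial.pderiv_X, map_add, smul_eq_mul, map_mul,
      MvPolynomial.aeval_X, add_mul, Finset.sum_add_distrib]
    congr 1
    · rw [Finset.sum_eq_single i]
      · simp
      · intro j _ hj
        simp [hj]
      · simp
    · exact Finset.sum_congr rfl fun j _ => by ring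

/-- The matrix `M = (D i (x j))` is the identity modulo `I`, so its determinant is `1` modulo the
Jacobson radical and hence a unit. The rows of `M⁻¹` combine the `D i` into dual derivations with
the same span. -/
theorem exists_dual_derivations {ι Λ G : Type*} [Fintype ι] [DecidableEq ι] [CommRing Λ]
    [CommRing G] [Algebra Λ G] (F : Submodule G (Derivation Λ G G)) {I : Ideal G}
    (hI : I ≤ (⊥ : Ideal G).jacobson) (x : ι → G) (D : ι → Derivation Λ G G) (hD : ∀ i, D i ∈ F)
    (h : ∀ i j, D i (x j) - (if i = j then 1 else 0) ∈ I) :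
    ∃ E : ι → Derivation Λ G G, (∀ i, E i ∈ Submodule.span G (Set.range D)) ∧ (∀ i, E i ∈ F) ∧
      (∀ i, D i ∈ Submodule.span G (Set.range E)) ∧
      ∀ i j, E i (x j) = if i = j then 1 else 0 := by
  set M : Matrix ι ι G := Matrix.of fun i j => D i (x j) with hM
  have h1 : (Ideal.Quotient.mk I).mapMatrix M = 1 := by
    ext i j
    rw [RingHom.mapMatrix_apply, Matrix.map_apply, hM, Matrix.of_apply, Matrix.one_apply,
      Ideal.Quotient.eq.2 (h i j), apply_ite (Ideal.Quotient.mk I), map_one, map_zero]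
  have h2 : IsUnit M.det := by
    have h3 : M.det - 1 ∈ I := by
      rw [← Ideal.Quotient.eq_zero_iff_mem, map_sub, RingHom.map_det, h1, Matrix.det_one, map_one,
        sub_self]
    simpa using Ideal.mem_jacobson_bot.1 (hI h3) 1
  have key : ∀ (N : Matrix ι ι G) (i j), (∑ k, N i k • D k) (x j) = (N * M) i j := by
    intro N i j
    rw [Matrix.mul_apply, ← Derivation.coeFnAddMonoidHom_apply, map_sum, Finset.sum_apply]
    rfl
  have hspan : ∀ (N : Matrix ι ι G) (D : ι → Derivation Λ G G) i,
      ∑ k, N i k • D k ∈ Submodule.span G (Set.range D) := fun N D i =>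
    Submodule.sum_mem _ fun k _ => Submodule.smul_mem _ _ (Submodule.subset_span ⟨k, rfl⟩)
  refine ⟨fun i => ∑ k, M⁻¹ i k • D k, fun i => hspan _ _ i, fun i => ?_, fun i => ?_,
    fun i j => ?_⟩
  · exact Submodule.sum_mem _ fun k _ => Submodule.smul_mem _ _ (hD k)
  · have h4 : D i = ∑ k, M i k • ∑ l, M⁻¹ k l • D l := by
      simp only [Finset.smul_sum, smul_smul]
      rw [Finset.sum_comm]
      simp only [← Finset.sum_smul, ← Matrix.mul_apply, Matrix.mul_nonsing_inv M h2]
      rw [Finset.sum_eq_single i]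
      · simp
      · intro j _ hj
        rw [Matrix.one_apply_ne hj.symm, zero_smul]
      · simp
    rw [h4]
    exact hspan M _ i
  · rw [key, Matrix.nonsing_inv_mul M h2, Matrix.one_apply]

/-- A system of coordinates of a local ring modulo an ideal `𝔞` that contains `𝔪 ^ 2`. -/
theorem exists_coordinates {R : Type u} [CommRing R] [IsLocalRing R] (hm : (maximalIdeal R).FG)
    (𝔞 : Ideal R) (h2 : maximalIdeal R ^ 2 ≤ 𝔞) :
    ∃ (n : ℕ) (x : Fin n → maximalIdeal R) (ψ : Fin n → maximalIdeal R →ₗ[R] ResidueField R),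
      (∀ m ∈ maximalIdeal R, m ∈ Ideal.span (Set.range fun i => (x i : R)) ⊔ 𝔞) ∧
      (∀ i (m : maximalIdeal R), (m : R) ∈ 𝔞 → ψ i m = 0) ∧
      ∀ i j, ψ i (x j) = if i = j then 1 else 0 := by
  have hfin : Module.Finite R (maximalIdeal R) := Module.Finite.iff_fg.2 hm
  have hfin' : Module.Finite R (CotangentSpace R) :=
    Module.Finite.of_surjective _ (maximalIdeal R).toCotangent_surjective
  have hfin'' : Module.Finite (ResidueField R) (CotangentSpace R) :=
    Module.Finite.of_restrictScalars_finite R _ _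
  -- The image of `𝔞` in the cotangent space; `R` acts there through the residue field, so this is
  -- also a subspace `W`. The coordinates lift a basis of the quotient by `W`.
  set W₀ : Submodule R (CotangentSpace R) :=
    (Submodule.comap (maximalIdeal R).subtype 𝔞).map (maximalIdeal R).toCotangent with hW₀
  set W : Submodule (ResidueField R) (CotangentSpace R) :=
    { W₀ with
      smul_mem' := fun c v hv => by
        obtain ⟨r, rfl⟩ := IsLocalRing.residue_surjective c
        rw [← ResidueField.algebraMap_eq, algebraMap_smul]
        exact W₀.smul_mem r hv } with hW
  have hmemW : ∀ v, v ∈ W ↔ ∃ m : maximalIdeal R, (m : R) ∈ 𝔞 ∧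
      (maximalIdeal R).toCotangent m = v := fun v => Iff.rfl
  let b := Module.finBasis (ResidueField R) (CotangentSpace R ⧸ W)
  let pr : maximalIdeal R →ₗ[R] CotangentSpace R ⧸ W :=
    (W.mkQ.restrictScalars R).comp (maximalIdeal R).toCotangent
  have hpr : Function.Surjective pr :=
    W.mkQ_surjective.comp (maximalIdeal R).toCotangent_surjective
  choose x hx using fun i => hpr (b i)
  have hpr0 : ∀ m : maximalIdeal R, pr m = 0 ↔ (m : R) ∈ 𝔞 := by
    intro m
    refine (Submodule.Quotient.mk_eq_zero W).trans ((hmemW _).trans ⟨?_, fun h => ⟨m, h, rfl⟩⟩)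
    rintro ⟨a, ha, h⟩
    rw [Ideal.toCotangent_eq] at h
    -- Elements with the same cotangent vector differ by `𝔪 ^ 2`, which lies in `𝔞`.
    have := sub_mem ha (h2 h)
    simpa using this
  refine ⟨_, x, fun i => ((b.coord i).restrictScalars R).comp pr, fun m hm => ?_, fun i m hm => ?_,
    fun i j => ?_⟩
  · choose c hc using fun i => IsLocalRing.residue_surjective (b.repr (pr ⟨m, hm⟩) i)
    have h3 : pr (⟨m, hm⟩ - ∑ i, c i • x i) = 0 := by
      rw [map_sub, map_sum, sub_eq_zero]
      conv_lhs => rw [← b.sum_repr (pr ⟨m, hm⟩)]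
      refine Finset.sum_congr rfl fun i _ => ?_
      rw [map_smul, hx, ← hc, ← ResidueField.algebraMap_eq, algebraMap_smul]
    rw [hpr0] at h3
    rw [Submodule.mem_sup]
    refine ⟨∑ i, c i * x i, Submodule.sum_mem _ fun i _ => Ideal.mul_mem_left _ _
      (Ideal.subset_span ⟨i, rfl⟩), _, h3, ?_⟩
    simp
  · rw [LinearMap.comp_apply, (hpr0 m).2 hm, map_zero]
  · rw [LinearMap.comp_apply, hx]
    simp [Finsupp.single_apply, eq_comm]

end coordinates

/-! ### Lifting tangent vectors to divided power derivations -/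

section squareZero

variable {G : Type u} [CommRing G] {I : Ideal G} (γ : DividedPowers I)

/-- In a generator of degree at least `2` there is either a factor `γ_n` with `n ≥ 2`, which dies in
`Q`, or there are two factors `γ_1`, whose product falls into `K ^ 2 = ⊥`. -/
theorem DividedPowers.IsDPMorphism.apply_eq_zero_of_mem_dpPower {Q : Type v} [CommRing Q]
    {K : Ideal Q} {δ : DividedPowers K} {γ : DividedPowers I} (hK : K ^ 2 = ⊥)
    (hδ : ∀ n, 2 ≤ n → ∀ x ∈ K, δ.dpow n x = 0)
    {q : G →+* Q} (hq : γ.IsDPMorphism δ q) {y : G} (hy : y ∈ γ.dpPower (I : Set G) 2) :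
    q y = 0 := by
  -- The bound for degree one is carried along for the case of a leading factor `γ_1`: there the
  -- rest of the list has degree at least one and contributes the second factor from `K`.
  have key : ∀ l : List (ℕ × G), (∀ p ∈ l, p.2 ∈ I) →
      (1 ≤ (l.map Prod.fst).sum → q (l.map fun p => γ.dpow p.1 p.2).prod ∈ K) ∧
      (2 ≤ (l.map Prod.fst).sum → q (l.map fun p => γ.dpow p.1 p.2).prod = 0) := by
    intro l
    induction l with
    | nil => simp
    | cons p l ih =>
      intro hl
      obtain ⟨n, x⟩ := p
      have hx : x ∈ I := hl (n, x) (by simp)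
      have hqx : q x ∈ K := hq.ideal_comp (Ideal.mem_map_of_mem _ hx)
      obtain ⟨h1, h2⟩ := ih fun p hp => hl p (by simp [hp])
      simp only [List.map_cons, List.sum_cons, List.prod_cons, map_mul]
      rw [hq.map_dpow hx]
      rcases n with _ | _ | n
      · rw [δ.dpow_zero hqx, one_mul, zero_add]
        exact ⟨h1, h2⟩
      · rw [zero_add, δ.dpow_one hqx]
        refine ⟨fun _ => K.mul_mem_right _ hqx, fun h => ?_⟩
        have h3 := Ideal.mul_mem_mul hqx (h1 (by omega))
        rwa [← sq, hK] at h3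
      · rw [hδ (n + 1 + 1) (by omega) _ hqx, zero_mul]
        exact ⟨fun _ => zero_mem _, fun _ => rfl⟩
  have hle : γ.dpPower (I : Set G) 2 ≤ RingHom.ker q := by
    refine Ideal.span_le.2 ?_
    rintro _ ⟨l, hl, h2, rfl⟩
    exact (key l hl).2 h2
  exact hle hy

/-- A tangent vector of `R` that vanishes on `𝔞` extends to `G` if `R ⧸ 𝔞` is a quotient of `G`. -/
theorem exists_extend_tangent {R : Type v} [CommRing R] [IsLocalRing R] (e : R →+* G) {𝔞 : Ideal R}
    (q : G →+* R ⧸ 𝔞) (hqe : ∀ r, q (e r) = Ideal.Quotient.mk 𝔞 r) (hker : RingHom.ker q ≤ I)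
    (hqI : ∀ y ∈ I, q y ∈ (maximalIdeal R).map (Ideal.Quotient.mk 𝔞))
    (heI : ∀ m ∈ maximalIdeal R, e m ∈ I)
    (ψ : maximalIdeal R →ₗ[R] ResidueField R)
    (hψ : ∀ m : maximalIdeal R, (m : R) ∈ 𝔞 → ψ m = 0) :
    ∃ φ : I →ₗ[G] G ⧸ I, (∀ y : I, q y = 0 → φ y = 0) ∧
      ∀ (m : maximalIdeal R) (r : R), ψ m = residue R r →
        φ ⟨e m, heI m m.2⟩ = Ideal.Quotient.mk I (e r) := by
  let ρ : ResidueField R →+* G ⧸ I := Ideal.Quotient.lift (maximalIdeal R)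
    ((Ideal.Quotient.mk I).comp e) fun a ha => Ideal.Quotient.eq_zero_iff_mem.2 (heI a ha)
  have hρ : ∀ r, ρ (residue R r) = Ideal.Quotient.mk I (e r) := fun r => rfl
  have hex : ∀ y : I, ∃ m : maximalIdeal R, Ideal.Quotient.mk 𝔞 (m : R) = q y := by
    intro y
    obtain ⟨m, hm, h⟩ := (Ideal.mem_map_iff_of_surjective _ Ideal.Quotient.mk_surjective).1
      (hqI y y.2)
    exact ⟨⟨m, hm⟩, h⟩
  choose μ hμ using hex
  -- Two lifts of `q y` to `𝔪` differ by an element of `𝔞`, where `ψ` vanishes.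
  have hwd : ∀ (y : I) (m : maximalIdeal R), Ideal.Quotient.mk 𝔞 (m : R) = q y →
      ψ (μ y) = ψ m := by
    intro y m hm
    rw [← sub_eq_zero, ← map_sub]
    refine hψ _ ?_
    rw [← hμ, Ideal.Quotient.eq] at hm
    have := neg_mem hm
    simpa using this
  refine ⟨{ toFun := fun y => ρ (ψ (μ y)), map_add' := fun y z => ?_, map_smul' := fun g y => ?_ },
    fun y hy => ?_, fun m r hr => ?_⟩
  · rw [hwd (y + z) (μ y + μ z) (by simp [hμ]), map_add, map_add]
  · obtain ⟨b, hb⟩ := Ideal.Quotient.mk_surjective (q g)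
    -- Linearity over `G`, not only over `R`: `g` and `e b` have the same image under `q`, and the
    -- kernel of `q` lies in `I`.
    have hg : Ideal.Quotient.mk I g = Ideal.Quotient.mk I (e b) := by
      rw [Ideal.Quotient.eq]
      apply hker
      rw [RingHom.mem_ker, map_sub, hqe, hb, sub_self]
    rw [hwd (g • y) (b • μ y) (by simp [hμ, hb]), map_smul, RingHom.id_apply, Algebra.smul_def,
      map_mul, Algebra.smul_def, Ideal.Quotient.algebraMap_eq, hg]
    rfl
  · change ρ (ψ (μ y)) = 0
    rw [hwd y 0 (by simp [hy]), map_zero, map_zero]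
  · change ρ (ψ (μ _)) = _
    rw [hwd _ m (by simp [hqe]), hr, hρ]

/-- Coordinates of the local ring `R` are coordinates of the divided power ring `G` if the latter
is tangent smooth. -/
theorem IsDPTangentSmooth.exists_derivations {Λ : Type w} [CommRing Λ] [Algebra Λ G]
    [TopologicalSpace G] [IsTopologicalRing G] {J : Ideal Λ} {γ : DividedPowers I}
    (h : IsDPTangentSmooth Λ J γ) (hjac : I ≤ (⊥ : Ideal G).jacobson)
    {R : Type v} [CommRing R] [IsLocalRing R] (e : R →+* G) {𝔞 : Ideal R}
    (h2 : maximalIdeal R ^ 2 ≤ 𝔞)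
    (q : G →+* R ⧸ 𝔞) (hqe : ∀ r, q (e r) = Ideal.Quotient.mk 𝔞 r) (hker : RingHom.ker q ≤ I)
    {δ : DividedPowers ((maximalIdeal R).map (Ideal.Quotient.mk 𝔞))}
    (hδ : ∀ n, 2 ≤ n → ∀ x ∈ (maximalIdeal R).map (Ideal.Quotient.mk 𝔞), δ.dpow n x = 0)
    (hq : γ.IsDPMorphism δ q) (hopen : IsOpen (RingHom.ker q : Set G))
    (hJ : ∀ a ∈ J, q (algebraMap Λ G a) = 0)
    (heI : ∀ m ∈ maximalIdeal R, e m ∈ I) {n : ℕ} (x : Fin n → maximalIdeal R)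
    (ψ : Fin n → maximalIdeal R →ₗ[R] ResidueField R)
    (hψ : ∀ i (m : maximalIdeal R), (m : R) ∈ 𝔞 → ψ i m = 0)
    (hx : ∀ i j, ψ i (x j) = if i = j then 1 else 0) :
    ∃ D : Fin n → Derivation Λ G G, (∀ i, D i ∈ dpTangent Λ γ) ∧
      ∀ i j, D i (e (x j)) = if i = j then 1 else 0 := by
  have hqI : ∀ y ∈ I, q y ∈ (maximalIdeal R).map (Ideal.Quotient.mk 𝔞) := fun y hy =>
    hq.ideal_comp (Ideal.mem_map_of_mem _ hy)
  have hK : ((maximalIdeal R).map (Ideal.Quotient.mk 𝔞)) ^ 2 = ⊥ := by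
    rw [← Ideal.map_pow, Ideal.map_eq_bot_iff_le_ker, Ideal.mk_ker]
    exact h2
  choose φ hφ0 hφ using fun i => exists_extend_tangent e q hqe hker hqI heI (ψ i) (hψ i)
  have hlift : ∀ i, ∃ D ∈ dpTangent Λ γ, ∀ x : I, φ i x = Ideal.Quotient.mk I (D x) := by
    intro i
    refine h.lifts (φ i) ?_ (fun y hy => hφ0 i y (hq.apply_eq_zero_of_mem_dpPower hK hδ hy))
      fun a ha y hy => hφ0 i y (by rw [hy, hJ a ha])
    have h3 : {y : I | φ i y = 0} = ((LinearMap.ker (φ i)).toAddSubgroup : Set I) := rfl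
    rw [h3]
    refine AddSubgroup.isOpen_mono
      (H₁ := (RingHom.ker q).toAddSubgroup.comap I.subtype.toAddMonoidHom) ?_ ?_
    · intro y hy
      exact hφ0 i y hy
    · exact hopen.preimage continuous_subtype_val
  choose D hD hDφ using hlift
  -- The lifts are dual to the coordinates only modulo `I`; the inverse Jacobian makes the duality
  -- exact.
  obtain ⟨E, -, hE, -, hEx⟩ := exists_dual_derivations (dpTangent Λ γ) hjac (fun j => e (x j)) D hD
    fun i j => by
      rw [← Ideal.Quotient.eq, ← hDφ i ⟨e (x j), heI _ (x j).2⟩,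
        hφ i (x j) (if i = j then 1 else 0) (by rw [hx]; split_ifs <;> simp)]
      split_ifs <;> simp
  exact ⟨E, hE, hEx⟩

end squareZero

/-! ### Coefficients as constant terms of derivatives -/

section pderiv

/-- If the constant terms of the members of a set of families of polynomials that is stable under
partial derivatives have a property, then so have all their coefficients, up to factorials. -/
theorem MvPolynomial.forall_factorial_mul_coeff {ι S M : Type*} [Fintype ι] [CommRing S]
    (N : Set (M → MvPolynomial ι S))
    (hN : ∀ f ∈ N, ∀ j, (fun a => MvPolynomial.pderiv j (f a)) ∈ N) (P : (M → S) → Prop)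
    (h0 : ∀ f ∈ N, P fun a => MvPolynomial.constantCoeff (f a)) (β : ι →₀ ℕ) :
    ∀ f ∈ N, P fun a => ((∏ j, (β j).factorial : ℕ) : S) * MvPolynomial.coeff β (f a) := by
  classical
  obtain ⟨d, hd⟩ : ∃ d, β.degree = d := ⟨_, rfl⟩
  induction d generalizing β with
  | zero =>
    rw [Finsupp.degree_eq_zero_iff] at hd
    subst hd
    intro f hf
    simpa [MvPolynomial.constantCoeff_eq] using h0 f hf
  | succ d ih =>
    obtain ⟨i, hi⟩ : ∃ i, β i ≠ 0 := by
      by_contra! h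
      have : β = 0 := Finsupp.ext h
      simp [this] at hd
    obtain ⟨β, rfl⟩ : ∃ β', β = β' + Finsupp.single i 1 :=
      ⟨β - Finsupp.single i 1, (tsub_add_cancel_of_le (by
        rw [Finsupp.single_le_iff]; omega)).symm⟩
    intro f hf
    -- The coefficient of `∂_i f` at `β` is `β i + 1` times that of `f` at `β + e_i`, which is the
    -- quotient of the two factorials.
    have h1 := ih β (by rw [map_add, Finsupp.degree_single] at hd; omega) _ (hN f hf i)
    have h2 : ∏ j, ((β + Finsupp.single i 1 : ι →₀ ℕ) j).factorial =
        (∏ j, (β j).factorial) * (β i + 1) := by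
      rw [← Finset.mul_prod_erase _ _ (Finset.mem_univ i),
        ← Finset.mul_prod_erase Finset.univ (fun j => (β j).factorial) (Finset.mem_univ i)]
      simp only [Finsupp.add_apply, Finsupp.single_eq_same, Nat.factorial_succ]
      rw [Finset.prod_congr rfl (g := fun j => (β j).factorial) fun j hj => by
        rw [Finsupp.single_eq_of_ne (Finset.ne_of_mem_erase hj), add_zero]]
      ring
    convert h1 using 2 with a
    rw [MvPolynomial.coeff_pderiv, h2]
    push_cast
    ring

theorem MvPolynomial.sub_C_constantCoeff_mem {ι S : Type*} [CommRing S] (f : MvPolynomial ι S) :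
    f - MvPolynomial.C (MvPolynomial.constantCoeff f) ∈
      Ideal.span (Set.range (MvPolynomial.X : ι → MvPolynomial ι S)) := by
  induction f using MvPolynomial.induction_on with
  | C a => simp
  | add f g hf hg =>
    rw [map_add, map_add, add_sub_add_comm]
    exact add_mem hf hg
  | mul_X f i _ =>
    rw [map_mul, MvPolynomial.constantCoeff_X, mul_zero, map_zero, sub_zero]
    exact Ideal.mul_mem_left _ _ (Ideal.subset_span ⟨i, rfl⟩)

end pderiv

/-! ### Successive approximation along powers of an ideal -/

section approximation

variable {A R : Type*} [CommRing A] [CommRing R] (φ : A →+* R) {𝔫 : Ideal A} {𝔪 : Ideal R}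

/-- The graded ring of `𝔪` is generated in degree one, so surjectivity of the associated graded map
in degrees `0` and `1` implies it in all degrees. -/
theorem exists_sub_mem_pow_succ (h0 : ∀ r, ∃ p, r - φ p ∈ 𝔪) (h1 : 𝔪 ≤ 𝔫.map φ ⊔ 𝔪 ^ 2)
    (h2 : 𝔫.map φ ≤ 𝔪) (s : ℕ) : ∀ m ∈ 𝔪 ^ s, ∃ p ∈ 𝔫 ^ s, m - φ p ∈ 𝔪 ^ (s + 1) := by
  -- Degree one: a coefficient from `R` is replaced by one from `A` at the cost of an error in `𝔪 *
  -- 𝔪`.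
  have hb : ∀ m ∈ 𝔪, ∃ p ∈ 𝔫, m - φ p ∈ 𝔪 ^ 2 := by
    intro m hm
    obtain ⟨a, ha, b, hb, rfl⟩ := Submodule.mem_sup.1 (h1 hm)
    suffices h : ∃ p ∈ 𝔫, a - φ p ∈ 𝔪 ^ 2 by
      obtain ⟨p, hp, h⟩ := h
      exact ⟨p, hp, by rw [add_sub_right_comm]; exact add_mem h hb⟩
    clear hm
    induction ha using Submodule.span_induction with
    | mem x hx =>
      obtain ⟨q, hq, rfl⟩ := hx
      exact ⟨q, hq, by simp⟩
    | zero => exact ⟨0, zero_mem _, by simp⟩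
    | add x y _ _ hx hy =>
      obtain ⟨p, hp, hx⟩ := hx
      obtain ⟨q, hq, hy⟩ := hy
      exact ⟨p + q, add_mem hp hq, by rw [map_add, add_sub_add_comm]; exact add_mem hx hy⟩
    | smul r x hx' hx =>
      obtain ⟨p, hp, hx⟩ := hx
      obtain ⟨q, hq⟩ := h0 r
      refine ⟨q * p, Ideal.mul_mem_left _ _ hp, ?_⟩
      have : r • x - φ (q * p) = φ q * (x - φ p) + (r - φ q) * x := by
        rw [map_mul, smul_eq_mul]; ring
      rw [this]
      refine add_mem (Ideal.mul_mem_left _ _ hx) ?_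
      rw [sq]
      exact Ideal.mul_mem_mul hq (h2 hx')
  induction s with
  | zero =>
    intro m _
    obtain ⟨p, hp⟩ := h0 m
    exact ⟨p, by simp, by simpa using hp⟩
  | succ s ih =>
    intro m hm
    rw [pow_succ] at hm
    induction hm using Submodule.mul_induction_on' with
    | mem_mul_mem a ha b hb' =>
      obtain ⟨p, hp, h3⟩ := ih a ha
      obtain ⟨q, hq, h4⟩ := hb b hb'
      refine ⟨p * q, by rw [pow_succ]; exact Ideal.mul_mem_mul hp hq, ?_⟩
      have : a * b - φ (p * q) = (a - φ p) * b + φ p * (b - φ q) := by rw [map_mul]; ring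
      rw [this]
      refine add_mem ?_ ?_
      · rw [pow_succ]; exact Ideal.mul_mem_mul h3 hb'
      · have h5 : φ p ∈ 𝔪 ^ s := by
          have := Ideal.mem_map_of_mem φ hp
          rw [Ideal.map_pow] at this
          exact Ideal.pow_right_mono h2 s this
        rw [add_assoc, pow_add]
        exact Ideal.mul_mem_mul h5 h4
    | add x _ y _ hx hy =>
      obtain ⟨p, hp, hx⟩ := hx
      obtain ⟨q, hq, hy⟩ := hy
      exact ⟨p + q, add_mem hp hq, by rw [map_add, add_sub_add_comm]; exact add_mem hx hy⟩

theorem exists_sub_mem_pow (h0 : ∀ r, ∃ p, r - φ p ∈ 𝔪) (h1 : 𝔪 ≤ 𝔫.map φ ⊔ 𝔪 ^ 2)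
    (h2 : 𝔫.map φ ≤ 𝔪) (s : ℕ) (r : R) : ∃ p, r - φ p ∈ 𝔪 ^ s := by
  induction s with
  | zero => exact ⟨0, by simp⟩
  | succ s ih =>
    obtain ⟨p, hp⟩ := ih
    obtain ⟨q, _, hq⟩ := exists_sub_mem_pow_succ φ h0 h1 h2 s _ hp
    exact ⟨p + q, by rw [map_add, ← sub_sub]; exact hq⟩

end approximation

/-! ### Square zero quotients of the hull -/

section hull

variable {S : Type v} {R : Type u} [CommRing S] [CommRing R] [IsLocalRing R] [Algebra S R]

theorem DividedPowers.dpow_map_bot {C : Type w} [CommRing C] {K : Ideal C} (δ : DividedPowers K)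
    (g : S →+* C) (n : ℕ) {a : S} (ha : a ∈ (⊥ : Ideal S)) :
    δ.dpow n (g a) = g ((dividedPowersBot S).dpow n a) := by
  rw [Ideal.mem_bot] at ha
  subst ha
  rcases eq_or_ne n 0 with rfl | hn
  · rw [(dividedPowersBot S).dpow_zero (zero_mem _), map_zero, map_one, δ.dpow_zero (zero_mem _)]
  · rw [(dividedPowersBot S).dpow_eval_zero hn, map_zero, δ.dpow_eval_zero hn]

variable (S) in
/-- The projection of the hull of a local ring to a quotient with square zero maximal ideal. -/
theorem DPHull.exists_squareZero {𝔞 : Ideal R} (h2 : maximalIdeal R ^ 2 ≤ 𝔞)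
    (ha : 𝔞 ≤ maximalIdeal R) :
    ∃ (δ : DividedPowers ((maximalIdeal R).map (Ideal.Quotient.mk 𝔞)))
      (q : DPHull (dividedPowersBot S) (maximalIdeal R) →+* R ⧸ 𝔞),
      (∀ n, 2 ≤ n → ∀ x ∈ (maximalIdeal R).map (Ideal.Quotient.mk 𝔞), δ.dpow n x = 0) ∧
      (∀ r, q (DPHull.of _ _ r) = Ideal.Quotient.mk 𝔞 r) ∧
      RingHom.ker q ≤ DPHull.ideal (dividedPowersBot S) (maximalIdeal R) ∧
      (DPHull.dividedPowers (dividedPowersBot S) (maximalIdeal R)).IsDPMorphism δ q := by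
  classical
  have hK : ((maximalIdeal R).map (Ideal.Quotient.mk 𝔞)) ^ 2 = 0 := by
    rw [← Ideal.map_pow, Ideal.zero_eq_bot, Ideal.map_eq_bot_iff_le_ker, Ideal.mk_ker]
    exact h2
  let δ := DividedPowers.OfSquareZero.dividedPowers hK
  have hg : maximalIdeal R ≤
      ((maximalIdeal R).map (Ideal.Quotient.mk 𝔞)).comap (Ideal.Quotient.mk 𝔞) :=
    Ideal.le_comap_map
  have hb : ∀ n, ∀ a ∈ (⊥ : Ideal S), δ.dpow n (Ideal.Quotient.mk 𝔞 (algebraMap S R a)) =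
      Ideal.Quotient.mk 𝔞 (algebraMap S R ((dividedPowersBot S).dpow n a)) := fun n a ha =>
    δ.dpow_map_bot ((Ideal.Quotient.mk 𝔞).comp (algebraMap S R)) n ha
  have hq := DPHull.lift_isDPMorphism δ (Ideal.Quotient.mk 𝔞) hg hb
  refine ⟨δ, DPHull.lift δ (Ideal.Quotient.mk 𝔞) hg hb,
    fun n hn x _ => DividedPowers.OfSquareZero.dpow_of_two_le hK hn x, fun r => rfl, ?_, hq⟩
  intro y hy
  -- Modulo the divided power ideal `y` comes from some `b` in `R`; then `q y = 0` forces `b ∈ 𝔪`.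
  obtain ⟨b, hyb⟩ := DPHull.exists_sub_of_mem y
  have h3 := hq.ideal_comp (Ideal.mem_map_of_mem _ hyb)
  rw [RingHom.mem_ker] at hy
  rw [map_sub, hy, zero_sub, neg_mem_iff, DPHull.lift_of,
    Ideal.mem_quotient_iff_mem ha] at h3
  have := add_mem hyb (DPHull.of_mem (γ₀ := dividedPowersBot S) h3)
  simpa using this

end hull

/-! ### Height one smoothness in characteristic `p` -/

section heightOne

theorem Ideal.pow_mem_powIdeal {R : Type u} [CommRing R] {I : Ideal R} (p : ℕ) {x : R}
    (hx : x ∈ I) : x ^ p ∈ I.powIdeal p := Ideal.subset_span ⟨x, hx, rfl⟩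

theorem Ideal.powIdeal_map_le {R : Type u} {S : Type v} [CommRing R] [CommRing S] (f : R →+* S)
    {I : Ideal R} {J : Ideal S} (p : ℕ) (h : I ≤ J.comap f) :
    I.powIdeal p ≤ (J.powIdeal p).comap f := by
  refine Ideal.span_le.2 ?_
  rintro _ ⟨x, hx, rfl⟩
  change f (x ^ p) ∈ J.powIdeal p
  rw [map_pow]
  exact Ideal.pow_mem_powIdeal p (h hx)

/-- A polynomial without monomials all of whose exponents are less than `p`. -/
theorem MvPolynomial.mem_powIdeal {ι κ : Type*} [CommRing κ] {p : ℕ} {f : MvPolynomial ι κ}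
    (hf : ∀ β : ι →₀ ℕ, (∀ i, β i < p) → MvPolynomial.coeff β f = 0) :
    f ∈ (Ideal.span (Set.range (MvPolynomial.X : ι → MvPolynomial ι κ))).powIdeal p := by
  rw [f.as_sum]
  refine Submodule.sum_mem _ fun β hβ => ?_
  obtain ⟨i, hi⟩ : ∃ i, p ≤ β i := by
    by_contra! h
    exact MvPolynomial.mem_support_iff.1 hβ (hf β h)
  have h : MvPolynomial.monomial β (f.coeff β) =
      MvPolynomial.monomial (β - Finsupp.single i p) (f.coeff β) * MvPolynomial.X i ^ p := by
    rw [MvPolynomial.X_pow_eq_monomial, MvPolynomial.monomial_mul, mul_one,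
      tsub_add_cancel_of_le (Finsupp.single_le_iff.2 hi)]
  rw [h]
  exact Ideal.mul_mem_left _ _ (Ideal.pow_mem_powIdeal p (Ideal.subset_span ⟨i, rfl⟩))

variable (p : ℕ) [hp : Fact p.Prime] {k : Type v} {Λ : Type u} [Field k] [CharP k p]
  [CommRing Λ] [IsLocalRing Λ] [Algebra k Λ]

/-- `y ^ p = p! γ_p(y)`, and `p!` is zero in a `k`-algebra. -/
theorem DPHull.pow_eq_zero {y : DPHull (dividedPowersBot k) (maximalIdeal Λ)}
    (hy : y ∈ DPHull.ideal (dividedPowersBot k) (maximalIdeal Λ)) : y ^ p = 0 := by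
  have hp0 : (p : DPHull (dividedPowersBot k) (maximalIdeal Λ)) = 0 := by
    rw [← map_natCast (algebraMap k (DPHull (dividedPowersBot k) (maximalIdeal Λ))),
      CharP.cast_eq_zero, map_zero]
  rw [← (DPHull.dividedPowers (dividedPowersBot k) (maximalIdeal Λ)).factorial_mul_dpow_eq_pow hy,
    ← Nat.mul_factorial_pred hp.out.ne_zero, Nat.cast_mul, hp0, zero_mul, zero_mul]

/-- Derivations factor through the Kähler differentials, which vanish. It is applied to `κ` over
`k`. -/
theorem Derivation.eq_zero_of_formallyUnramified {K L M : Type*} [CommRing K] [CommRing L]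
    [Algebra K L] [AddCommGroup M] [Module K M] [Module L M] [IsScalarTower K L M]
    [Algebra.FormallyUnramified K L] (D : Derivation K L M) : D = 0 := by
  have := Algebra.FormallyUnramified.subsingleton_kaehlerDifferential (R := K) (A := L)
  rw [← D.liftKaehlerDifferential_comp, Subsingleton.elim D.liftKaehlerDifferential 0]
  ext
  simp

theorem IsDPTangentSmooth.isHeightOneSmooth [PerfectField k] [Module.Finite k (ResidueField Λ)]
    (hfg : (maximalIdeal Λ).FG)
    (h : IsDPTangentSmooth k ⊥ (DPHull.dividedPowers (dividedPowersBot k) (maximalIdeal Λ))) :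
    IsHeightOneSmooth p k Λ := by
  have : Algebra.IsSeparable k (ResidueField Λ) := inferInstance
  have : Algebra.FormallyEtale k (ResidueField Λ) := Algebra.FormallyEtale.of_isSeparable _ _
  set 𝔪 := maximalIdeal Λ with h𝔪
  set Γ := DPHull (dividedPowersBot k) 𝔪
  set IΓ := DPHull.ideal (dividedPowersBot k) 𝔪 with hIΓ
  obtain ⟨n, x, ψ, hspan, hψ, hx⟩ := exists_coordinates hfg (𝔪 ^ 2) le_rfl
  obtain ⟨δ, q, hδ, hqe, hker, hq⟩ := DPHull.exists_squareZero k (R := Λ) (𝔞 := 𝔪 ^ 2) le_rfl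
    (Ideal.pow_le_self two_ne_zero)
  have hnil : IΓ ≤ (⊥ : Ideal Γ).jacobson := fun y hy =>
    Ideal.radical_le_jacobson ⟨p, (DPHull.pow_eq_zero p hy : _)⟩
  obtain ⟨D, -, hDx⟩ := h.exists_derivations hnil (DPHull.of _ _) le_rfl q hqe hker hδ hq
    (isOpen_discrete _) (fun a ha => by rw [Ideal.mem_bot.1 ha, map_zero, map_zero])
    (fun m hm => DPHull.of_mem hm) x ψ hψ hx
  -- the truncation of height one
  set 𝔭 := 𝔪.powIdeal p with h𝔭
  set A := Λ ⧸ 𝔭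
  set 𝔪A : Ideal A := 𝔪.map (Ideal.Quotient.mk 𝔭) with h𝔪A
  have hAnil : IsNilpotent 𝔪A := by
    rw [Ideal.FG.isNilpotent_iff_le_nilradical (hfg.map _)]
    rw [Ideal.map_le_iff_le_comap]
    intro m hm
    refine ⟨p, ?_⟩
    rw [← map_pow, Ideal.Quotient.eq_zero_iff_mem.2 (Ideal.pow_mem_powIdeal p hm)]
    exact zero_mem _
  have h𝔭𝔪 : 𝔭 ≤ 𝔪 := by
    refine Ideal.span_le.2 ?_
    rintro _ ⟨m, hm, rfl⟩
    exact 𝔪.pow_mem_of_mem hm p hp.out.pos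
  let g : ResidueField Λ →ₐ[k] A ⧸ 𝔪A := Ideal.Quotient.liftₐ 𝔪
    ((Ideal.Quotient.mkₐ k 𝔪A).comp (Ideal.Quotient.mkₐ k 𝔭))
    fun a ha => Ideal.Quotient.eq_zero_iff_mem.2 (Ideal.mem_map_of_mem _ ha)
  -- A coefficient field: `κ` is formally smooth over `k` and `𝔪A` is nilpotent, so `g` lifts.
  let s : ResidueField Λ →ₐ[k] A := Algebra.FormallySmooth.lift 𝔪A hAnil g
  have hs : ∀ b : Λ, Ideal.Quotient.mk 𝔭 b - s (residue Λ b) ∈ 𝔪A := by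
    intro b
    rw [← Ideal.Quotient.eq, Algebra.FormallySmooth.mk_lift]
    rfl
  -- The `p`-th powers of elements of `𝔪` die in `Γ`, so relations in `A` can be tested in `Γ`, on
  -- which the derivations act.
  let a : A →ₐ[k] Γ := Ideal.Quotient.liftₐ 𝔭
      { DPHull.of (dividedPowersBot k) 𝔪 with commutes' := fun _ => rfl } fun y hy => by
    have h1 : 𝔭 ≤ RingHom.ker (DPHull.of (dividedPowersBot k) 𝔪) := by
      refine Ideal.span_le.2 ?_
      rintro _ ⟨m, hm, rfl⟩
      change DPHull.of (dividedPowersBot k) 𝔪 (m ^ p) = 0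
      rw [map_pow, DPHull.pow_eq_zero p (DPHull.of_mem hm)]
    exact h1 hy
  have ha : ∀ b, a (Ideal.Quotient.mk 𝔭 b) = DPHull.of (dividedPowersBot k) 𝔪 b := fun b => rfl
  let _ : Algebra (ResidueField Λ) A := s.toRingHom.toAlgebra
  let _ : Algebra (ResidueField Λ) Γ := (a.comp s).toRingHom.toAlgebra
  have : IsScalarTower k (ResidueField Λ) A := IsScalarTower.of_algebraMap_eq' s.comp_algebraMap.symm
  have : IsScalarTower k (ResidueField Λ) Γ :=
    IsScalarTower.of_algebraMap_eq' (a.comp s).comp_algebraMap.symm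
  -- Composed with `κ → Γ`, the derivation `D i` is a `k`-derivation of a separable extension, hence
  -- zero.
  have hDκ : ∀ i (c : ResidueField Λ), D i (algebraMap _ Γ c) = 0 := by
    intro i c
    have := ((D i).compAlgebraMap (ResidueField Λ)).eq_zero_of_formallyUnramified
    exact congrArg (fun d : Derivation k (ResidueField Λ) Γ => d c) this
  let xA : Fin n → A := fun i => Ideal.Quotient.mk 𝔭 (x i)
  let xΓ : Fin n → Γ := fun i => DPHull.of _ _ (x i : Λ)
  let Φ : MvPolynomial (Fin n) (ResidueField Λ) →ₐ[ResidueField Λ] A := MvPolynomial.aeval xA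
  have hΦa : ∀ f, a (Φ f) = MvPolynomial.aeval xΓ f := by
    let a' : A →ₐ[ResidueField Λ] Γ := { a with commutes' := fun _ => rfl }
    have : a'.comp Φ = MvPolynomial.aeval xΓ := by
      refine MvPolynomial.algHom_ext fun i => ?_
      rw [AlgHom.comp_apply, MvPolynomial.aeval_X, MvPolynomial.aeval_X]
      rfl
    exact fun f => DFunLike.congr_fun this f
  set 𝔫 := Ideal.span (Set.range (MvPolynomial.X : Fin n → MvPolynomial (Fin n) (ResidueField Λ)))
    with h𝔫
  have h𝔫le : 𝔫.map Φ.toRingHom ≤ 𝔪A := by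
    rw [h𝔫, Ideal.map_span, Ideal.span_le]
    rintro _ ⟨_, ⟨i, rfl⟩, rfl⟩
    change Φ (MvPolynomial.X i) ∈ 𝔪A
    rw [MvPolynomial.aeval_X]
    exact Ideal.mem_map_of_mem _ (x i).2
  have hsurj : Function.Surjective Φ := by
    obtain ⟨N, hN⟩ := hAnil
    intro r
    suffices h0 : (∀ r, ∃ f, r - Φ.toRingHom f ∈ 𝔪A) ∧ 𝔪A ≤ 𝔫.map Φ.toRingHom ⊔ 𝔪A ^ 2 by
      obtain ⟨f, hf⟩ := exists_sub_mem_pow Φ.toRingHom h0.1 h0.2 h𝔫le N r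
      rw [hN] at hf
      exact ⟨f, (sub_eq_zero.1 hf).symm⟩
    refine ⟨fun r => ?_, ?_⟩
    · obtain ⟨b, rfl⟩ := Ideal.Quotient.mk_surjective r
      refine ⟨MvPolynomial.C (residue Λ b), ?_⟩
      change _ - Φ _ ∈ _
      rw [MvPolynomial.aeval_C]
      exact hs b
    · rw [h𝔪A, Ideal.map_le_iff_le_comap]
      intro m hm
      obtain ⟨y, hy, z, hz, rfl⟩ := Submodule.mem_sup.1 (hspan m hm)
      rw [Ideal.mem_comap, map_add]
      refine add_mem (Submodule.mem_sup_left ?_) (Submodule.mem_sup_right ?_)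
      · have h1 : Ideal.span (Set.range fun i => (x i : Λ)) ≤
            (𝔫.map Φ.toRingHom).comap (Ideal.Quotient.mk 𝔭) := by
          rw [Ideal.span_le]
          rintro _ ⟨i, rfl⟩
          have := Ideal.mem_map_of_mem Φ.toRingHom (Ideal.subset_span
            (Set.mem_range_self (f := (MvPolynomial.X : Fin n → MvPolynomial (Fin n) _)) i))
          have h2 : Φ.toRingHom (MvPolynomial.X i) = Ideal.Quotient.mk 𝔭 (x i : Λ) :=
            MvPolynomial.aeval_X _ _
          rw [h2] at this
          exact this
        exact h1 hy
      · rw [← Ideal.map_pow]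
        exact Ideal.mem_map_of_mem _ hz
  have hmax : IΓ.IsMaximal := DPHull.ideal_isMaximal inferInstance bot_le
  have hkerΦ : ∀ f, Φ f = 0 → f ∈ 𝔫.powIdeal p := by
    intro f hf
    refine MvPolynomial.mem_powIdeal fun β hβ => ?_
    -- A family indexed by `Unit` is a single polynomial. The set of polynomials that vanish at `xΓ`
    -- is stable under `∂_j` because `D j` computes `∂_j` there.
    have key := MvPolynomial.forall_factorial_mul_coeff (M := Unit)
      {f | ∀ u, MvPolynomial.aeval xΓ (f u) = 0}
      (fun f hf j u => ?_) (fun c => c () = 0) (fun f hf => ?_) β (fun _ => f)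
      (fun _ => by rw [← hΦa, hf, map_zero])
    -- `β!` is prime to `p` since all exponents are less than `p`.
    · refine (mul_eq_zero.1 key).resolve_left ?_
      have : CharP (ResidueField Λ) p := charP_of_injective_algebraMap
        (algebraMap k (ResidueField Λ)).injective p
      intro h0
      rw [CharP.cast_eq_zero_iff (ResidueField Λ) p, hp.out.prime.dvd_finsetProd_iff] at h0
      revert h0
      rintro ⟨i, _, hi⟩
      exact absurd ((hp.out.dvd_factorial).1 hi) (by have := hβ i; omega)
    · have h1 := (D j).map_mvPolynomial_aeval (hDκ j) xΓ (f u)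
      rw [hf u, map_zero] at h1
      simp only [show ∀ l, D j (xΓ l) = if j = l then 1 else 0 from hDx j] at h1
      simpa using h1.symm
    -- The value at `xΓ` is zero and differs from the constant term by an element of `IΓ`; a nonzero
    -- constant term would be a unit in this proper ideal.
    · by_contra hc
      have h1 : algebraMap (ResidueField Λ) Γ (MvPolynomial.constantCoeff (f ())) ∈ IΓ := by
        have h2 := (f ()).sub_C_constantCoeff_mem
        have h3 : 𝔫 ≤ IΓ.comap (MvPolynomial.aeval xΓ).toRingHom := by
          rw [h𝔫, Ideal.span_le]
          rintro _ ⟨i, rfl⟩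
          change MvPolynomial.aeval xΓ (MvPolynomial.X i) ∈ IΓ
          rw [MvPolynomial.aeval_X]
          exact DPHull.of_mem (x i).2
        have h4 := h3 h2
        change MvPolynomial.aeval xΓ _ ∈ IΓ at h4
        rw [map_sub, hf (), zero_sub, neg_mem_iff, MvPolynomial.aeval_C] at h4
        exact h4
      exact hmax.ne_top (Ideal.eq_top_of_isUnit_mem _ h1 ((IsUnit.mk0 _ hc).map _))
  refine ⟨n, ⟨AlgEquiv.symm (AlgEquiv.ofBijective (Ideal.Quotient.liftₐ _
    (Φ.restrictScalars k) ?_) ⟨?_, ?_⟩)⟩⟩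
  · intro f hf
    have h1 : 𝔪A.powIdeal p = ⊥ := by
      rw [eq_bot_iff]
      refine Ideal.span_le.2 ?_
      rintro _ ⟨y, hy, rfl⟩
      obtain ⟨m, hm, rfl⟩ := (Ideal.mem_map_iff_of_surjective _ Ideal.Quotient.mk_surjective).1 hy
      change _ ^ p = (0 : A)
      rw [← map_pow, Ideal.Quotient.eq_zero_iff_mem]
      exact Ideal.pow_mem_powIdeal p hm
    have h2 := Ideal.powIdeal_map_le Φ.toRingHom p (Ideal.map_le_iff_le_comap.1 h𝔫le) hf
    rw [h1] at h2
    exact h2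
  · rw [injective_iff_map_eq_zero]
    intro y hy
    obtain ⟨f, rfl⟩ := Ideal.Quotient.mk_surjective y
    exact Ideal.Quotient.eq_zero_iff_mem.2 (hkerΦ f hy)
  · exact Ideal.Quotient.lift_surjective_of_surjective _ _ hsurj

end heightOne

/-! ### Taylor formula with divided powers for polynomials -/

section taylor

open MvPolynomial

variable {ι : Type*} [DecidableEq ι] {S B : Type*} [CommRing S] [CommRing B]

/-- `h m` is the Hasse derivative `∂_i^m / m!`, which exists without division. The factor `m!` that
relates it to `∂_i^m` is the one that relates `(-y)^m` to `γ_m(-y)`. -/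
theorem MvPolynomial.exists_hasse (φ : S →+* B) (y : ι → B) (i : ι) {s : ℕ}
    (hs : y i ^ (s + 1) = 0) (p : MvPolynomial ι S) :
    ∃ h : ℕ → MvPolynomial ι S, (∀ m, (pderiv i)^[m] p = (m.factorial : MvPolynomial ι S) * h m) ∧
      eval₂Hom φ (Function.update y i 0) p =
        ∑ m ∈ Finset.range (s + 1), (-y i) ^ m * eval₂Hom φ y (h m) := by
  induction p using MvPolynomial.induction_on with
  | C a =>
    refine ⟨fun m => if m = 0 then C a else 0, fun m => ?_, ?_⟩
    · rcases m with _ | m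
      · simp
      · rw [Function.iterate_succ_apply, pderiv_C, iterate_map_zero]
        simp
    · rw [Finset.sum_range_succ']
      simp
  | add p q hp hq =>
    obtain ⟨h, hp, hp'⟩ := hp
    obtain ⟨g, hq, hq'⟩ := hq
    refine ⟨h + g, fun m => ?_, ?_⟩
    · rw [iterate_map_add, hp, hq, Pi.add_apply, mul_add]
    · rw [map_add, hp', hq', ← Finset.sum_add_distrib]
      simp only [Pi.add_apply, map_add, mul_add]
  | mul_X p j hp =>
    obtain ⟨h, hp, hp'⟩ := hp
    rcases eq_or_ne j i with rfl | hj
    · have hD : ∀ m, (pderiv j)^[m + 1] (p * X j) =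
          (pderiv j)^[m + 1] p * X j + ((m + 1 : ℕ) : MvPolynomial ι S) * (pderiv j)^[m] p := by
        intro m
        induction m with
        | zero => simp [Derivation.leibniz, mul_comm, add_comm]
        | succ m ih =>
          rw [Function.iterate_succ_apply', ih, map_add, Derivation.leibniz, Derivation.leibniz,
            pderiv_X_self, Derivation.map_natCast, Function.iterate_succ_apply' _ (m + 1),
            Function.iterate_succ_apply' _ m]
          simp only [smul_eq_mul]
          push_cast
          ring
      -- Leibniz for Hasse derivatives: that of `p * X_j` of order `m` is `h m * X_j + h (m - 1)`.
      refine ⟨fun m => h m * X j + if m = 0 then 0 else h (m - 1), fun m => ?_, ?_⟩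
      · rcases m with _ | m
        · have := hp 0
          simp only [Function.iterate_zero, id] at this ⊢
          rw [this]
          simp
        · simp only [hD, hp, if_neg (Nat.succ_ne_zero m), Nat.add_sub_cancel, Nat.factorial_succ]
          push_cast
          ring
      · rw [map_mul]
        simp only [coe_eval₂Hom, eval₂_X, Function.update_self, mul_zero, map_add, map_mul, mul_add]
        rw [Finset.sum_add_distrib, Finset.sum_range_succ', Finset.sum_range_succ']
        simp only [if_true, eval₂_zero, mul_zero, add_zero, Nat.add_eq_zero_iff, one_ne_zero,
          and_false, if_false, Nat.add_sub_cancel]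
        have h1 : ∑ m ∈ Finset.range s, (-y j) ^ (m + 1) * (eval₂ φ y (h (m + 1)) * y j) +
            (-y j) ^ 0 * (eval₂ φ y (h 0) * y j) =
            ∑ m ∈ Finset.range (s + 1), (-y j) ^ m * (eval₂ φ y (h m) * y j) := by
          rw [Finset.sum_range_succ' _ s]
        -- The two sums cancel term by term except for the top term, which contains `y_j ^ (s + 1) =
        -- 0`.
        rw [h1, Finset.sum_range_succ, add_right_comm, ← Finset.sum_add_distrib,
          Finset.sum_eq_zero, zero_add]
        · rw [mul_comm (eval₂ φ y (h s)), ← mul_assoc]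
          have : (-y j) ^ s * y j = 0 := by
            rw [neg_pow, mul_assoc, ← pow_succ, hs, mul_zero]
          rw [this, zero_mul]
        · intro m _
          rw [pow_succ]
          ring
    · have hD : ∀ m, (pderiv i)^[m] (p * X j) = (pderiv i)^[m] p * X j := by
        intro m
        induction m with
        | zero => rfl
        | succ m ih =>
          rw [Function.iterate_succ_apply', ih, Derivation.leibniz, pderiv_X_of_ne hj,
            Function.iterate_succ_apply']
          simp [mul_comm]
      refine ⟨fun m => h m * X j, fun m => by rw [hD, hp, mul_assoc], ?_⟩
      rw [map_mul, hp', Finset.sum_mul]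
      refine Finset.sum_congr rfl fun m _ => ?_
      simp [Function.update_of_ne hj, mul_assoc]

/-- The Taylor formula with divided powers. -/
theorem MvPolynomial.eval₂Hom_update_eq_sum {K : Ideal B} (γ : DividedPowers K) (φ : S →+* B)
    (y : ι → B) (i : ι) (hi : y i ∈ K) {s : ℕ} (hs : y i ^ (s + 1) = 0) (p : MvPolynomial ι S) :
    eval₂Hom φ (Function.update y i 0) p =
      ∑ m ∈ Finset.range (s + 1), γ.dpow m (-y i) * eval₂Hom φ y ((pderiv i)^[m] p) := by
  obtain ⟨h, h1, h2⟩ := exists_hasse φ y i hs p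
  rw [h2]
  refine Finset.sum_congr rfl fun m _ => ?_
  rw [h1, map_mul, map_natCast, ← mul_assoc, mul_comm (γ.dpow m _),
    γ.factorial_mul_dpow_eq_pow (neg_mem hi)]

/-- If all the derivatives of a sequence of polynomials converge to zero at a point of a divided
power ideal, then so do their constant terms. -/
theorem MvPolynomial.eventually_constantCoeff_eq_zero [Fintype ι] {K : Ideal B}
    (γ : DividedPowers K) (φ : S →+* B) (y : ι → B) (hy : ∀ i, y i ∈ K)
    (hnil : ∀ i, IsNilpotent (y i)) (N : Set (ℕ → MvPolynomial ι S))
    (hN : ∀ f ∈ N, ∀ j, (fun a => pderiv j (f a)) ∈ N)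
    (h0 : ∀ f ∈ N, ∀ᶠ a in Filter.atTop, eval₂Hom φ y (f a) = 0) :
    ∀ f ∈ N, ∀ᶠ a in Filter.atTop, φ (constantCoeff (f a)) = 0 := by
  -- The coordinates in `T` are set to zero one at a time, for all sequences in `N` at once, because
  -- the Taylor formula in one variable involves the higher derivatives.
  have key : ∀ T : Finset ι, ∀ f ∈ N, ∀ᶠ a in Filter.atTop,
      eval₂Hom φ (fun i => if i ∈ T then 0 else y i) (f a) = 0 := by
    intro T
    induction T using Finset.induction_on with
    | empty => simpa using h0
    | insert i T hi ih =>
      intro f hf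
      obtain ⟨s, hs⟩ := hnil i
      have hs' : (fun i => if i ∈ T then 0 else y i) i ^ (s + 1) = 0 := by
        simp [hi, pow_succ, hs]
      have h1 : ∀ m, (fun a => (pderiv i)^[m] (f a)) ∈ N := by
        intro m
        induction m with
        | zero => exact hf
        | succ m ihm => simpa only [Function.iterate_succ_apply'] using hN _ ihm i
      -- Nilpotency of `y i` leaves finitely many Taylor terms, so they all vanish from some stage
      -- on.
      have h2 : ∀ᶠ a in Filter.atTop, ∀ m ∈ Finset.range (s + 1),
          eval₂Hom φ (fun i => if i ∈ T then 0 else y i) ((pderiv i)^[m] (f a)) = 0 :=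
        (Filter.eventually_all_finset _).2 fun m _ => ih _ (h1 m)
      have h3 : (fun j => if j ∈ insert i T then 0 else y j) =
          Function.update (fun i => if i ∈ T then 0 else y i) i 0 := by
        ext j
        rcases eq_or_ne j i with rfl | hj
        · simp
        · simp [hj]
      filter_upwards [h2] with a ha
      rw [h3, eval₂Hom_update_eq_sum γ φ _ i (by simpa [hi] using hy i) hs']
      exact Finset.sum_eq_zero fun m hm => by rw [ha m hm, mul_zero]
  intro f hf
  filter_upwards [key Finset.univ f hf] with a ha
  simp only [Finset.mem_univ, if_true] at ha
  rw [← ha]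
  simp [constantCoeff_eq]

end taylor

/-! ### Powers of the ideal `(I, t)` in a polynomial ring -/

section coeffIdeal

variable {ι S : Type*} [CommRing S]

/-- With truncated subtraction, `(m - |β₁|) + (n - |β₂|) ≥ m + n - |β₁ + β₂|`. -/
theorem MvPolynomial.coeff_mul_mem {I : Ideal S} {m n : ℕ} {p q : MvPolynomial ι S}
    (hp : ∀ β, p.coeff β ∈ I ^ (m - β.degree)) (hq : ∀ β, q.coeff β ∈ I ^ (n - β.degree)) (β) :
    (p * q).coeff β ∈ I ^ (m + n - β.degree) := by
  classical
  rw [MvPolynomial.coeff_mul]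
  refine Ideal.sum_mem _ fun x hx => ?_
  rw [Finset.HasAntidiagonal.mem_antidiagonal] at hx
  have := Ideal.mul_mem_mul (hp x.1) (hq x.2)
  rw [← pow_add] at this
  refine Ideal.pow_le_pow_right ?_ this
  rw [← hx, map_add]
  omega

/-- The powers of the ideal of the zero section over the closed point. -/
theorem MvPolynomial.mem_pow_iff (I : Ideal S) (s : ℕ) (p : MvPolynomial ι S) :
    p ∈ (I.map (MvPolynomial.C : S →+* MvPolynomial ι S) ⊔
      Ideal.span (Set.range MvPolynomial.X)) ^ s ↔ ∀ β, p.coeff β ∈ I ^ (s - β.degree) := by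
  classical
  set 𝔫 := I.map (MvPolynomial.C : S →+* MvPolynomial ι S) ⊔ Ideal.span (Set.range MvPolynomial.X)
  constructor
  -- The coefficient conditions define ideals `E s` with `E s * E 1 ≤ E (s + 1)`, so it suffices
  -- that `𝔫 ≤ E 1`.
  · let E : ℕ → Ideal (MvPolynomial ι S) := fun s =>
      { carrier := {p | ∀ β, p.coeff β ∈ I ^ (s - β.degree)}
        zero_mem' := fun β => by simp
        add_mem' := fun hp hq β => by rw [MvPolynomial.coeff_add]; exact add_mem (hp β) (hq β)
        smul_mem' := fun c p hp β => by
          have := coeff_mul_mem (I := I) (m := 0) (p := c) (fun β => by simp) hp β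
          rwa [zero_add] at this }
    have hE : ∀ s, 𝔫 ^ s ≤ E s := by
      intro s
      induction s with
      | zero => exact fun p _ β => by simp
      | succ s ih =>
        have h1 : 𝔫 ≤ E 1 := by
          refine sup_le ?_ ?_
          · rw [Ideal.map_le_iff_le_comap]
            intro a ha β
            rw [MvPolynomial.coeff_C]
            split_ifs with h
            · subst h; simpa using ha
            · exact zero_mem _
          · rw [Ideal.span_le]
            rintro _ ⟨i, rfl⟩ β
            rw [MvPolynomial.coeff_X]
            split_ifs with h
            · subst h; simp
            · exact zero_mem _
        rw [pow_succ, Ideal.mul_le]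
        exact fun p hp q hq => coeff_mul_mem (ih hp) (h1 hq)
    exact fun h => hE s h
  · intro h
    rw [p.as_sum]
    refine Ideal.sum_mem _ fun β _ => ?_
    have h1 : MvPolynomial.monomial β (p.coeff β) =
        MvPolynomial.C (p.coeff β) * MvPolynomial.monomial β 1 := by
      rw [MvPolynomial.C_mul_monomial, mul_one]
    have h2 : MvPolynomial.C (p.coeff β) ∈ 𝔫 ^ (s - β.degree) :=
      Ideal.pow_right_mono le_sup_left _ (by
        rw [← Ideal.map_pow]; exact Ideal.mem_map_of_mem _ (h β))
    have h3 : (MvPolynomial.monomial β (1 : S)) ∈ 𝔫 ^ β.degree := by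
      rw [MvPolynomial.monomial_eq, map_one, one_mul, Finsupp.prod,
        show β.degree = ∑ i ∈ β.support, β i from rfl,
        ← Finset.prod_pow_eq_pow_sum]
      exact Ideal.prod_mem_prod fun i _ =>
        Ideal.pow_mem_pow (Submodule.mem_sup_right (Ideal.subset_span (Set.mem_range_self i))) _
    rw [h1]
    have := Ideal.mul_mem_mul h2 h3
    rw [← pow_add] at this
    exact Ideal.pow_le_pow_right (by omega) this

end coeffIdeal

/-! ### Projections of the divided power completion -/

namespace DividedPowers.Completion

variable {R : Type u} [CommRing R] {I : Ideal R} {γ : DividedPowers I} {P : Ideal R → Prop}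

/-- The projection of the completion to a factor ring. -/
def proj (J : {J : Ideal R // γ.IsSubDPIdeal J ∧ P J}) : γ.Completion P →+* R ⧸ J.1 where
  toFun f := f.1 J
  map_one' := rfl
  map_zero' := rfl
  map_add' _ _ := rfl
  map_mul' _ _ := rfl

theorem isOpen_ker_proj (J : {J : Ideal R // γ.IsSubDPIdeal J ∧ P J}) :
    IsOpen (RingHom.ker (proj J) : Set (γ.Completion P)) := by
  let _ : ∀ J : {J : Ideal R // γ.IsSubDPIdeal J ∧ P J}, TopologicalSpace (R ⧸ J.1) := fun _ => ⊥
  have _ : ∀ J : {J : Ideal R // γ.IsSubDPIdeal J ∧ P J}, DiscreteTopology (R ⧸ J.1) :=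
    fun _ => ⟨rfl⟩
  have h : Continuous fun f : γ.Completion P => f.1 J :=
    (continuous_apply J).comp continuous_subtype_val
  exact (isOpen_discrete ({0} : Set (R ⧸ J.1))).preimage h

theorem tendsto_nhds_zero {ι : Type*} {l : Filter ι} {u : ι → γ.Completion P} :
    Filter.Tendsto u l (nhds 0) ↔ ∀ J, ∀ᶠ i in l, proj J (u i) = 0 := by
  let _ : ∀ J : {J : Ideal R // γ.IsSubDPIdeal J ∧ P J}, TopologicalSpace (R ⧸ J.1) := fun _ => ⊥
  have _ : ∀ J : {J : Ideal R // γ.IsSubDPIdeal J ∧ P J}, DiscreteTopology (R ⧸ J.1) :=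
    fun _ => ⟨rfl⟩
  refine (tendsto_subtype_rng (f := u) (x := 0)).trans (tendsto_pi_nhds.trans ?_)
  refine forall_congr' fun J => ?_
  rw [nhds_discrete, Filter.tendsto_pure]
  rfl

theorem isDPMorphism_of : γ.IsDPMorphism (dividedPowers γ P) (of γ P) := by
  have h : I ≤ (ideal γ P).comap (of γ P) := fun a ha J => Ideal.mem_map_of_mem _ ha
  refine ⟨Ideal.map_le_iff_le_comap.2 h, fun {n} a ha => ext fun J => ?_⟩
  refine (dpow_apply n (h ha) J).trans ?_
  exact Quotient.dpow_apply γ (inf_isSubDPIdeal J.2.1) ha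

theorem isDPMorphism_proj (J : {J : Ideal R // γ.IsSubDPIdeal J ∧ P J}) :
    (dividedPowers γ P).IsDPMorphism (quotDP γ P J) (proj J) :=
  ⟨Ideal.map_le_iff_le_comap.2 fun _ hf => hf J, fun {n} _ hf => (dpow_apply n hf J).symm⟩

/-- A divided power morphism from `R` with kernel `J` factors through the completion. -/
theorem isDPMorphism_lift {C : Type v} [CommRing C] {K : Ideal C} {δ : DividedPowers K}
    {q : R →+* C} (hq : γ.IsDPMorphism δ q) (J : {J : Ideal R // γ.IsSubDPIdeal J ∧ P J})
    (hJ : ∀ a ∈ J.1, q a = 0) :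
    (dividedPowers γ P).IsDPMorphism δ ((Ideal.Quotient.lift J.1 q hJ).comp (proj J)) := by
  refine DividedPowers.IsDPMorphism.comp (hJ := quotDP γ P J) _ ⟨?_, ?_⟩ (isDPMorphism_proj J)
  · rw [Ideal.map_map]
    exact hq.ideal_comp
  · intro n x hx
    obtain ⟨a, ha, rfl⟩ := (Ideal.mem_map_iff_of_surjective _ Ideal.Quotient.mk_surjective).1 hx
    rw [quotDP, Quotient.dpow_apply γ (inf_isSubDPIdeal J.2.1) ha, Ideal.Quotient.lift_mk,
      Ideal.Quotient.lift_mk, hq.map_dpow ha]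

/-- `1 + y z` is a unit in each local factor, since `I` maps into its maximal ideal. Inverses are
unique, hence compatible with the projections. -/
theorem ideal_le_jacobson (hI : I.IsMaximal) (hP : ∀ J, P J → IsLocalRing (R ⧸ J)) :
    ideal γ P ≤ (⊥ : Ideal (γ.Completion P)).jacobson := by
  intro y hy
  rw [Ideal.mem_jacobson_bot]
  intro z
  have hunit : ∀ J : {J : Ideal R // γ.IsSubDPIdeal J ∧ P J}, IsUnit ((y * z + 1).1 J) := by
    intro J
    have := hP J.1 J.2.2
    have h1 : I.map (Ideal.Quotient.mk J.1) ≤ maximalIdeal (R ⧸ J.1) := by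
      refine IsLocalRing.le_maximalIdeal ?_
      have := Ideal.IsMaximal.map_of_surjective_of_ker_le (m := I)
        (Ideal.Quotient.mk_surjective (I := J.1)) (by rw [Ideal.mk_ker]; exact J.2.1.isSubideal)
      exact this.ne_top
    have h2 : y.1 J * z.1 J ∈ maximalIdeal (R ⧸ J.1) := Ideal.mul_mem_right _ _ (h1 (hy J))
    by_contra h
    have h3 : y.1 J * z.1 J + 1 ∈ maximalIdeal (R ⧸ J.1) := h
    have h4 := sub_mem h3 h2
    rw [add_sub_cancel_left] at h4
    exact (Ideal.ne_top_iff_one _).1 (maximalIdeal.isMaximal (R ⧸ J.1)).ne_top h4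
  choose b hb using fun J => (hunit J).exists_right_inv
  have hcompat : b ∈ γ.Completion P := by
    intro J J' h
    have h1 := congrArg (Ideal.Quotient.factor h) (hb J)
    rw [map_mul, map_one, (y * z + 1).2 J J' h] at h1
    refine (hunit J').mul_left_cancel ?_
    rw [hb J', ← h1]
  exact IsUnit.of_mul_eq_one (⟨b, hcompat⟩ : γ.Completion P) (ext hb)

end DividedPowers.Completion

/-! ### The completed hull of a local ring -/

section proArtin

variable {R : Type u} [CommRing R] [IsLocalRing R]

/-- The divided power ideal arises from `I` by sums, multiples and `γ_n` with `n ≠ 0`, and `γ_n(0) =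
0` for these `n`. -/
theorem DPHull.apply_eq_zero_of_mem_ideal {S : Type v} {B : Type u} [CommRing S] [CommRing B]
    [Algebra S B] {J₀ : Ideal S} {γ₀ : DividedPowers J₀} {I : Ideal B} {C : Type w} [CommRing C]
    {K : Ideal C} {δ : DividedPowers K} {h : DPHull γ₀ I →+* C}
    (hh : (DPHull.dividedPowers γ₀ I).IsDPMorphism δ h) (h0 : ∀ b ∈ I, h (DPHull.of γ₀ I b) = 0)
    {x : DPHull γ₀ I} (hx : x ∈ DPHull.ideal γ₀ I) : h x = 0 := by
  obtain ⟨t, ht, rfl⟩ := hx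
  induction ht with
  | of hb => exact h0 _ hb
  | add _ _ hs ht => rw [DPHull.mk_add, map_add, hs, ht, add_zero]
  | mul s _ ht => rw [DPHull.mk_mul, map_mul, ht, mul_zero]
  | @gam n hn t ht h1 =>
    have h2 : h (DPHull.dpow n (DPHull.mk γ₀ I t)) = δ.dpow n (h (DPHull.mk γ₀ I t)) :=
      hh.map_dpow (DPHull.mk_mem ht)
    rw [← DPHull.dpow_mk n ht, h2, h1, δ.dpow_eval_zero hn]

theorem toProArtinDP_mem {m : R} (hm : m ∈ maximalIdeal R) :
    toProArtinDP R m ∈ DividedPowers.Completion.ideal (localDP R) IsLocalArtinQuotient :=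
  DividedPowers.Completion.isDPMorphism_of.ideal_comp
    (Ideal.mem_map_of_mem _ (DPHull.of_mem hm))

/-- The maximal ideal of an artinian local quotient is nilpotent. Consequently `𝔪`-adic convergence
in `R` implies convergence in the completed hull. -/
theorem exists_proj_toProArtinDP_eq_zero
    (J : {J : Ideal (LocalDPHull R) // (localDP R).IsSubDPIdeal J ∧ IsLocalArtinQuotient J}) :
    ∃ s, ∀ m ∈ maximalIdeal R ^ s,
      DividedPowers.Completion.proj J (toProArtinDP R m) = 0 := by
  obtain ⟨hloc, hart⟩ := J.2.2
  set h := (DividedPowers.Completion.proj J).comp (toProArtinDP R) with hh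
  have h1 : (maximalIdeal R).map h ≤ maximalIdeal (LocalDPHull R ⧸ J.1) := by
    have := LocalDPHull.ideal_isMaximal R
    have h2 := Ideal.IsMaximal.map_of_surjective_of_ker_le
      (m := DPHull.ideal (dividedPowersBot ℤ) (maximalIdeal R))
      (Ideal.Quotient.mk_surjective (I := J.1)) (by rw [Ideal.mk_ker]; exact J.2.1.isSubideal)
    refine le_trans ?_ (IsLocalRing.le_maximalIdeal h2.ne_top)
    rw [Ideal.map_le_iff_le_comap]
    exact fun m hm => Ideal.mem_map_of_mem _ (DPHull.of_mem hm)
  obtain ⟨s, hs⟩ := IsArtinianRing.isNilpotent_jacobson_bot (R := LocalDPHull R ⧸ J.1)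
  rw [IsLocalRing.jacobson_eq_maximalIdeal _ bot_ne_top] at hs
  refine ⟨s, fun m hm => ?_⟩
  have h3 := Ideal.mem_map_of_mem h hm
  rw [Ideal.map_pow] at h3
  have h4 := Ideal.pow_right_mono h1 s h3
  rw [hs] at h4
  exact h4

/-- The projection of the completed hull to a quotient of `R` with square zero maximal ideal. -/
theorem ProArtinDP.exists_squareZero [IsNoetherianRing R] {𝔞 : Ideal R}
    (h2 : maximalIdeal R ^ 2 ≤ 𝔞) (ha : 𝔞 ≤ maximalIdeal R) :
    ∃ (δ : DividedPowers ((maximalIdeal R).map (Ideal.Quotient.mk 𝔞)))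
      (J : {J : Ideal (LocalDPHull R) // (localDP R).IsSubDPIdeal J ∧ IsLocalArtinQuotient J})
      (q₀ : LocalDPHull R →+* R ⧸ 𝔞) (hJ : ∀ a ∈ J.1, q₀ a = 0) (q : ProArtinDP R →+* R ⧸ 𝔞),
      (∀ n, 2 ≤ n → ∀ x ∈ (maximalIdeal R).map (Ideal.Quotient.mk 𝔞), δ.dpow n x = 0) ∧
      (localDP R).IsDPMorphism δ q₀ ∧ (∀ r, q₀ (DPHull.of _ _ r) = Ideal.Quotient.mk 𝔞 r) ∧
      q = (Ideal.Quotient.lift J.1 q₀ hJ).comp (DividedPowers.Completion.proj J) ∧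
      (∀ r, q (toProArtinDP R r) = Ideal.Quotient.mk 𝔞 r) ∧
      RingHom.ker q ≤ DividedPowers.Completion.ideal (localDP R) IsLocalArtinQuotient ∧
      IsOpen (RingHom.ker q : Set (ProArtinDP R)) ∧
      (DividedPowers.Completion.dividedPowers (localDP R) IsLocalArtinQuotient).IsDPMorphism δ q := by
  obtain ⟨δ, q₀, hδ, hqe, hker, hq⟩ := DPHull.exists_squareZero ℤ h2 ha
  have hsub : (localDP R).IsSubDPIdeal (RingHom.ker q₀) := by
    have := DividedPowers.isSubDPIdeal_ker _ _ hq
    rwa [inf_eq_left.2 hker] at this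
  have hsurj : Function.Surjective q₀ := by
    intro y
    obtain ⟨r, rfl⟩ := Ideal.Quotient.mk_surjective y
    exact ⟨_, hqe r⟩
  have hne : 𝔞 ≠ ⊤ := fun h => (maximalIdeal.isMaximal R).ne_top (top_le_iff.1 (h ▸ ha))
  have : Nontrivial (R ⧸ 𝔞) := Ideal.Quotient.nontrivial_iff.2 hne
  have hloc : IsLocalRing (R ⧸ 𝔞) :=
    IsLocalRing.of_surjective' (Ideal.Quotient.mk 𝔞) Ideal.Quotient.mk_surjective
  have hart : IsArtinianRing (R ⧸ 𝔞) := by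
    rw [isArtinianRing_iff_isNilpotent_maximalIdeal]
    refine ⟨2, ?_⟩
    have h3 : maximalIdeal (R ⧸ 𝔞) = (maximalIdeal R).map (Ideal.Quotient.mk 𝔞) := by
      refine (IsLocalRing.eq_maximalIdeal ?_).symm
      exact Ideal.IsMaximal.map_of_surjective_of_ker_le
        Ideal.Quotient.mk_surjective (by rw [Ideal.mk_ker]; exact ha)
    rw [h3, ← Ideal.map_pow, Ideal.zero_eq_bot, Ideal.map_eq_bot_iff_le_ker, Ideal.mk_ker]
    exact h2
  let e := RingHom.quotientKerEquivOfSurjective hsurj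
  have hJ : IsLocalArtinQuotient (RingHom.ker q₀) :=
    ⟨e.symm.isLocalRing, e.symm.surjective.isArtinianRing⟩
  let J : {J : Ideal (LocalDPHull R) // (localDP R).IsSubDPIdeal J ∧ IsLocalArtinQuotient J} :=
    ⟨RingHom.ker q₀, hsub, hJ⟩
  have hJ0 : ∀ a ∈ J.1, q₀ a = 0 := fun a ha => ha
  have hinj : Function.Injective (Ideal.Quotient.lift J.1 q₀ hJ0) := e.injective
  set q := (Ideal.Quotient.lift J.1 q₀ hJ0).comp (DividedPowers.Completion.proj J) with hqdef
  have hqker : RingHom.ker q = RingHom.ker (DividedPowers.Completion.proj J) := by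
    ext y
    rw [RingHom.mem_ker, RingHom.mem_ker, hqdef, RingHom.comp_apply, map_eq_zero_iff _ hinj]
  refine ⟨δ, J, q₀, hJ0, q, hδ, hq, hqe, rfl, fun r => hqe r, ?_, ?_,
    DividedPowers.Completion.isDPMorphism_lift hq J hJ0⟩
  · rw [hqker]
    intro y hy
    -- The largest index, whose factor is the residue field. If the component of `y` at `J` is zero,
    -- so is the one at `M`, and this puts all components of `y` in the divided power ideal.
    let M : {J : Ideal (LocalDPHull R) // (localDP R).IsSubDPIdeal J ∧ IsLocalArtinQuotient J} :=
      ⟨DPHull.ideal (dividedPowersBot ℤ) (maximalIdeal R), DividedPowers.IsSubDPIdeal.self _, by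
        have := LocalDPHull.ideal_isMaximal R
        let _ := Ideal.Quotient.field (DPHull.ideal (dividedPowersBot ℤ) (maximalIdeal R))
        exact ⟨inferInstance, inferInstance⟩⟩
    have h3 : y.1 M = 0 := by
      rw [← y.2 J M hsub.isSubideal]
      exact (congrArg (Ideal.Quotient.factor _) hy).trans (map_zero _)
    intro J'
    have h4 := y.2 J' M J'.2.1.isSubideal
    rw [h3] at h4
    obtain ⟨a, ha⟩ := Ideal.Quotient.mk_surjective (y.1 J')
    rw [← ha] at h4 ⊢
    exact Ideal.mem_map_of_mem _ (Ideal.Quotient.eq_zero_iff_mem.1 h4)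
  · rw [hqker]
    exact DividedPowers.Completion.isOpen_ker_proj J

end proArtin

/-! ### Formal smoothness from completed hulls -/

section formallySmooth

/-- A local homomorphism is formally smooth if the target is, to all orders, a polynomial ring. -/
theorem isAdicFormallySmooth_of_pow {A : Type v} {R : Type u} [CommRing A] [CommRing R]
    [IsLocalRing R] (f : A →+* R) {ι : Type w} (x : ι → R) (𝔫 : Ideal (MvPolynomial ι A))
    (hle : 𝔫.map (MvPolynomial.eval₂Hom f x) ≤ maximalIdeal R)
    (hsurj : ∀ s r, ∃ p, r - MvPolynomial.eval₂Hom f x p ∈ maximalIdeal R ^ s)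
    (hinj : ∀ s p, MvPolynomial.eval₂Hom f x p ∈ maximalIdeal R ^ s → p ∈ 𝔫 ^ s) :
    IsAdicFormallySmooth f := by
  intro C _ a N hN g hg ⟨m, hm⟩
  choose c hc using fun i => Ideal.Quotient.mk_surjective (g (x i))
  set φ := MvPolynomial.eval₂Hom f x
  set θ := MvPolynomial.eval₂Hom a c with hθ
  have hcomp : (Ideal.Quotient.mk N).comp θ = g.comp φ := by
    refine MvPolynomial.ringHom_ext (fun r => ?_) fun i => ?_
    · have := RingHom.congr_fun hg r
      simpa [hθ, φ] using this.symm
    · simp [hθ, φ, hc]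
  -- `θ` lifts `g ∘ φ`, which kills `𝔫 ^ m`.
  have h1 : (𝔫 ^ m).map θ ≤ N := by
    rw [Ideal.map_le_iff_le_comap]
    intro p hp
    have h2 := RingHom.congr_fun hcomp p
    rw [RingHom.comp_apply, RingHom.comp_apply] at h2
    have h3 := Ideal.mem_map_of_mem φ hp
    rw [Ideal.map_pow] at h3
    rw [hm _ (Ideal.pow_right_mono hle m h3)] at h2
    exact Ideal.mem_comap.2 (Ideal.Quotient.eq_zero_iff_mem.1 h2)
  -- `N ^ 2 = 0` costs a factor `2` in the exponent: the lift will be defined on `R / 𝔪 ^ (2m)`.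
  have h2 : ∀ p ∈ 𝔫 ^ (m * 2), θ p = 0 := by
    intro p hp
    have h3 := Ideal.mem_map_of_mem θ hp
    rw [pow_mul, Ideal.map_pow] at h3
    have h4 := Ideal.pow_right_mono h1 2 h3
    rwa [hN] at h4
  set ρ := (Ideal.Quotient.mk (maximalIdeal R ^ (m * 2))).comp φ with hρ
  have hρs : Function.Surjective ρ := by
    intro y
    obtain ⟨r, rfl⟩ := Ideal.Quotient.mk_surjective y
    obtain ⟨p, hp⟩ := hsurj (m * 2) r
    exact ⟨p, (Ideal.Quotient.eq.2 hp).symm⟩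
  have hker : RingHom.ker ρ ≤ RingHom.ker θ := fun p hp =>
    h2 p (hinj _ p (Ideal.Quotient.eq_zero_iff_mem.1 hp))
  let h := (ρ.liftOfSurjective hρs ⟨θ, hker⟩).comp (Ideal.Quotient.mk (maximalIdeal R ^ (m * 2)))
  have hh : ∀ p, h (φ p) = θ p := fun p =>
    ρ.liftOfRightInverse_comp_apply _ (Function.rightInverse_surjInv hρs) ⟨θ, hker⟩ p
  refine ⟨h, ?_, ?_⟩
  · ext r
    have := hh (MvPolynomial.C r)
    simpa [φ, hθ] using this
  · ext r
    obtain ⟨p, hp⟩ := hsurj (m * 2) r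
    have h3 : h r = h (φ p) := by
      change ρ.liftOfSurjective hρs ⟨θ, hker⟩ _ = ρ.liftOfSurjective hρs ⟨θ, hker⟩ _
      rw [Ideal.Quotient.eq.2 hp]
    have h4 := hm _ (Ideal.pow_le_pow_right (Nat.le_mul_of_pos_right m two_pos) hp)
    rw [map_sub, sub_eq_zero] at h4
    rw [RingHom.comp_apply, h3, hh, h4]
    exact RingHom.congr_fun hcomp p

/-- The sequence of successive approximations to a relation. -/
theorem exists_approximation {A R : Type*} [CommRing A] [CommRing R] (φ : A →+* R) {𝔫 : Ideal A}
    {𝔪 : Ideal R} (h : ∀ s, ∀ m ∈ 𝔪 ^ s, ∃ p ∈ 𝔫 ^ s, m - φ p ∈ 𝔪 ^ (s + 1)) (s : ℕ) (p : A)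
    (hp : φ p ∈ 𝔪 ^ s) :
    ∃ P : ℕ → A, P 0 = p ∧ ∀ k, φ (P k) ∈ 𝔪 ^ (s + k) ∧ P k - P (k + 1) ∈ 𝔫 ^ (s + k) := by
  choose! c hc hc' using h
  let P : ℕ → A := fun k => Nat.rec p (fun k q => q - c (s + k) (φ q)) k
  have hP : ∀ k, P (k + 1) = P k - c (s + k) (φ (P k)) := fun k => rfl
  have h1 : ∀ k, φ (P k) ∈ 𝔪 ^ (s + k) := by
    intro k
    induction k with
    | zero => exact hp
    | succ k ih =>
      rw [hP, map_sub]
      exact hc' _ _ ih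
  refine ⟨P, rfl, fun k => ⟨h1 k, ?_⟩⟩
  rw [hP, sub_sub_cancel]
  exact hc _ _ (h1 k)

/-- A Cauchy sequence of polynomials whose coefficients converge to zero. -/
theorem MvPolynomial.mem_pow_of_forall_limit {ι S : Type*} [CommRing S] (I : Ideal S)
    [IsPrecomplete I S] (s : ℕ) (P : ℕ → MvPolynomial ι S)
    (hP : ∀ k, P k - P (k + 1) ∈ (I.map (MvPolynomial.C : S →+* MvPolynomial ι S) ⊔
      Ideal.span (Set.range MvPolynomial.X)) ^ (s + k))
    (hlim : ∀ (β : ι →₀ ℕ) (L : S),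
      (∀ k, (P (k + β.degree)).coeff β - L ∈ I ^ k) → L = 0) :
    P 0 ∈ (I.map (MvPolynomial.C : S →+* MvPolynomial ι S) ⊔
      Ideal.span (Set.range MvPolynomial.X)) ^ s := by
  rw [MvPolynomial.mem_pow_iff]
  intro β
  have hdiff : ∀ k, (P k).coeff β - (P (k + 1)).coeff β ∈ I ^ (s + k - β.degree) := by
    intro k
    rw [← MvPolynomial.coeff_sub]
    exact (MvPolynomial.mem_pow_iff _ _ _).1 (hP k) β
  have hcauchy : ∀ t k l, t ≤ s + k - β.degree → k ≤ l →
      (P k).coeff β - (P l).coeff β ∈ I ^ t := by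
    intro t k l ht hkl
    induction l, hkl using Nat.le_induction with
    | base => simp
    | succ l hl ih =>
      have := add_mem ih (Ideal.pow_le_pow_right (by omega) (hdiff l))
      simpa using this
  -- The shift by `|β|` compensates that a difference in `𝔫 ^ (s + k)` controls the coefficient at
  -- `β` only modulo `I ^ (s + k - |β|)`.
  obtain ⟨L, hL⟩ := IsPrecomplete.prec' (I := I) (M := S) (fun k => (P (k + β.degree)).coeff β)
    fun {k l} hkl => by
      rw [SModEq.sub_mem, smul_eq_mul, Ideal.mul_top]
      exact hcauchy _ _ _ (by omega) (by omega)
  have hL' : ∀ k, (P (k + β.degree)).coeff β - L ∈ I ^ k := fun k => by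
    have := hL k
    rwa [SModEq.sub_mem, smul_eq_mul, Ideal.mul_top] at this
  -- The stage `s + |β|` agrees with the limit modulo `I ^ s`, and with stage `0` modulo `I ^ (s -
  -- |β|)`.
  have h3 := hcauchy (s - β.degree) 0 (s + β.degree) (by omega) (by omega)
  have h4 := hL' s
  rw [hlim β L hL', sub_zero] at h4
  have := add_mem h3 (Ideal.pow_le_pow_right (Nat.sub_le s β.degree) h4)
  simpa using this

variable {Λ₀ : Type u} {R : Type v} {Λ₁ : Type w} [CommRing Λ₀] [IsLocalRing Λ₀]
  [CommRing R] [IsLocalRing R] [CommRing Λ₁] [IsLocalRing Λ₁]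

theorem IsLocalRing.map_mem_maximalIdeal (f : Λ₀ →+* R) [IsLocalHom f] {a : Λ₀}
    (ha : a ∈ maximalIdeal Λ₀) : f a ∈ maximalIdeal R :=
  map_nonunit f a ha

/-- Coordinates of `R` over `Λ₀` and the partial derivatives on the completed hull. -/
theorem ProArtinDP.exists_pderiv [IsNoetherianRing R] (f : Λ₀ →+* R) [IsLocalHom f]
    (hf : (ResidueField.map f).Finite)
    (h : (ProArtinDP.map f hf).IsDPTangentSmooth
      (DividedPowers.Completion.ideal (localDP Λ₀) IsLocalArtinQuotient)
      (DividedPowers.Completion.dividedPowers (localDP R) IsLocalArtinQuotient)) :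
    ∃ (n : ℕ) (x : Fin n → R) (D : Fin n → ProArtinDP R → ProArtinDP R),
      (∀ i, x i ∈ maximalIdeal R) ∧ (∀ m ∈ maximalIdeal R, m ∈ Ideal.span (Set.range x) ⊔
        (maximalIdeal R ^ 2 ⊔ (maximalIdeal Λ₀).map f)) ∧
      ∀ j, Continuous (D j) ∧ D j 0 = 0 ∧ ∀ p, D j (toProArtinDP R (MvPolynomial.eval₂Hom f x p)) =
        toProArtinDP R (MvPolynomial.eval₂Hom f x (MvPolynomial.pderiv j p)) := by
  set 𝔞 := maximalIdeal R ^ 2 ⊔ (maximalIdeal Λ₀).map f with h𝔞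
  have h𝔞𝔪 : 𝔞 ≤ maximalIdeal R :=
    sup_le (Ideal.pow_le_self two_ne_zero) (Ideal.map_le_iff_le_comap.2 fun a ha => map_mem_maximalIdeal f ha)
  obtain ⟨n, x, ψ, hspan, hψ, hx⟩ := exists_coordinates (IsNoetherian.noetherian (maximalIdeal R))
    𝔞 le_sup_left
  obtain ⟨δ, J, q₀, hJ, q, hδ, hq₀, hq₀e, hqdef, hqe, hker, hopen, hq⟩ :=
    ProArtinDP.exists_squareZero (R := R) (𝔞 := 𝔞) le_sup_left h𝔞𝔪
  let _ : Algebra (ProArtinDP Λ₀) (ProArtinDP R) := (ProArtinDP.map f hf).toAlgebra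
  -- `R / 𝔞` kills `𝔪_{Λ₀}`, so `q₀` kills the image of the whole divided power ideal of `Γ(Λ₀)`:
  -- the tangent vectors are vertical over the base.
  have hq₀f : ∀ z ∈ DPHull.ideal (dividedPowersBot ℤ) (maximalIdeal Λ₀),
      q₀ (LocalDPHull.map f z) = 0 := by
    intro z hz
    refine DPHull.apply_eq_zero_of_mem_ideal (h := q₀.comp (LocalDPHull.map f))
      (hq₀.comp _ (LocalDPHull.map_isDPMorphism f)) (fun b hb => ?_) hz
    have : q₀ (LocalDPHull.map f (DPHull.of _ _ b)) = Ideal.Quotient.mk 𝔞 (f b) := hq₀e (f b)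
    rw [RingHom.comp_apply, this, Ideal.Quotient.eq_zero_iff_mem]
    exact Ideal.mem_sup_right (Ideal.mem_map_of_mem f hb)
  obtain ⟨D, hDT, hDx⟩ := IsDPTangentSmooth.exists_derivations h
    (DividedPowers.Completion.ideal_le_jacobson (LocalDPHull.ideal_isMaximal R) fun J hJ => hJ.1)
    (toProArtinDP R) le_sup_left q hqe hker hδ hq hopen (fun a ha => by
      have h1 := ha ⟨J.1.comap (LocalDPHull.map f), LocalDPHull.comap_open f hf J.1 J.2⟩
      obtain ⟨z, hz, hz'⟩ :=
        (Ideal.mem_map_iff_of_surjective _ Ideal.Quotient.mk_surjective).1 h1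
      rw [hqdef]
      change Ideal.Quotient.lift J.1 q₀ hJ (Ideal.quotientMap J.1 (LocalDPHull.map f) le_rfl
        (a.1 ⟨J.1.comap (LocalDPHull.map f), LocalDPHull.comap_open f hf J.1 J.2⟩)) = 0
      rw [← hz']
      exact hq₀f z hz)
    (fun m hm => toProArtinDP_mem hm) x ψ hψ hx
  let _ : Algebra Λ₀ (ProArtinDP R) := ((toProArtinDP R).comp f).toAlgebra
  let xG : Fin n → ProArtinDP R := fun i => toProArtinDP R (x i)
  have hφG : ∀ p, toProArtinDP R (MvPolynomial.eval₂Hom f (fun i => (x i : R)) p) =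
      MvPolynomial.aeval xG p := by
    intro p
    have : (toProArtinDP R).comp (MvPolynomial.eval₂Hom f (fun i => (x i : R))) =
        MvPolynomial.eval₂Hom ((toProArtinDP R).comp f) xG := by
      refine MvPolynomial.ringHom_ext (fun r => ?_) fun i => ?_ <;> simp [xG]
    exact RingHom.congr_fun this p
  refine ⟨n, fun i => x i, fun j => D j, fun i => (x i).2, hspan, fun j => ⟨(hDT j).1,
    map_zero _, fun p => ?_⟩⟩
  rw [hφG, hφG]
  change D j _ = _
  -- `D j` is linear over the completed hull of `Λ₀` and so kills the coefficients; duality then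
  -- leaves only `∂_j p`.
  rw [(D j).map_mvPolynomial_aeval
    (fun s => (D j).map_algebraMap (toProArtinDP Λ₀ s)) xG]
  simp only [show ∀ l, D j (xG l) = if j = l then 1 else 0 from hDx j]
  simp

/-- The coefficients of polynomials that converge to zero on `R` converge, up to factorials, to zero
on the completed hull of `Λ₁`. -/
theorem ProArtinDP.eventually_coeff_eq_zero {A : Type*} [CommRing A] (f : A →+* R)
    (g : R →+* Λ₁) [IsLocalHom g]
    (hg : (ResidueField.map g).Finite) {n : ℕ} (x : Fin n → R) (hx : ∀ i, x i ∈ maximalIdeal R)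
    (D : Fin n → ProArtinDP R → ProArtinDP R) (hD : ∀ j, Continuous (D j) ∧ D j 0 = 0 ∧
      ∀ p, D j (toProArtinDP R (MvPolynomial.eval₂Hom f x p)) =
        toProArtinDP R (MvPolynomial.eval₂Hom f x (MvPolynomial.pderiv j p)))
    (P : ℕ → MvPolynomial (Fin n) A)
    (hP : Filter.Tendsto (fun k => toProArtinDP R (MvPolynomial.eval₂Hom f x (P k)))
      Filter.atTop (nhds 0)) (β : Fin n →₀ ℕ)
    (J : {J : Ideal (LocalDPHull Λ₁) // (localDP Λ₁).IsSubDPIdeal J ∧ IsLocalArtinQuotient J}) :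
    ∀ᶠ k in Filter.atTop, DividedPowers.Completion.proj J (toProArtinDP Λ₁
      (g (f (((∏ j, (β j).factorial : ℕ) : A) * (P k).coeff β)))) = 0 := by
  set φ := MvPolynomial.eval₂Hom f x with hφ
  set N : Set (ℕ → MvPolynomial (Fin n) A) :=
    {p | Filter.Tendsto (fun k => toProArtinDP R (φ (p k))) Filter.atTop (nhds 0)} with hN
  -- Null sequences are stable under `∂_j` because `D j` is continuous.
  have hDN : ∀ p ∈ N, ∀ j, (fun k => MvPolynomial.pderiv j (p k)) ∈ N := by
    intro p hp j
    have h3 : Filter.Tendsto (fun k => D j (toProArtinDP R (φ (p k)))) Filter.atTop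
        (nhds (D j 0)) := ((hD j).1.tendsto 0).comp hp
    rw [(hD j).2.1] at h3
    exact h3.congr fun k => (hD j).2.2 _
  set pr := DividedPowers.Completion.proj J with hpr
  refine MvPolynomial.forall_factorial_mul_coeff N hDN
    (fun c => ∀ᶠ k in Filter.atTop, pr (toProArtinDP Λ₁ (g (f (c k)))) = 0) ?_ β P hP
  have hxm : ∀ i, g (x i) ∈ maximalIdeal Λ₁ := fun i => map_mem_maximalIdeal g (hx i)
  obtain ⟨t, ht⟩ := exists_proj_toProArtinDP_eq_zero J
  refine MvPolynomial.eventually_constantCoeff_eq_zero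
    (DividedPowers.Completion.quotDP (localDP Λ₁) IsLocalArtinQuotient J)
    (((pr.comp (toProArtinDP Λ₁)).comp g).comp f) (fun i => pr (toProArtinDP Λ₁ (g (x i))))
    (fun i => toProArtinDP_mem (hxm i) J) (fun i => ⟨t, ?_⟩) N hDN fun p hp => ?_
  · rw [← map_pow, ← map_pow]
    exact ht _ (Ideal.pow_mem_pow (hxm i) t)
  -- The preimage of `J` in `Γ(R)` is again an admissible index, so convergence in the completed
  -- hull of `R` passes to the quotient of `Γ(Λ₁)` by `J`.
  · have h3 := DividedPowers.Completion.tendsto_nhds_zero.1 hp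
      ⟨J.1.comap (LocalDPHull.map g), LocalDPHull.comap_open g hg J.1 J.2⟩
    filter_upwards [h3] with k hk
    have h4 : MvPolynomial.eval₂Hom (((pr.comp (toProArtinDP Λ₁)).comp g).comp f)
        (fun i => pr (toProArtinDP Λ₁ (g (x i)))) = ((pr.comp (toProArtinDP Λ₁)).comp g).comp φ := by
      refine MvPolynomial.ringHom_ext (fun r => ?_) fun i => ?_ <;> simp [hφ]
    rw [h4]
    have h5 := congrArg (Ideal.quotientMap J.1 (LocalDPHull.map g) le_rfl) hk
    rw [map_zero] at h5
    exact h5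

theorem IsAdicFormallySmooth.of_isDPTangentSmooth
    [IsNoetherianRing R] (f : Λ₀ →+* R) (g : R →+* Λ₁) [IsLocalHom f]
    [IsLocalHom g] (hf : (ResidueField.map f).Finite)
    (hg : (ResidueField.map g).Finite) (hbij : Function.Bijective (ResidueField.map f))
    (hcomplete : IsAdicComplete (maximalIdeal Λ₀) Λ₀) (htors : IsAddTorsionFree Λ₀)
    (hsr : IsSlightlyRamified (g.comp f))
    (h : (ProArtinDP.map f hf).IsDPTangentSmooth
      (DividedPowers.Completion.ideal (localDP Λ₀) IsLocalArtinQuotient)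
      (DividedPowers.Completion.dividedPowers (localDP R) IsLocalArtinQuotient)) :
    IsAdicFormallySmooth f := by
  obtain ⟨n, x, D, hx, hspan, hD⟩ := ProArtinDP.exists_pderiv f hf h
  set φ := MvPolynomial.eval₂Hom f x with hφ
  set 𝔫 := (maximalIdeal Λ₀).map (MvPolynomial.C : Λ₀ →+* MvPolynomial (Fin n) Λ₀) ⊔
    Ideal.span (Set.range MvPolynomial.X) with h𝔫
  have hC : (maximalIdeal Λ₀).map (MvPolynomial.C : Λ₀ →+* MvPolynomial (Fin n) Λ₀) ≤ 𝔫 :=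
    le_sup_left
  have hX : Ideal.span (Set.range (MvPolynomial.X : Fin n → MvPolynomial (Fin n) Λ₀)) ≤ 𝔫 :=
    le_sup_right
  have h2 : 𝔫.map φ ≤ maximalIdeal R := by
    rw [Ideal.map_le_iff_le_comap]
    refine sup_le ?_ ?_
    · rw [Ideal.map_le_iff_le_comap]
      intro a ha
      simpa [hφ] using map_mem_maximalIdeal f ha
    · rw [Ideal.span_le]
      rintro _ ⟨i, rfl⟩
      simpa [hφ] using hx i
  have h0 : ∀ r, ∃ p, r - φ p ∈ maximalIdeal R := by
    intro r
    obtain ⟨c, hc⟩ := hbij.2 (residue R r)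
    obtain ⟨a, rfl⟩ := IsLocalRing.residue_surjective c
    refine ⟨MvPolynomial.C a, ?_⟩
    rw [ResidueField.map_residue] at hc
    have : φ (MvPolynomial.C a) = f a := MvPolynomial.eval₂_C _ _ _
    rw [this]
    exact Ideal.Quotient.eq.1 hc.symm
  have h1 : maximalIdeal R ≤ 𝔫.map φ ⊔ maximalIdeal R ^ 2 := by
    have hspan' : Ideal.span (Set.range x) ≤ 𝔫.map φ := by
      rw [Ideal.span_le]
      rintro _ ⟨i, rfl⟩
      have := Ideal.mem_map_of_mem φ (hX (Ideal.subset_span ⟨i, rfl⟩))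
      simpa [hφ] using this
    have hf' : (maximalIdeal Λ₀).map f ≤ 𝔫.map φ := by
      rw [Ideal.map_le_iff_le_comap]
      intro a ha
      have := Ideal.mem_map_of_mem φ (hC (Ideal.mem_map_of_mem MvPolynomial.C ha))
      simpa [hφ] using this
    intro m hm
    refine (sup_le (hspan'.trans le_sup_left) ?_ :
      _ ≤ 𝔫.map φ ⊔ maximalIdeal R ^ 2) (hspan m hm)
    exact sup_le le_sup_right (hf'.trans le_sup_left)
  have hstep := exists_sub_mem_pow_succ φ h0 h1 h2
  refine isAdicFormallySmooth_of_pow f x 𝔫 h2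
    (exists_sub_mem_pow φ h0 h1 h2) fun s p hp => ?_
  obtain ⟨P, rfl, hP⟩ := exists_approximation φ hstep s p hp
  have hcoeff := ProArtinDP.eventually_coeff_eq_zero f g hg x hx D hD P
    (DividedPowers.Completion.tendsto_nhds_zero.2 fun J => by
      obtain ⟨t, ht⟩ := exists_proj_toProArtinDP_eq_zero J
      filter_upwards [Filter.eventually_ge_atTop t] with k hk
      exact ht _ (Ideal.pow_le_pow_right (by omega) (hP k).1))
  refine MvPolynomial.mem_pow_of_forall_limit _ s P (fun k => (hP k).2) fun β L hL' => ?_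
  have hgf : ∀ k, ∀ a ∈ maximalIdeal Λ₀ ^ k, g (f a) ∈ maximalIdeal Λ₁ ^ k := by
    intro k a ha
    have h3 := Ideal.mem_map_of_mem (g.comp f) ha
    rw [Ideal.map_pow] at h3
    have hle : (maximalIdeal Λ₀).map (g.comp f) ≤ maximalIdeal Λ₁ := by
      rw [Ideal.map_le_iff_le_comap]
      intro a ha
      exact map_mem_maximalIdeal g (map_mem_maximalIdeal f ha)
    exact Ideal.pow_right_mono hle k h3
  -- In each artinian quotient, `β! L` agrees with `β!` times the coefficient at late stages, which
  -- is zero there. Slight ramification makes the vanishing in all quotients sufficient.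
  have hL0 : ((∏ j, (β j).factorial : ℕ) : Λ₀) * L = 0 := by
    refine (injective_iff_map_eq_zero _).1 hsr _ (DividedPowers.Completion.ext fun J => ?_)
    obtain ⟨t, ht⟩ := exists_proj_toProArtinDP_eq_zero J
    obtain ⟨k, hk, hk'⟩ := ((hcoeff β J).and (Filter.eventually_ge_atTop (t + β.degree))).exists
    obtain ⟨l, rfl⟩ : ∃ l, k = l + β.degree := ⟨k - β.degree, by omega⟩
    have h3 := ht _ (Ideal.pow_le_pow_right (show t ≤ l by omega) (hgf l _
      (Ideal.mul_mem_left _ ((∏ j, (β j).factorial : ℕ) : Λ₀) (hL' l))))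
    rw [mul_sub, map_sub, map_sub, map_sub, map_sub, hk, zero_sub, neg_eq_zero] at h3
    exact h3
  rw [← nsmul_eq_mul] at hL0
  exact (nsmul_eq_zero_iff_right
    (Finset.prod_ne_zero_iff.2 fun j _ => Nat.factorial_ne_zero _)).1 hL0

end formallySmooth

/-- A submodule of the dual of `F / 𝔪F` that separates points contains a dual basis. -/
theorem exists_dual_family {R M : Type*} [CommRing R] [IsLocalRing R] [AddCommGroup M] [Module R M]
    [Module.Finite R M] (W : Submodule R (M →ₗ[R] R ⧸ maximalIdeal R))
    (hW : ∀ m : M, (∀ f ∈ W, f m = 0) → m ∈ maximalIdeal R • (⊤ : Submodule R M)) :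
    ∃ (n : ℕ) (d : Fin n → M) (f : Fin n → M →ₗ[R] R ⧸ maximalIdeal R), (∀ i, f i ∈ W) ∧
      (∀ i j, f i (d j) = if i = j then 1 else 0) ∧ Submodule.span R (Set.range d) = ⊤ := by
  let _ : Field (R ⧸ maximalIdeal R) := Ideal.Quotient.field _
  have hsurj : Function.Surjective (algebraMap R (R ⧸ maximalIdeal R)) :=
    Ideal.Quotient.mk_surjective
  set N : Submodule R M := maximalIdeal R • ⊤ with hN
  have : Module.Finite (R ⧸ maximalIdeal R) (M ⧸ N) :=
    Module.Finite.of_restrictScalars_finite R _ _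
  have hker : ∀ f : M →ₗ[R] R ⧸ maximalIdeal R, N ≤ LinearMap.ker f := by
    intro f
    rw [hN, Submodule.smul_le]
    intro r hr D _
    rw [LinearMap.mem_ker, map_smul, Algebra.smul_def, Ideal.Quotient.algebraMap_eq,
      Ideal.Quotient.eq_zero_iff_mem.2 hr, zero_mul]
  let L : (M →ₗ[R] R ⧸ maximalIdeal R) → Module.Dual (R ⧸ maximalIdeal R) (M ⧸ N) := fun f =>
    (N.liftQ f (hker f)).extendScalarsOfSurjective hsurj
  have hL : ∀ f m, L f (N.mkQ m) = f m := fun f m => rfl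
  have hext : ∀ f g : Module.Dual (R ⧸ maximalIdeal R) (M ⧸ N),
      (∀ m, f (N.mkQ m) = g (N.mkQ m)) → f = g := by
    intro f g h
    refine LinearMap.ext fun m => ?_
    obtain ⟨m, rfl⟩ := N.mkQ_surjective m
    exact h m
  let W' : Submodule (R ⧸ maximalIdeal R) (Module.Dual (R ⧸ maximalIdeal R) (M ⧸ N)) :=
    { carrier := L '' W
      zero_mem' := ⟨0, W.zero_mem, hext _ _ fun m => by rw [hL]; rfl⟩
      add_mem' := by
        rintro _ _ ⟨x, hx, rfl⟩ ⟨y, hy, rfl⟩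
        exact ⟨x + y, W.add_mem hx hy, hext _ _ fun m => by
          rw [LinearMap.add_apply, hL, hL, hL, LinearMap.add_apply]⟩
      smul_mem' := by
        rintro c _ ⟨x, hx, rfl⟩
        obtain ⟨r, rfl⟩ := hsurj c
        exact ⟨r • x, W.smul_mem r hx, hext _ _ fun m => by
          rw [LinearMap.smul_apply, hL, hL, LinearMap.smul_apply, algebraMap_smul]⟩ }
  -- A space of functionals that separates the points of a finite dimensional space has zero
  -- coannihilator and is the whole dual.
  have hW' : W' = ⊤ := by
    have h1 : W'.dualCoannihilator = ⊥ := by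
      rw [eq_bot_iff]
      intro m hm
      obtain ⟨m, rfl⟩ := N.mkQ_surjective m
      rw [Submodule.mem_dualCoannihilator] at hm
      rw [Submodule.mem_bot, Submodule.mkQ_apply, Submodule.Quotient.mk_eq_zero]
      exact hW m fun f hf => by rw [← hL]; exact hm _ ⟨f, hf, rfl⟩
    rw [← Subspace.dualCoannihilator_dualAnnihilator_eq (W := W'), h1,
      Submodule.dualAnnihilator_bot]
  let b := Module.finBasis (R ⧸ maximalIdeal R) (M ⧸ N)
  choose d hd using fun i => N.mkQ_surjective (b i)
  have hf : ∀ j, ∃ f ∈ W, L f = b.coord j := fun j => by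
    have : b.coord j ∈ W' := hW' ▸ Submodule.mem_top
    exact this
  choose f hfW hf using hf
  refine ⟨_, d, f, hfW, fun i j => ?_, ?_⟩
  · rw [← hL, hf, hd, Module.Basis.coord_apply, Module.Basis.repr_self, Finsupp.single_apply]
    simp only [eq_comm]
  · rw [eq_top_iff]
    refine Submodule.le_of_le_smul_of_le_jacobson_bot (I := maximalIdeal R) Module.Finite.fg_top
      (IsLocalRing.maximalIdeal_le_jacobson _) fun m _ => ?_
    choose c hc using fun i => hsurj (b.repr (N.mkQ m) i)
    rw [Submodule.mem_sup]
    refine ⟨∑ i, c i • d i, Submodule.sum_mem _ fun i _ =>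
      Submodule.smul_mem _ _ (Submodule.subset_span ⟨i, rfl⟩), m - ∑ i, c i • d i, ?_, by abel⟩
    rw [← hN, ← Submodule.Quotient.mk_eq_zero, ← Submodule.mkQ_apply, map_sub, sub_eq_zero,
      map_sum]
    conv_lhs => rw [← b.sum_repr (N.mkQ m)]
    refine Finset.sum_congr rfl fun i _ => ?_
    rw [map_smul, hd, ← hc, algebraMap_smul]

/-! ### Commuting frames dual to functions -/

section frame

variable {Λ : Type v} {R : Type u} [CommRing Λ] [CommRing R] [Algebra Λ R]

/-- A dual frame of a finitely generated module of derivations that is transverse to `V(Y)`. -/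
theorem exists_dual_frame [IsLocalRing R] (F : Submodule R (Derivation Λ R R)) (hfg : F.FG)
    {Y : Ideal R} (hY : Y ≤ maximalIdeal R)
    (hinj : ∀ D ∈ F, (∀ x ∈ Y, D x ∈ maximalIdeal R) → D ∈ maximalIdeal R • F) :
    ∃ (n : ℕ) (D : Fin n → Derivation Λ R R) (t : Fin n → R),
      F = Submodule.span R (Set.range D) ∧ (∀ i, t i ∈ Y) ∧
      ∀ i j, D i (t j) = if i = j then 1 else 0 := by
  have : Module.Finite R F := Module.Finite.iff_fg.2 hfg
  let ev : R → F →ₗ[R] R ⧸ maximalIdeal R := fun x =>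
    { toFun := fun D => Ideal.Quotient.mk _ (D.1 x)
      map_add' := fun _ _ => map_add _ _ _
      map_smul' := fun r D => map_mul _ _ _ }
  have hev : ∀ x D, ev x D = Ideal.Quotient.mk _ (D.1 x) := fun _ _ => rfl
  -- Evaluations at elements of `Y` form a submodule because `D (c x)` is `c D x` modulo `𝔪` for `x
  -- ∈ Y ≤ 𝔪`.
  let W : Submodule R (F →ₗ[R] R ⧸ maximalIdeal R) :=
    { carrier := ev '' Y
      zero_mem' := ⟨0, Y.zero_mem, LinearMap.ext fun D => by rw [hev, map_zero, map_zero]; rfl⟩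
      add_mem' := by
        rintro _ _ ⟨x, hx, rfl⟩ ⟨y, hy, rfl⟩
        exact ⟨x + y, Y.add_mem hx hy, LinearMap.ext fun D => by
          rw [LinearMap.add_apply, hev, hev, hev, map_add, map_add]⟩
      smul_mem' := by
        rintro c _ ⟨x, hx, rfl⟩
        refine ⟨c * x, Y.mul_mem_left c hx, LinearMap.ext fun D => ?_⟩
        rw [LinearMap.smul_apply, hev, hev, Derivation.leibniz, map_add, smul_eq_mul, smul_eq_mul,
          map_mul _ x, Ideal.Quotient.eq_zero_iff_mem.2 (hY hx), zero_mul, add_zero]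
        rfl }
  obtain ⟨n, d, f, hfW, hfd, hspan⟩ := exists_dual_family W (by
    intro D hD
    have h1 := hinj D D.2 fun x hx => Ideal.Quotient.eq_zero_iff_mem.1 (hD _ ⟨x, hx, rfl⟩)
    have h2 : (maximalIdeal R • (⊤ : Submodule R F)).map F.subtype = maximalIdeal R • F := by
      rw [Submodule.map_smul'', Submodule.map_top, Submodule.range_subtype]
    rw [← h2] at h1
    obtain ⟨D', hD', h3⟩ := h1
    rwa [← Subtype.ext h3])
  choose t ht htf using hfW
  have hDt : ∀ i j, (d i : Derivation Λ R R) (t j) - (if i = j then 1 else 0) ∈ maximalIdeal R := by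
    intro i j
    rw [← Ideal.Quotient.eq, ← hev, htf, hfd]
    simp only [eq_comm (a := i)]
    split_ifs <;> simp
  have hspan' : F ≤ Submodule.span R (Set.range fun i => (d i : Derivation Λ R R)) := by
    have h1 := congrArg (Submodule.map F.subtype) hspan
    rw [Submodule.map_top, Submodule.range_subtype, Submodule.map_span, ← Set.range_comp] at h1
    exact h1.ge
  obtain ⟨E, hEspan, hEF, hDspan, hE⟩ := exists_dual_derivations F
    (IsLocalRing.maximalIdeal_le_jacobson _) t (fun i => (d i).1)
    (fun i => (d i).2) hDt
  refine ⟨_, E, t, le_antisymm ?_ ?_, ht, hE⟩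
  · refine hspan'.trans (Submodule.span_le.2 ?_)
    rintro _ ⟨i, rfl⟩
    exact hDspan i
  · rw [Submodule.span_le]
    rintro _ ⟨i, rfl⟩
    exact hEF i

/-- The values `D_i (t_l)` are constants, so a commutator kills every `t_l`. Written as `∑ c_k D_k`,
it takes the value `c_l` at `t_l`, so all coefficients vanish. -/
theorem commute_of_dual_frame {n : ℕ} (D : Fin n → Derivation Λ R R) (t : Fin n → R)
    (hlie : ∀ i j, ⁅D i, D j⁆ ∈ Submodule.span R (Set.range D))
    (hDt : ∀ i j, D i (t j) = if i = j then 1 else 0) (i j : Fin n) (r : R) :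
    D i (D j r) = D j (D i r) := by
  obtain ⟨c, hc⟩ := (Submodule.mem_span_range_iff_exists_fun R).1 (hlie i j)
  have h1 : ∀ l, c l = 0 := by
    intro l
    have h2 := congrArg (fun E : Derivation Λ R R => E (t l)) hc
    simp only [Derivation.commutator_apply, hDt] at h2
    have h3 : (∑ k, c k • D k) (t l) = c l := by
      rw [← Derivation.coeFnAddMonoidHom_apply, map_sum, Finset.sum_apply]
      simp [hDt]
    rw [h3] at h2
    rw [h2]
    split_ifs <;> simp
  rw [Finset.sum_eq_zero fun k _ => by rw [h1, zero_smul]] at hc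
  rw [← sub_eq_zero, ← Derivation.commutator_apply, ← hc, Derivation.zero_apply]

theorem Derivation.iterate_mul (D : Derivation Λ R R) (n : ℕ) (a b : R) :
    D^[n] (a * b) =
      ∑ q ∈ Finset.HasAntidiagonal.antidiagonal n, (n.choose q.1 : R) * (D^[q.1] a * D^[q.2] b) := by
  induction n with
  | zero => simp
  | succ n ih =>
    rw [Finset.sum_antidiagonal_choose_succ_mul (fun i j => D^[i] a * D^[j] b) n]
    simp only [Function.iterate_succ_apply', ih, map_sum, Derivation.leibniz, smul_eq_mul,
      Derivation.map_natCast, mul_zero, add_zero, mul_add, Finset.sum_add_distrib]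
    congr 1
    refine Finset.sum_congr rfl fun q hq => ?_
    rw [n.choose_symm_of_eq_add (Finset.HasAntidiagonal.mem_antidiagonal.1 hq).symm]
    ring

end frame

/-! ### Limits in pro-DP-artinian rings -/

section proDPArtin

variable {R : Type u} [CommRing R] [IsLocalRing R] [TopologicalSpace R]
  {γ : DividedPowers (maximalIdeal R)}

/-- The ideals that define the topology of a pro-DP-artinian ring. -/
def DividedPowers.IsOpenDPIdeal (γ : DividedPowers (maximalIdeal R)) (J : Ideal R) : Prop :=
  γ.IsSubDPIdeal J ∧ IsArtinianRing (R ⧸ J) ∧ IsOpen (J : Set R)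

theorem IsProDPArtin.eq_zero (h : IsProDPArtin γ) {x : R} (hx : ∀ J, γ.IsOpenDPIdeal J → x ∈ J) :
    x = 0 := by
  refine h.complete.1 (DividedPowers.Completion.ext fun J => ?_)
  exact (Ideal.Quotient.eq_zero_iff_mem.2 (hx J.1 J.2)).trans (map_zero _).symm

theorem IsProDPArtin.exists_limit (h : IsProDPArtin γ) (f : Ideal R → R)
    (hf : ∀ J J', γ.IsOpenDPIdeal J → γ.IsOpenDPIdeal J' → J ≤ J' → f J - f J' ∈ J') :
    ∃ x, ∀ J, γ.IsOpenDPIdeal J → x - f J ∈ J := by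
  obtain ⟨x, hx⟩ := h.complete.2 ⟨fun J => Ideal.Quotient.mk J.1 (f J.1), fun J J' hJ =>
    Ideal.Quotient.eq.2 (hf J.1 J'.1 J.2 J'.2 hJ)⟩
  refine ⟨x, fun J hJ => Ideal.Quotient.eq.1 ?_⟩
  exact congrFun (congrArg Subtype.val hx) ⟨J, hJ⟩

/-- Completeness in terms of representatives: a family of elements of `R` replaces an element of the
limit of the quotients. -/
theorem IsProDPArtin.of_exists_limit
    (hbasis : ∀ U ∈ nhds (0 : R), ∃ J : Ideal R, (J : Set R) ⊆ U ∧ γ.IsOpenDPIdeal J)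
    (hsep : ∀ x, (∀ J, γ.IsOpenDPIdeal J → x ∈ J) → x = 0)
    (hlim : ∀ f : Ideal R → R,
      (∀ J J', γ.IsOpenDPIdeal J → γ.IsOpenDPIdeal J' → J ≤ J' → f J - f J' ∈ J') →
      ∃ x, ∀ J, γ.IsOpenDPIdeal J → x - f J ∈ J) : IsProDPArtin γ := by
  refine ⟨hbasis, ?_, ?_⟩
  · rw [injective_iff_map_eq_zero]
    intro x hx
    refine hsep x fun J hJ => Ideal.Quotient.eq_zero_iff_mem.1 ?_
    exact congrFun (congrArg Subtype.val hx) ⟨J, hJ⟩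
  · intro g
    classical
    choose f hf using fun J => Ideal.Quotient.mk_surjective (g.1 J)
    -- The value `0` at other ideals is arbitrary; the conditions concern only open divided power
    -- ideals.
    obtain ⟨x, hx⟩ := hlim (fun J => if hJ : γ.IsOpenDPIdeal J then f ⟨J, hJ⟩ else 0) (by
      intro J J' hJ hJ' hle
      rw [dif_pos hJ, dif_pos hJ', ← Ideal.Quotient.eq]
      exact ((congrArg (Ideal.Quotient.factor hle) (hf ⟨J, hJ⟩)).trans
        (g.2 ⟨J, hJ⟩ ⟨J', hJ'⟩ hle)).trans (hf ⟨J', hJ'⟩).symm)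
    refine ⟨x, DividedPowers.Completion.ext fun J => ?_⟩
    have h1 := hx J.1 J.2
    rw [dif_pos (show γ.IsOpenDPIdeal J.1 from J.2)] at h1
    exact (Ideal.Quotient.eq.2 h1).trans (hf J)

theorem IsProDPArtin.continuous_of [IsTopologicalRing R] (h : IsProDPArtin γ) {G : Type*}
    [TopologicalSpace G] [AddGroup G] [IsTopologicalAddGroup G] (f : G →+ R)
    (hf : ∀ J, γ.IsOpenDPIdeal J → f ⁻¹' J ∈ nhds (0 : G)) : Continuous f := by
  refine continuous_of_continuousAt_zero f fun U hU => ?_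
  rw [map_zero] at hU
  obtain ⟨J, hJU, hJ⟩ := h.basis U hU
  exact Filter.mem_of_superset (hf J hJ) (Set.preimage_mono hJU)

theorem IsProDPArtin.exists_forall_mem (h : IsProDPArtin γ) {f : R →+ R} (hf : Continuous f)
    {J : Ideal R} (hJ : γ.IsOpenDPIdeal J) : ∃ J', γ.IsOpenDPIdeal J' ∧ ∀ x ∈ J', f x ∈ J := by
  have h1 : f ⁻¹' J ∈ nhds (0 : R) :=
    (hJ.2.2.preimage hf).mem_nhds (by rw [Set.mem_preimage, map_zero]; exact J.zero_mem)
  obtain ⟨J', h2, hJ'⟩ := h.basis _ h1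
  exact ⟨J', hJ', h2⟩

end proDPArtin

/-- The product of two finite sums is computed by the convolution. -/
theorem sum_range_mul_sum_range_eq {B : Type*} [CommRing B] {f g h : ℕ → B} {N : ℕ}
    (hf : ∀ m ≥ N, f m = 0) (hg : ∀ m ≥ N, g m = 0) (hh : ∀ m ≥ N, h m = 0)
    (H : ∀ m, h m = ∑ q ∈ Finset.HasAntidiagonal.antidiagonal m, f q.1 * g q.2) :
    ∑ m ∈ Finset.range N, h m = (∑ m ∈ Finset.range N, f m) * ∑ m ∈ Finset.range N, g m := by
  have key : ∀ k : ℕ → B, (∀ m ≥ N, k m = 0) →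
      ((∑ m ∈ Finset.range N, Polynomial.monomial m (k m) : Polynomial B) : PowerSeries B) =
        PowerSeries.mk k := by
    intro k hk
    ext m
    rw [Polynomial.coeff_coe, Polynomial.finsetSum_coeff, PowerSeries.coeff_mk]
    simp only [Polynomial.coeff_monomial, Finset.sum_ite_eq', Finset.mem_range]
    split_ifs with h1
    · rfl
    · exact (hk m (not_lt.1 h1)).symm
  have h2 : PowerSeries.mk h = PowerSeries.mk f * PowerSeries.mk g := by
    ext m
    rw [PowerSeries.coeff_mul, PowerSeries.coeff_mk, H]
    simp only [PowerSeries.coeff_mk]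
  rw [← key f hf, ← key g hg, ← key h hh, ← Polynomial.coe_mul, Polynomial.coe_inj] at h2
  have h3 := congrArg (Polynomial.eval 1) h2
  rw [Polynomial.eval_mul] at h3
  simpa [Polynomial.eval_finsetSum] using h3

/-! ### Truncated Taylor series along a derivation -/

section taylorSum

variable {Λ : Type v} {R : Type u} [CommRing Λ] [CommRing R] [IsLocalRing R] [Algebra Λ R]
  {γ : DividedPowers (maximalIdeal R)}

/-- The partial sums of the Taylor expansion of `r` at `t = 0`. -/
def taylorSum (γ : DividedPowers (maximalIdeal R)) (D : Derivation Λ R R) (t : R) (N : ℕ) (r : R) :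
    R :=
  ∑ m ∈ Finset.range N, γ.dpow m (-t) * D^[m] r

variable {D : Derivation Λ R R} {t : R}

theorem taylorSum_add (N : ℕ) (a b : R) :
    taylorSum γ D t N (a + b) = taylorSum γ D t N a + taylorSum γ D t N b := by
  simp only [taylorSum, iterate_map_add, mul_add, Finset.sum_add_distrib]

theorem taylorSum_of_apply_eq_zero (ht : t ∈ maximalIdeal R) (N : ℕ) {r : R} (hr : D r = 0) :
    taylorSum γ D t (N + 1) r = r := by
  rw [taylorSum, Finset.sum_range_succ', Finset.sum_eq_zero, zero_add,
    γ.dpow_zero (neg_mem ht), one_mul, Function.iterate_zero, id]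
  intro m _
  rw [Function.iterate_succ_apply, hr, iterate_map_zero, mul_zero]

theorem taylorSum_sub_mem {J : Ideal R} {N N' : ℕ} (hN : ∀ m ≥ N, γ.dpow m (-t) ∈ J)
    (hN' : N ≤ N') (r : R) : taylorSum γ D t N' r - taylorSum γ D t N r ∈ J := by
  rw [taylorSum, taylorSum, ← Finset.sum_range_add_sum_Ico _ hN', add_sub_cancel_left]
  exact J.sum_mem fun m hm => J.mul_mem_right _ (hN m (Finset.mem_Ico.1 hm).1)

theorem taylorSum_sub_mem' {J : Ideal R} {N N' : ℕ} (hN : ∀ m ≥ N, γ.dpow m (-t) ∈ J)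
    (hN' : ∀ m ≥ N', γ.dpow m (-t) ∈ J) (r : R) :
    taylorSum γ D t N' r - taylorSum γ D t N r ∈ J := by
  rcases le_total N N' with h | h
  · exact taylorSum_sub_mem hN h r
  · rw [← neg_mem_iff, neg_sub]
    exact taylorSum_sub_mem hN' h r

/-- Modulo `J` this is the multiplicativity of `exp (-tD)`: by Leibniz and `γ_i γ_j = (i + j choose
i) γ_{i+j}`, the terms of the series of `a b` are the convolutions of those of `a` and `b`. -/
theorem taylorSum_mul_sub_mem (ht : t ∈ maximalIdeal R) {J : Ideal R} {N : ℕ}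
    (hN : ∀ m ≥ N, γ.dpow m (-t) ∈ J) (a b : R) :
    taylorSum γ D t N (a * b) - taylorSum γ D t N a * taylorSum γ D t N b ∈ J := by
  have h0 : ∀ r, ∀ m ≥ N, Ideal.Quotient.mk J (γ.dpow m (-t) * D^[m] r) = 0 := fun r m hm =>
    Ideal.Quotient.eq_zero_iff_mem.2 (J.mul_mem_right _ (hN m hm))
  rw [← Ideal.Quotient.eq, map_mul]
  simp only [taylorSum, map_sum]
  refine sum_range_mul_sum_range_eq (h0 a) (h0 b) (h0 (a * b)) fun m => ?_
  rw [Derivation.iterate_mul, Finset.mul_sum, map_sum]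
  refine Finset.sum_congr rfl fun q hq => ?_
  rw [← map_mul]
  congr 1
  have h1 := γ.mul_dpow (m := q.1) (n := q.2) (neg_mem ht)
  rw [Finset.HasAntidiagonal.mem_antidiagonal.1 hq] at h1
  linear_combination (-(D^[q.1] a * D^[q.2] b)) * h1

theorem taylorSum_sub_self_mem (ht : t ∈ maximalIdeal R) (N : ℕ) (r : R) :
    taylorSum γ D t (N + 1) r - r ∈ Ideal.span ((fun m => γ.dpow m t) '' {m | m ≠ 0}) := by
  rw [taylorSum, Finset.sum_range_succ', γ.dpow_zero (neg_mem ht), one_mul, Function.iterate_zero,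
    id, add_sub_cancel_right]
  refine Ideal.sum_mem _ fun m _ => Ideal.mul_mem_right _ _ ?_
  rw [← neg_one_mul t, γ.dpow_mul ht]
  exact Ideal.mul_mem_left _ _ (Ideal.subset_span ⟨m + 1, m.succ_ne_zero, rfl⟩)

end taylorSum

section taylorSum

variable {Λ : Type v} {R : Type u} [CommRing Λ] [CommRing R] [IsLocalRing R] [Algebra Λ R]
  {γ : DividedPowers (maximalIdeal R)}

end taylorSum

/-! ### The Taylor projection onto the kernel of a derivation -/

section projection

variable {Λ : Type v} {R : Type u} [CommRing Λ] [CommRing R] [IsLocalRing R] [TopologicalSpace R]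
  [IsTopologicalRing R] [Algebra Λ R] {γ : DividedPowers (maximalIdeal R)}
  {D : Derivation Λ R R} {t : R}
  {D : Derivation Λ R R} {t : R}

theorem dpTangent_iterate_dpow (hD : D ∈ dpTangent Λ γ)
    (ht : t ∈ maximalIdeal R) (hDt : D t = 1) (m : ℕ) :
    ∀ i, D^[i] (γ.dpow m t) = if i ≤ m then γ.dpow (m - i) t else 0 := by
  intro i
  induction i with
  | zero => simp
  | succ i ih =>
    rw [Function.iterate_succ_apply', ih]
    split_ifs with h1 h2 h2
    · obtain ⟨k, rfl⟩ := Nat.exists_eq_add_of_le h2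
      rw [show i + 1 + k - i = k + 1 by omega, show i + 1 + k - (i + 1) = k by omega,
        hD.2 _ _ ht, hDt, mul_one]
    · rw [show m - i = 0 by omega, γ.dpow_zero ht, D.map_one_eq_zero]
    · omega
    · exact map_zero D

theorem dpTangent_map_dpow_eq_zero (hD : D ∈ dpTangent Λ γ)
    (ht : t ∈ maximalIdeal R) (hDt : D t = 0) (m : ℕ) : D (γ.dpow m t) = 0 := by
  cases m with
  | zero => rw [γ.dpow_zero ht, D.map_one_eq_zero]
  | succ m => rw [hD.2 _ _ ht, hDt, mul_zero]

/-- Since `D (-t) = -1`, the sum telescopes and only one half of the derivative of the last term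
survives. -/
theorem apply_taylorSum (hD : D ∈ dpTangent Λ γ) (ht : t ∈ maximalIdeal R) (hDt : D t = 1) (N : ℕ)
    (r : R) : D (taylorSum γ D t (N + 1) r) = γ.dpow N (-t) * D^[N + 1] r := by
  have hD' : D (-t) = -1 := by rw [map_neg, hDt]
  induction N with
  | zero =>
    simp [taylorSum, γ.dpow_zero (neg_mem ht)]
  | succ N ih =>
    rw [taylorSum, Finset.sum_range_succ, map_add, ← taylorSum, ih, Derivation.leibniz,
      hD.2 _ _ (neg_mem ht), hD', smul_eq_mul, smul_eq_mul, ← Function.iterate_succ_apply' D]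
    ring

/-- The Taylor sum is the expansion of `γ_m(-t + t) = γ_m(0) = 0` by the addition formula. -/
theorem taylorSum_dpow (hD : D ∈ dpTangent Λ γ) (ht : t ∈ maximalIdeal R) (hDt : D t = 1)
    {m N : ℕ} (hm : m ≠ 0) (hN : m < N) : taylorSum γ D t N (γ.dpow m t) = 0 := by
  have h1 := γ.dpow_add' (n := m) (neg_mem ht) ht
  rw [neg_add_cancel, γ.dpow_eval_zero hm] at h1
  rw [h1, taylorSum]
  symm
  refine Finset.sum_subset_zero_on_sdiff (Finset.range_mono hN) ?_ ?_
  · intro i hi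
    rw [Finset.mem_sdiff, Finset.mem_range, Finset.mem_range] at hi
    rw [dpTangent_iterate_dpow hD ht hDt, if_neg (by omega), mul_zero]
  · intro i hi
    rw [dpTangent_iterate_dpow hD ht hDt, if_pos (by have := Finset.mem_range.1 hi; omega)]

theorem taylorSum_comm (ht : t ∈ maximalIdeal R) {E : Derivation Λ R R}
    (hE : E ∈ dpTangent Λ γ) (hEt : E t = 0) (hED : ∀ r, E (D r) = D (E r)) (N : ℕ) (r : R) :
    E (taylorSum γ D t N r) = taylorSum γ D t N (E r) := by
  have h1 : ∀ m, E (D^[m] r) = D^[m] (E r) := by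
    intro m
    induction m with
    | zero => rfl
    | succ m ih => rw [Function.iterate_succ_apply', hED, ih, Function.iterate_succ_apply']
  rw [taylorSum, map_sum, taylorSum]
  refine Finset.sum_congr rfl fun m _ => ?_
  rw [Derivation.leibniz, dpTangent_map_dpow_eq_zero hE (neg_mem ht) (by rw [map_neg, hEt, neg_zero]),
    smul_zero, add_zero, smul_eq_mul, h1]

theorem continuous_iterate (hD : D ∈ dpTangent Λ γ) (m : ℕ) : Continuous (D^[m]) :=
  hD.1.iterate m

theorem continuous_taylorSum (hD : D ∈ dpTangent Λ γ) (N : ℕ) :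
    Continuous (taylorSum γ D t N) :=
  continuous_finsetSum _ fun m _ => continuous_const.mul (continuous_iterate hD m)

/-- The projection to the kernel of a divided power derivation `D` with `D t = 1`. -/
theorem IsProDPArtin.exists_projection (h : IsProDPArtin γ) (hD : D ∈ dpTangent Λ γ)
    (ht : t ∈ maximalIdeal R) (hDt : D t = 1)
    (hconv : ∀ J, γ.IsOpenDPIdeal J → ∃ N, ∀ m ≥ N, γ.dpow m (-t) ∈ J) :
    ∃ P : R →+* R, Continuous P ∧ (∀ r, D r = 0 → P r = r) ∧ (∀ r, D (P r) = 0) ∧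
      (∀ m ≠ 0, P (γ.dpow m t) = 0) ∧
      (∀ J, γ.IsOpenDPIdeal J → ∀ r,
        r - P r ∈ Ideal.span ((fun m => γ.dpow m t) '' {m | m ≠ 0}) ⊔ J) ∧
      ∀ E ∈ dpTangent Λ γ, E t = 0 → (∀ r, E (D r) = D (E r)) → ∀ r, E (P r) = P (E r) := by
  choose! N hN using hconv
  -- The limit is compared with every sufficiently long truncation, not only with the chosen one, so
  -- that lengths may be adapted to several ideals at once.
  have hlim : ∀ r, ∃ x, ∀ J, γ.IsOpenDPIdeal J → ∀ n, (∀ m ≥ n, γ.dpow m (-t) ∈ J) →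
      x - taylorSum γ D t n r ∈ J := by
    intro r
    obtain ⟨x, hx⟩ := h.exists_limit (fun J => taylorSum γ D t (N J) r) (by
      intro J J' hJ hJ' hle
      exact taylorSum_sub_mem' (hN J' hJ') (fun m hm => hle (hN J hJ m hm)) r)
    refine ⟨x, fun J hJ n hn => ?_⟩
    have := J.add_mem (hx J hJ) (taylorSum_sub_mem' (D := D) hn (hN J hJ) r)
    rwa [sub_add_sub_cancel] at this
  choose P hP using hlim
  have heq : ∀ x y, (∀ J, γ.IsOpenDPIdeal J → x - y ∈ J) → x = y := fun x y hxy =>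
    sub_eq_zero.1 (h.eq_zero hxy)
  have hP' : ∀ J, γ.IsOpenDPIdeal J → ∀ n ≥ N J, ∀ r, P r - taylorSum γ D t n r ∈ J :=
    fun J hJ n hn r => hP r J hJ n fun m hm => hN J hJ m (hn.trans hm)
  have hfix : ∀ r, D r = 0 → P r = r := fun r hr => heq _ _ fun J hJ => by
    have := hP' J hJ (N J + 1) (Nat.le_succ _) r
    rwa [taylorSum_of_apply_eq_zero ht _ hr] at this
  have hadd : ∀ a b, P (a + b) = P a + P b := fun a b => heq _ _ fun J hJ => by
    have := J.sub_mem (hP' J hJ _ le_rfl (a + b))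
      (J.add_mem (hP' J hJ _ le_rfl a) (hP' J hJ _ le_rfl b))
    rw [taylorSum_add] at this
    convert this using 1
    ring
  have hmul : ∀ a b, P (a * b) = P a * P b := fun a b => heq _ _ fun J hJ => by
    have h1 := hP' J hJ _ le_rfl (a * b)
    have h2 := hP' J hJ _ le_rfl a
    have h3 := hP' J hJ _ le_rfl b
    have h4 := taylorSum_mul_sub_mem (D := D) ht (hN J hJ) a b
    rw [← Ideal.Quotient.eq] at h1 h2 h3 h4 ⊢
    rw [h1, h4, map_mul, map_mul, h2, h3]
  let Φ : R →+* R :=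
    { toFun := P
      map_one' := hfix 1 D.map_one_eq_zero
      map_zero' := hfix 0 (map_zero D)
      map_add' := hadd
      map_mul' := hmul }
  -- By continuity of `E`, the derivative of the limit is the limit of the derivatives, uniformly in
  -- `r`.
  have hcont : ∀ (E : Derivation Λ R R), E ∈ dpTangent Λ γ → ∀ J, γ.IsOpenDPIdeal J →
      ∃ M, ∀ n ≥ M, ∀ r, E (P r) - E (taylorSum γ D t n r) ∈ J := by
    intro E hE J hJ
    obtain ⟨J', hJ', hle⟩ := h.exists_forall_mem (f := E.toLinearMap.toAddMonoidHom) hE.1 hJ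
    refine ⟨N J', fun n hn r => ?_⟩
    rw [← map_sub]
    exact hle _ (hP' J' hJ' n hn r)
  refine ⟨Φ, ?_, hfix, ?_, ?_, ?_, ?_⟩
  · refine h.continuous_of Φ.toAddMonoidHom fun J hJ => ?_
    -- Modulo `J` the projection is a finite Taylor sum, which is continuous.
    have h1 : Φ.toAddMonoidHom ⁻¹' J = taylorSum γ D t (N J) ⁻¹' J := by
      ext r
      have := hP' J hJ _ le_rfl r
      exact ⟨fun hr => (J.sub_mem_iff_right hr).1 this, fun hr => (J.sub_mem_iff_left hr).1 this⟩
    rw [h1]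
    refine (hJ.2.2.preimage (continuous_taylorSum hD _)).mem_nhds ?_
    have : taylorSum γ D t (N J) 0 = 0 := by simp [taylorSum]
    rw [Set.mem_preimage, this]
    exact J.zero_mem
  · intro r
    refine h.eq_zero fun J hJ => ?_
    obtain ⟨M, hM⟩ := hcont D hD J hJ
    -- The extra term matches `apply_taylorSum`: the derivative of the sum is then a multiple of
    -- `γ_n(-t)` with `n ≥ N J`, which lies in `J`.
    have h1 := hM (max M (N J) + 1) (by omega) r
    rw [apply_taylorSum hD ht hDt] at h1
    exact (J.sub_mem_iff_left (J.mul_mem_right _ (hN J hJ _ (by omega)))).1 h1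
  · intro m hm
    refine h.eq_zero fun J hJ => ?_
    have h1 := hP' J hJ (max (N J) (m + 1)) (by omega) (γ.dpow m t)
    rwa [taylorSum_dpow hD ht hDt hm (by omega), sub_zero] at h1
  · intro J hJ r
    have h1 := hP' J hJ (N J + 1) (Nat.le_succ _) r
    have h2 := taylorSum_sub_self_mem (γ := γ) (D := D) ht (N J) r
    rw [show r - Φ r = -(taylorSum γ D t (N J + 1) r - r) + -(P r - taylorSum γ D t (N J + 1) r) by
      change r - P r = _; ring]
    exact Submodule.add_mem_sup (neg_mem h2) (neg_mem h1)
  · intro E hE hEt hED r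
    refine heq _ _ fun J hJ => ?_
    obtain ⟨M, hM⟩ := hcont E hE J hJ
    have h1 := hM (max M (N J)) (by omega) r
    have h2 := hP' J hJ (max M (N J)) (by omega) (E r)
    rw [taylorSum_comm ht hE hEt hED] at h1
    have := J.sub_mem h1 h2
    rwa [sub_sub_sub_cancel_right] at this

end projection

theorem Derivation.map_prod_eq_zero {Λ R ι : Type*} [CommRing Λ] [CommRing R] [Algebra Λ R]
    (D : Derivation Λ R R) {s : Finset ι} {f : ι → R} (h : ∀ i ∈ s, D (f i) = 0) :
    D (∏ i ∈ s, f i) = 0 := by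
  induction s using Finset.cons_induction with
  | empty => rw [Finset.prod_empty, D.map_one_eq_zero]
  | cons i s hi ih =>
    rw [Finset.prod_cons, Derivation.leibniz, h i (Finset.mem_cons_self i s),
      ih fun j hj => h j (Finset.mem_cons_of_mem hj), smul_zero, smul_zero, add_zero]

/-! ### Projection along a commuting frame, and coefficient functionals -/

section frameProjection

variable {Λ : Type v} {R : Type u} [CommRing Λ] [CommRing R] [IsLocalRing R] [TopologicalSpace R]
  [IsTopologicalRing R] [Algebra Λ R] {γ : DividedPowers (maximalIdeal R)} {n : ℕ}
  {D : Fin n → Derivation Λ R R} {t : Fin n → R}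

/-- The projections of the single `D i` are composed. The one for `i` commutes with `D j` for `j ≠
i`, because the frame commutes and `D j (t i) = 0`; hence it preserves the kernels reached before.
-/
theorem IsProDPArtin.exists_finset_projection (h : IsProDPArtin γ) (hD : ∀ i, D i ∈ dpTangent Λ γ)
    (ht : ∀ i, t i ∈ maximalIdeal R) (hDt : ∀ i j, D i (t j) = if i = j then 1 else 0)
    (hcomm : ∀ i j r, D i (D j r) = D j (D i r))
    (hconv : ∀ i J, γ.IsOpenDPIdeal J → ∃ N, ∀ m ≥ N, γ.dpow m (-t i) ∈ J) (s : Finset (Fin n)) :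
    ∃ P : R →+* R, Continuous P ∧ (∀ r, (∀ i ∈ s, D i r = 0) → P r = r) ∧
      (∀ i ∈ s, ∀ r, D i (P r) = 0) ∧ (∀ i ∈ s, ∀ m ≠ 0, P (γ.dpow m (t i)) = 0) ∧
      (∀ J, γ.IsOpenDPIdeal J → ∀ r,
        r - P r ∈ Ideal.span {y | ∃ i, ∃ m ≠ 0, γ.dpow m (t i) = y} ⊔ J) ∧
      ∀ j ∉ s, ∀ r, D j (P r) = P (D j r) := by
  induction s using Finset.induction_on with
  | empty => exact ⟨RingHom.id R, continuous_id, by simp, by simp, by simp, by simp, by simp⟩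
  | insert i s hi ih =>
    obtain ⟨P, hP, hfix, hker, hzero, hsub, hc⟩ := ih
    obtain ⟨Q, hQ, hfixQ, hkerQ, hzeroQ, hsubQ, hcQ⟩ :=
      h.exists_projection (hD i) (ht i) (by rw [hDt, if_pos rfl]) (hconv i)
    refine ⟨Q.comp P, hQ.comp hP, ?_, ?_, ?_, ?_, ?_⟩
    · intro r hr
      rw [RingHom.comp_apply, hfix r fun j hj => hr j (Finset.mem_insert_of_mem hj),
        hfixQ r (hr i (Finset.mem_insert_self i s))]
    · intro j hj r
      rw [RingHom.comp_apply]
      rcases eq_or_ne j i with rfl | hji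
      · exact hkerQ _
      · rw [hcQ _ (hD j) (by rw [hDt, if_neg hji]) (hcomm j i),
          hker j ((Finset.mem_insert.1 hj).resolve_left hji), map_zero]
    · intro j hj m hm
      rw [RingHom.comp_apply]
      rcases eq_or_ne j i with rfl | hji
      · rw [hfix, hzeroQ m hm]
        intro k hk
        exact dpTangent_map_dpow_eq_zero (hD k) (ht j)
          (by rw [hDt, if_neg (by rintro rfl; exact hi hk)]) m
      · rw [hzero j ((Finset.mem_insert.1 hj).resolve_left hji) m hm, map_zero]
    · intro J hJ r
      have h1 : Ideal.span ((fun m => γ.dpow m (t i)) '' {m | m ≠ 0}) ⊔ J ≤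
          Ideal.span {y | ∃ i, ∃ m ≠ 0, γ.dpow m (t i) = y} ⊔ J := by
        refine sup_le_sup_right (Ideal.span_mono ?_) _
        rintro _ ⟨m, hm, rfl⟩
        exact ⟨i, m, hm, rfl⟩
      have := Ideal.add_mem _ (hsub J hJ r) (h1 (hsubQ J hJ (P r)))
      rwa [sub_add_sub_cancel] at this
    · intro j hj r
      have hji : j ≠ i := fun h => hj (h ▸ Finset.mem_insert_self i s)
      rw [RingHom.comp_apply, hcQ _ (hD j) (by rw [hDt, if_neg hji]) (hcomm j i),
        hc j (fun h => hj (Finset.mem_insert_of_mem h))]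
      rfl

/-- A dual derivation lowers the exponent of a divided power monomial. -/
theorem dpTangent_map_prod_dpow (hD : ∀ i, D i ∈ dpTangent Λ γ)
    (ht : ∀ i, t i ∈ maximalIdeal R) (hDt : ∀ i j, D i (t j) = if i = j then 1 else 0)
    (i : Fin n) (α : Fin n → ℕ) {a : R} (ha : D i a = 0) :
    D i ((∏ j, γ.dpow (α j) (t j)) * a) =
      if α i = 0 then 0 else
        (∏ j, γ.dpow (Function.update α i (α i - 1) j) (t j)) * a := by
  have h0 : D i ((∏ j ∈ Finset.univ.erase i, γ.dpow (α j) (t j)) * a) = 0 := by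
    rw [Derivation.leibniz, ha, smul_zero, zero_add, Derivation.map_prod_eq_zero, smul_zero]
    intro j hj
    exact dpTangent_map_dpow_eq_zero (hD i) (ht j)
      (by rw [hDt, if_neg (Finset.ne_of_mem_erase hj).symm]) _
  have h1 : ∀ β : Fin n → ℕ, (∏ j, γ.dpow (β j) (t j)) * a =
      γ.dpow (β i) (t i) * ((∏ j ∈ Finset.univ.erase i, γ.dpow (β j) (t j)) * a) := fun β => by
    rw [← Finset.mul_prod_erase Finset.univ _ (Finset.mem_univ i), mul_assoc]
  rw [h1, Derivation.leibniz, h0, smul_zero, zero_add, smul_eq_mul]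
  split_ifs with h2
  · rw [h2, γ.dpow_zero (ht i), Derivation.map_one_eq_zero, mul_zero]
  · obtain ⟨k, hk⟩ := Nat.exists_eq_succ_of_ne_zero h2
    rw [h1, Function.update_self, hk, (hD i).2 _ _ (ht i), hDt, if_pos rfl, mul_one,
      Nat.succ_sub_one, mul_comm]
    congr 2
    refine Finset.prod_congr rfl fun j hj => ?_
    rw [Function.update_of_ne (Finset.ne_of_mem_erase hj)]

/-- The coefficient functionals of divided power expansions. -/
theorem exists_dpCoeff (hD : ∀ i, D i ∈ dpTangent Λ γ) (ht : ∀ i, t i ∈ maximalIdeal R)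
    (hDt : ∀ i j, D i (t j) = if i = j then 1 else 0) {P : R →+* R} (hP : Continuous P)
    (hfix : ∀ r, (∀ i, D i r = 0) → P r = r) (hzero : ∀ i, ∀ m ≠ 0, P (γ.dpow m (t i)) = 0)
    (β : Fin n → ℕ) :
    ∃ Q : R →+ R, Continuous Q ∧ ∀ a, (∀ i, D i a = 0) → ∀ α : Fin n → ℕ,
      Q ((∏ j, γ.dpow (α j) (t j)) * a) = if α = β then a else 0 := by
  obtain ⟨k, hk⟩ : ∃ k, ∑ i, β i = k := ⟨_, rfl⟩
  induction k generalizing β with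
  | zero =>
    have hβ : β = 0 := by
      funext i
      exact Finset.sum_eq_zero_iff.1 hk i (Finset.mem_univ i)
    subst hβ
    refine ⟨P.toAddMonoidHom, hP, fun a ha α => ?_⟩
    change P _ = _
    rw [map_mul, map_prod, hfix a ha]
    split_ifs with h1
    · subst h1
      simp [γ.dpow_zero (ht _)]
    · obtain ⟨i, hi⟩ := Function.ne_iff.1 h1
      rw [Finset.prod_eq_zero (Finset.mem_univ i) (hzero i _ hi), zero_mul]
  | succ k ih =>
    obtain ⟨i, hi⟩ : ∃ i, β i ≠ 0 := by
      by_contra! h1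
      simp [h1] at hk
    obtain ⟨Q, hQ, hQ'⟩ := ih (Function.update β i (β i - 1)) (by
      rw [Finset.sum_update_of_mem (Finset.mem_univ i)]
      rw [← Finset.add_sum_erase _ _ (Finset.mem_univ i), Finset.erase_eq] at hk
      omega)
    -- Unrolled, the functional is `P ∘ D^β`: the constant term of the derivative of order `β`. No
    -- factorial appears, since `D i` lowers exponents of divided powers without a factor.
    refine ⟨Q.comp (D i).toLinearMap.toAddMonoidHom, hQ.comp (hD i).1, fun a ha α => ?_⟩
    change Q (D i _) = _
    rw [dpTangent_map_prod_dpow hD ht hDt i α (ha i)]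
    split_ifs with h1 h2 h2
    · exact absurd (h2 ▸ h1) hi
    · exact map_zero Q
    · subst h2
      rw [hQ' a ha, if_pos rfl]
    · rw [hQ' a ha, if_neg]
      intro h3
      refine h2 (funext fun j => ?_)
      have h4 := congrFun h3 j
      rcases eq_or_ne j i with rfl | hj
      · rw [Function.update_self, Function.update_self] at h4
        omega
      · rwa [Function.update_of_ne hj, Function.update_of_ne hj] at h4

end frameProjection

/-- The projection of an inverse in `R` is an inverse in `A`. -/
theorem Subalgebra.isLocalHom_of_retract {Λ R : Type*} [CommRing Λ] [CommRing R] [Algebra Λ R]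
    (A : Subalgebra Λ R) {P : R →+* R} (hmem : ∀ r, P r ∈ A) (hfix : ∀ a ∈ A, P a = a) :
    IsLocalHom A.val.toRingHom := by
  refine ⟨fun a ha => ?_⟩
  obtain ⟨b, hb⟩ := ha.exists_right_inv
  refine IsUnit.of_mul_eq_one ⟨P b, hmem b⟩ (Subtype.ext ?_)
  have h1 := congrArg P hb
  rw [map_mul, map_one] at h1
  have h2 : P (A.val.toRingHom a) = a := hfix _ a.2
  rwa [h2] at h1

/-! ### Retracts of pro-DP-artinian rings -/

section retract

variable {R : Type u} [CommRing R] [IsLocalRing R] [TopologicalSpace R]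
  {γ : DividedPowers (maximalIdeal R)}

/-- `γ_k(γ_m(t))` is an integer multiple of `γ_{km}(t)`. -/
theorem DividedPowers.dpow_span_isSubDPIdeal {R ι : Type*} [CommRing R] {I : Ideal R}
    (γ : DividedPowers I) {t : ι → R} (ht : ∀ i, t i ∈ I) :
    γ.IsSubDPIdeal (Ideal.span {y | ∃ i, ∃ m ≠ 0, γ.dpow m (t i) = y}) := by
  have hsub : {y | ∃ i, ∃ m ≠ 0, γ.dpow m (t i) = y} ⊆ (I : Set R) := by
    rintro _ ⟨i, m, hm, rfl⟩
    exact γ.dpow_mem hm (ht i)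
  rw [DividedPowers.span_isSubDPIdeal_iff hsub]
  rintro k hk _ ⟨i, m, hm, rfl⟩
  rw [γ.dpow_comp hm (ht i)]
  exact Ideal.mul_mem_left _ _ (Ideal.subset_span ⟨i, k * m, mul_ne_zero hk hm, rfl⟩)

/-- A continuous projection which kills a divided power ideal `K` with `x - P x ∈ K` up to
arbitrarily small elements is a divided power morphism. -/
theorem IsProDPArtin.isDPMorphism_projection (h : IsProDPArtin γ) {P : R →+* R}
    (hP : Continuous P) {K : Ideal R} (hK : γ.IsSubDPIdeal K) (hPK : K ≤ RingHom.ker P)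
    (hsub : ∀ J, γ.IsOpenDPIdeal J → ∀ r, r - P r ∈ K ⊔ J)
    (hfix : ∀ m, ∀ x ∈ maximalIdeal R, P x ∈ maximalIdeal R →
      P (γ.dpow m (P x)) = γ.dpow m (P x)) : γ.IsDPMorphism γ P := by
  have hle : ∀ J, γ.IsOpenDPIdeal J → K ⊔ J ≤ maximalIdeal R := fun J hJ =>
    sup_le hK.isSubideal hJ.1.isSubideal
  have hmem : ∀ x ∈ maximalIdeal R, P x ∈ maximalIdeal R := by
    intro x hx
    obtain ⟨J, -, hJ⟩ := h.basis _ Filter.univ_mem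
    exact ((maximalIdeal R).sub_mem_iff_right hx).1 (hle J hJ (hsub J hJ x))
  refine ⟨Ideal.map_le_iff_le_comap.2 hmem, fun {m} x hx => ?_⟩
  rw [← hfix m x hx (hmem x hx), ← sub_eq_zero, ← map_sub]
  refine h.eq_zero fun J hJ => ?_
  obtain ⟨J', hJ', hPJ⟩ := h.exists_forall_mem (f := P.toAddMonoidHom) hP hJ
  have h1 : γ.IsSubDPIdeal ((K ⊔ J') ⊓ maximalIdeal R) := by
    rw [inf_eq_left.2 (hle J' hJ')]
    exact γ.isSubDPIdeal_sup hK hJ'.1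
  -- `x` and `P x` agree modulo the divided power ideal `K ⊔ J'`, hence so do their divided powers;
  -- now `P` kills `K` and maps `J'` into `J`.
  have h2 : γ.dpow m (P x) - γ.dpow m x ∈ K ⊔ J' := γ.isSubDPIdeal_inf_iff.1 h1 (hmem x hx) hx
    (by rw [← neg_mem_iff, neg_sub]; exact hsub J' hJ' x)
  obtain ⟨a, ha, b, hb, hab⟩ := Submodule.mem_sup.1 h2
  rw [← hab, map_add, RingHom.mem_ker.1 (hPK ha), zero_add]
  exact hPJ b hb

variable [IsTopologicalRing R] {Λ : Type v} [CommRing Λ] [Algebra Λ R] (A : Subalgebra Λ R)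
  {P : R →+* R}

/-- A retract of a pro-DP-artinian ring under a continuous divided power projection is
pro-DP-artinian. -/
theorem IsProDPArtin.exists_retract (h : IsProDPArtin γ) (hP : Continuous P)
    (hdp : γ.IsDPMorphism γ P) (hmem : ∀ r, P r ∈ A) (hfix : ∀ a ∈ A, P a = a) :
    ∃ (_ : IsLocalRing A) (γ' : DividedPowers (maximalIdeal A)),
      γ'.IsDPMorphism γ A.val.toRingHom ∧ γ.IsDPMorphism γ' (P.codRestrict A hmem) ∧
      IsProDPArtin γ' := by
  have hlocal := A.isLocalHom_of_retract hmem hfix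
  have : IsLocalRing A := RingHom.domain_isLocalRing A.val.toRingHom
  have hmax : ∀ a : A, a ∈ maximalIdeal A ↔ (a : R) ∈ maximalIdeal R := fun a =>
    (IsLocalRing.maximalIdeal_comap A.val.toRingHom).symm ▸ Iff.rfl
  set Q : R →+* A := P.codRestrict A hmem with hQ
  have hQval : ∀ r, (Q r : R) = P r := fun r => rfl
  have hQA : ∀ a : A, Q a = a := fun a => Subtype.ext (hfix a a.2)
  have hQmem : ∀ {r}, r ∈ maximalIdeal R → Q r ∈ maximalIdeal A := fun hr =>
    (hmax _).2 (hdp.ideal_comp (Ideal.mem_map_of_mem P hr))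
  have hval : ∀ (n : ℕ) (a : A), (Q (γ.dpow n a) : R) = γ.dpow n a := by
    intro n a
    by_cases ha : (a : R) ∈ maximalIdeal R
    · have h1 := hdp.map_dpow (n := n) ha
      rw [hfix a a.2] at h1
      rw [hQval, h1]
    · rw [γ.dpow_null ha, map_zero]; rfl
  -- By `hval` the divided powers of an element of `A` already lie in `A`; composing with `Q` only
  -- records this membership, and the axioms descend from `R`.
  let γ' : DividedPowers (maximalIdeal A) :=
    { dpow := fun n a => Q (γ.dpow n a)
      dpow_null := fun {n a} ha => by rw [γ.dpow_null (mt (hmax a).2 ha), map_zero]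
      dpow_zero := fun {a} ha => by rw [γ.dpow_zero ((hmax a).1 ha), map_one]
      dpow_one := fun {a} ha => by rw [γ.dpow_one ((hmax a).1 ha), hQA]
      dpow_mem := fun {n a} hn ha => hQmem (γ.dpow_mem hn ((hmax a).1 ha))
      dpow_add := fun {n a b} ha hb => by
        rw [Subalgebra.coe_add, γ.dpow_add ((hmax a).1 ha) ((hmax b).1 hb), map_sum]
        simp only [map_mul]
      dpow_mul := fun {n a b} hb => by
        rw [Subalgebra.coe_mul, γ.dpow_mul ((hmax b).1 hb), map_mul, map_pow, hQA]
      mul_dpow := fun {m n a} ha => by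
        rw [← map_mul, γ.mul_dpow ((hmax a).1 ha), map_mul, map_natCast]
      dpow_comp := fun {m n a} hn ha => by
        rw [hval, γ.dpow_comp hn ((hmax a).1 ha), map_mul, map_natCast] }
  have hγ'Q : γ.IsDPMorphism γ' Q := by
    refine ⟨Ideal.map_le_iff_le_comap.2 fun r hr => hQmem hr, fun {n} r hr => ?_⟩
    refine Subtype.ext ?_
    change (Q (γ.dpow n (Q r : R)) : R) = _
    rw [hval, hQval, hQval, hdp.map_dpow hr]
  have hQc : Continuous Q := hP.subtype_mk hmem
  have hQs : Function.Surjective Q := fun a => ⟨a, hQA a⟩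
  have himg : ∀ J : Ideal R, ∀ a ∈ J.map Q, ∃ r ∈ J, Q r = a := fun J a ha =>
    (Ideal.mem_map_iff_of_surjective Q hQs).1 ha
  have hmap : ∀ J, γ.IsOpenDPIdeal J → γ'.IsOpenDPIdeal (J.map Q) := by
    intro J hJ
    refine ⟨⟨Ideal.map_le_iff_le_comap.2 fun r hr => hQmem (hJ.1.isSubideal hr), ?_⟩, ?_, ?_⟩
    · intro n hn a ha
      obtain ⟨r, hr, rfl⟩ := himg J a ha
      rw [← hγ'Q.map_dpow (hJ.1.isSubideal hr)]
      exact Ideal.mem_map_of_mem Q (hJ.1.dpow_mem n hn hr)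
    · have := hJ.2.1
      exact (Ideal.quotientMap_surjective (f := Q) (J := J) (H := Ideal.le_comap_map) hQs).isArtinianRing
    · have h1 : IsOpen ((J.comap A.val : Ideal A) : Set A) :=
        hJ.2.2.preimage continuous_subtype_val
      refine AddSubgroup.isOpen_mono (H₁ := (J.comap A.val).toAddSubgroup)
        (H₂ := (J.map Q).toAddSubgroup) ?_ h1
      intro a ha
      have := Ideal.mem_map_of_mem Q (show (a : R) ∈ J from ha)
      rwa [hQA] at this
  -- Continuity of `Q` makes the images of the open divided power ideals of `R` a basis at zero in
  -- `A`.
  have hsmall : ∀ U ∈ nhds (0 : A), ∃ J, γ.IsOpenDPIdeal J ∧ ((J.map Q : Ideal A) : Set A) ⊆ U := by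
    intro U hU
    have h1 : Q ⁻¹' U ∈ nhds (0 : R) :=
      hQc.continuousAt.preimage_mem_nhds (by rwa [map_zero])
    obtain ⟨J, hJU, hJ⟩ := h.basis _ h1
    refine ⟨J, hJ, fun a ha => ?_⟩
    obtain ⟨r, hr, rfl⟩ := himg J a ha
    exact hJU hr
  have hnhds : ∀ J : Ideal A, IsOpen (J : Set A) → (J : Set A) ∈ nhds 0 := fun J hJ =>
    hJ.mem_nhds J.zero_mem
  have hcomap : ∀ J : Ideal R, IsOpen (J : Set R) →
      ∃ K, γ.IsOpenDPIdeal K ∧ K.map Q ≤ J.comap A.val := fun J hJ =>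
    hsmall _ (hnhds _ (hJ.preimage continuous_subtype_val))
  refine ⟨inferInstance, γ', ⟨Ideal.map_le_iff_le_comap.2 fun a ha => (hmax a).1 ha,
    fun {n} a _ => (hval n a).symm⟩, hγ'Q, IsProDPArtin.of_exists_limit ?_ ?_ ?_⟩
  · intro U hU
    obtain ⟨J, hJ, hJU⟩ := hsmall U hU
    exact ⟨J.map Q, hJU, hmap J hJ⟩
  · intro x hx
    refine Subtype.ext (h.eq_zero fun J hJ => ?_)
    obtain ⟨K, hK, hle⟩ := hcomap J hJ.2.2
    exact hle (hx _ (hmap K hK))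
  · intro f hf
    -- Compatibility is given only for nested ideals; two ideals are compared through a third one
    -- inside both.
    have hcompat : ∀ J J', γ'.IsOpenDPIdeal J → γ'.IsOpenDPIdeal J' → ∀ N : Ideal A, J ≤ N →
        J' ≤ N → f J - f J' ∈ N := by
      intro J J' hJ hJ' N hN hN'
      obtain ⟨K, hK, hle⟩ := hsmall _ (Filter.inter_mem (hnhds J hJ.2.2) (hnhds J' hJ'.2.2))
      have h1 := hN (hf _ J (hmap K hK) hJ fun a ha => (hle ha).1)
      have h2 := hN' (hf _ J' (hmap K hK) hJ' fun a ha => (hle ha).2)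
      have := N.sub_mem h2 h1
      rwa [sub_sub_sub_cancel_left] at this
    -- To each `J` in `R` belongs a `K` with `Q(K) ⊆ J ∩ A`; the values at `Q(K)` form a compatible
    -- family in `R`, whose limit is projected back to `A`.
    choose! K hK hle using fun (J : Ideal R) (hJ : γ.IsOpenDPIdeal J) => hcomap J hJ.2.2
    obtain ⟨x, hx⟩ := h.exists_limit (fun J => (f ((K J).map Q) : R)) (by
      intro J J' hJ hJ' hJJ'
      exact hcompat _ _ (hmap _ (hK J hJ)) (hmap _ (hK J' hJ')) (J'.comap A.val)
        ((hle J hJ).trans (Ideal.comap_mono hJJ')) (hle J' hJ'))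
    refine ⟨Q x, fun J' hJ' => ?_⟩
    obtain ⟨J, hJ, hJJ'⟩ := hsmall _ (hnhds J' hJ'.2.2)
    have h1 := hJJ' (Ideal.mem_map_of_mem Q (hx J hJ))
    rw [map_sub, hQA] at h1
    have h2 := hcompat _ _ (hmap _ (hK J hJ)) hJ' J' (fun a ha => hJJ' (by
      have := Ideal.mem_map_of_mem Q (hle J hJ ha)
      rwa [Subalgebra.coe_val, hQA] at this)) le_rfl
    have := J'.add_mem h1 h2
    rwa [sub_add_sub_cancel] at this

end retract

/-! ### Divided power monomials span the divided power polynomial ring -/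

namespace DPPolynomial

variable {A : Type u} [CommRing A] [IsLocalRing A] (γ : DividedPowers (maximalIdeal A)) (n : ℕ)

theorem X_mem (i : Fin n) : X γ n i ∈ DPHull.ideal γ ((maximalIdeal A).map
      (MvPolynomial.C : A →+* MvPolynomial (Fin n) A) ⊔ Ideal.span (Set.range MvPolynomial.X)) :=
  DPHull.of_mem (Ideal.mem_sup_right (Ideal.subset_span ⟨i, rfl⟩))

theorem isDPMorphism_algebraMap : γ.IsDPMorphism (dp γ n) (algebraMap A (DPPolynomial γ n)) := by
  have h1 : ∀ a ∈ maximalIdeal A, MvPolynomial.C a ∈ ((maximalIdeal A).map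
      (MvPolynomial.C : A →+* MvPolynomial (Fin n) A) ⊔ Ideal.span (Set.range MvPolynomial.X)) :=
    fun a ha => Ideal.mem_sup_left (Ideal.mem_map_of_mem _ ha)
  refine ⟨Ideal.map_le_iff_le_comap.2 fun a ha => DPHull.of_mem (h1 a ha), fun {m} a ha => ?_⟩
  exact (DPHull.dpow_mk m (DPTerm.Mem.of (h1 a ha))).trans
    (DPHull.sound (DPTerm.Rel.base m ha (h1 a ha)))

/-- The divided power monomials span a subalgebra. -/
theorem adjoin_le_span : (Algebra.adjoin A {y | ∃ i m, (dp γ n).dpow m (X γ n i) = y} :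
      Set (DPPolynomial γ n)) ⊆
    Submodule.span A (Set.range fun α : Fin n → ℕ => ∏ i, (dp γ n).dpow (α i) (X γ n i)) := by
  classical
  set T := Submodule.span A
    (Set.range fun α : Fin n → ℕ => ∏ i, (dp γ n).dpow (α i) (X γ n i)) with hT
  have h1 : (1 : DPPolynomial γ n) ∈ T :=
    Submodule.subset_span ⟨0, Finset.prod_eq_one fun i _ => (dp γ n).dpow_zero (X_mem γ n i)⟩
  have hmul : T * T ≤ T := by
    rw [hT, Submodule.span_mul_span, ← hT, Submodule.span_le]
    rintro _ ⟨_, ⟨α, rfl⟩, _, ⟨β, rfl⟩, rfl⟩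
    have h2 : (∏ i, (dp γ n).dpow (α i) (X γ n i)) * ∏ i, (dp γ n).dpow (β i) (X γ n i) =
        (∏ i, (α i + β i).choose (α i)) •
          ∏ i, (dp γ n).dpow ((α + β) i) (X γ n i) := by
      rw [← Finset.prod_mul_distrib, nsmul_eq_mul, Nat.cast_prod, ← Finset.prod_mul_distrib]
      exact Finset.prod_congr rfl fun i _ => (dp γ n).mul_dpow (X_mem γ n i)
    simp only [h2]
    exact T.smul_of_tower_mem _ (Submodule.subset_span ⟨α + β, rfl⟩)
  intro x hx
  induction hx using Algebra.adjoin_induction with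
  | mem x hx =>
    obtain ⟨i, m, rfl⟩ := hx
    refine Submodule.subset_span ⟨Pi.single i m, ?_⟩
    change ∏ j, _ = _
    rw [Finset.prod_eq_single i, Pi.single_eq_same]
    · intro j _ hj
      rw [Pi.single_eq_of_ne hj, (dp γ n).dpow_zero (X_mem γ n j)]
    · simp
  | algebraMap a => rw [Algebra.algebraMap_eq_smul_one]; exact T.smul_mem a h1
  | add x y _ _ hx hy => exact T.add_mem hx hy
  | mul x y _ _ hx hy => exact hmul (Submodule.mul_mem_mul hx hy)

/-- Induction over expressions. For the closure under `γ_m` one also has to know that expressions of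
the divided power ideal land in the `S`-span `S'` of `𝔪_A` and the `γ_m(t_i)` with `m ≠ 0`, which is
stable under divided powers since its generators are. -/
theorem adjoin_eq_top :
    Algebra.adjoin A {y | ∃ i m, (dp γ n).dpow m (X γ n i) = y} = ⊤ := by
  set I := ((maximalIdeal A).map (MvPolynomial.C : A →+* MvPolynomial (Fin n) A) ⊔
    Ideal.span (Set.range MvPolynomial.X)) with hI
  set S := Algebra.adjoin A {y | ∃ i m, (dp γ n).dpow m (X γ n i) = y} with hS
  let G : Set (DPPolynomial γ n) := {y | (∃ a ∈ maximalIdeal A, algebraMap A _ a = y) ∨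
    ∃ i, ∃ m ≠ 0, (dp γ n).dpow m (X γ n i) = y}
  -- A submodule over `S` and not an ideal: as long as `S = ⊤` is unknown, only this keeps `S'`
  -- inside `S`.
  let S' : Submodule S (DPPolynomial γ n) := Submodule.span S G
  have hsmul : ∀ s ∈ S, ∀ x ∈ S', s * x ∈ S' := fun s hs x hx => S'.smul_mem (⟨s, hs⟩ : S) hx
  have hXS : ∀ i m, (dp γ n).dpow m (X γ n i) ∈ S := fun i m =>
    Algebra.subset_adjoin (s := {y | ∃ i m, (dp γ n).dpow m (X γ n i) = y}) ⟨i, m, rfl⟩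
  have hS'S : ∀ x ∈ S', x ∈ S := by
    intro x hx
    induction hx using Submodule.span_induction with
    | mem x hx =>
      rcases hx with ⟨a, -, rfl⟩ | ⟨i, m, -, rfl⟩
      · exact S.algebraMap_mem a
      · exact hXS i m
    | zero => exact S.zero_mem
    | add x y _ _ hx hy => exact S.add_mem hx hy
    | smul s x _ hx => exact S.mul_mem s.2 hx
  have hdp : ∀ x ∈ S', x ∈ DPHull.ideal γ I ∧ ∀ m ≠ 0, (dp γ n).dpow m x ∈ S' := by
    intro x hx
    induction hx using Submodule.span_induction with
    | mem x hx =>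
      rcases hx with ⟨a, ha, rfl⟩ | ⟨i, m, hm, rfl⟩
      · refine ⟨(isDPMorphism_algebraMap γ n).ideal_comp (Ideal.mem_map_of_mem _ ha),
          fun m hm => ?_⟩
        rw [← (isDPMorphism_algebraMap γ n).map_dpow ha]
        exact Submodule.subset_span (Or.inl ⟨_, γ.dpow_mem hm ha, rfl⟩)
      · refine ⟨(dp γ n).dpow_mem hm (X_mem γ n i), fun k hk => ?_⟩
        rw [(dp γ n).dpow_comp hm (X_mem γ n i)]
        exact hsmul _ (S.natCast_mem _) _
          (Submodule.subset_span (Or.inr ⟨i, k * m, mul_ne_zero hk hm, rfl⟩))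
    | zero => exact ⟨zero_mem _, fun m hm => by
        rw [(dp γ n).dpow_eval_zero hm]; exact S'.zero_mem⟩
    | add x y hx' hy' hx hy =>
      refine ⟨add_mem hx.1 hy.1, fun m hm => ?_⟩
      rw [(dp γ n).dpow_add' hx.1 hy.1]
      refine S'.sum_mem fun k _ => ?_
      by_cases hk : k = 0
      · subst hk
        rw [(dp γ n).dpow_zero hx.1, one_mul]
        exact hy.2 _ (by omega)
      · rw [mul_comm]
        refine hsmul _ ?_ _ (hx.2 k hk)
        by_cases hj : m - k = 0
        · rw [hj, (dp γ n).dpow_zero hy.1]; exact S.one_mem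
        · exact hS'S _ (hy.2 _ hj)
    | smul s x hx' hx =>
      refine ⟨Ideal.mul_mem_left _ _ hx.1, fun m hm => ?_⟩
      change (dp γ n).dpow m ((s : DPPolynomial γ n) * x) ∈ S'
      rw [(dp γ n).dpow_mul hx.1]
      exact hsmul _ (S.pow_mem s.2 m) _ (hx.2 m hm)
  have hof : ∀ b : MvPolynomial (Fin n) A, DPHull.of γ I b ∈ S := by
    intro b
    induction b using MvPolynomial.induction_on with
    | C a => exact S.algebraMap_mem a
    | add p q hp hq => rw [map_add]; exact S.add_mem hp hq
    | mul_X p i hp =>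
      rw [map_mul]
      refine S.mul_mem hp ?_
      have := hXS i 1
      rwa [(dp γ n).dpow_one (X_mem γ n i)] at this
  have hofI : ∀ b ∈ I, DPHull.of γ I b ∈ S' := by
    intro b hb
    rw [hI, Ideal.map, ← Ideal.span_union] at hb
    induction hb using Submodule.span_induction with
    | mem b hb =>
      rcases hb with ⟨a, ha, rfl⟩ | ⟨i, rfl⟩
      · exact Submodule.subset_span (Or.inl ⟨a, ha, rfl⟩)
      · exact Submodule.subset_span (Or.inr ⟨i, 1, one_ne_zero,
          (dp γ n).dpow_one (X_mem γ n i)⟩)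
    | zero => rw [map_zero]; exact S'.zero_mem
    | add x y _ _ hx hy => rw [map_add]; exact S'.add_mem hx hy
    | smul s x _ hx => rw [smul_eq_mul, map_mul]; exact hsmul _ (hof s) _ hx
  have hterm : ∀ t, DPHull.mk γ I t ∈ S ∧ (DPTerm.Mem I t → DPHull.mk γ I t ∈ S') := by
    intro t
    induction t with
    | of b => exact ⟨hof b, fun h => by cases h with | of hb => exact hofI b hb⟩
    | add s t hs ht =>
      exact ⟨S.add_mem hs.1 ht.1, fun h => by
        cases h with | add h1 h2 => exact S'.add_mem (hs.2 h1) (ht.2 h2)⟩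
    | mul s t hs ht =>
      exact ⟨S.mul_mem hs.1 ht.1, fun h => by
        cases h with | mul _ h2 => exact hsmul _ hs.1 _ (ht.2 h2)⟩
    | neg t ht => exact ⟨S.neg_mem ht.1, fun h => by cases h⟩
    | gam m t ht =>
      by_cases hm : DPTerm.Mem I t
      · rw [← DPHull.dpow_mk m hm]
        by_cases h0 : m = 0
        · subst h0
          refine ⟨?_, fun h => by cases h with | gam h1 _ => exact absurd rfl h1⟩
          have h2 := (dp γ n).dpow_zero (DPHull.mk_mem hm)
          exact (congrArg (· ∈ S) h2).mpr S.one_mem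
        · have h1 := (hdp _ (ht.2 hm)).2 m h0
          exact ⟨hS'S _ h1, fun _ => h1⟩
      · refine ⟨?_, fun h => by cases h with | gam _ h1 => exact absurd h1 hm⟩
        rw [DPHull.sound (DPTerm.Rel.gam_null m hm)]
        exact S.zero_mem
  rw [eq_top_iff]
  intro x _
  induction x using DPHull.ind with
  | h t => exact (hterm t).1

theorem span_monomials : Submodule.span A
    (Set.range fun α : Fin n → ℕ => ∏ i, (dp γ n).dpow (α i) (X γ n i)) = ⊤ := by
  rw [eq_top_iff]
  intro x _
  exact adjoin_le_span γ n (by rw [adjoin_eq_top]; trivial)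

end DPPolynomial

/-! ### Divided power ideals under morphisms and products -/

namespace DividedPowers

variable {A : Type u} {B : Type v} [CommRing A] [CommRing B] {I : Ideal A} {J : Ideal B}
  {γ : DividedPowers I} {δ : DividedPowers J}

theorem IsDPMorphism.dpPower_le_comap {f : A →+* B} (hf : γ.IsDPMorphism δ f) {X : Set A}
    {Y : Set B} (hX : X ⊆ I) (hXY : Set.MapsTo f X Y) (N : ℕ) :
    γ.dpPower X N ≤ (δ.dpPower Y N).comap f := by
  refine Ideal.span_le.2 ?_
  rintro _ ⟨l, hl, hN, rfl⟩
  refine Ideal.subset_span ⟨l.map fun q => (q.1, f q.2), ?_, ?_, ?_⟩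
  · intro q hq
    obtain ⟨q', hq', rfl⟩ := List.mem_map.1 hq
    exact hXY (hl q' hq')
  · simpa [Function.comp_def] using hN
  · rw [map_list_prod, List.map_map, List.map_map]
    congr 1
    refine List.map_congr_left fun q hq => ?_
    exact hf.map_dpow (hX (hl q hq))

theorem prod_dpow_mem_dpPower {n : ℕ} (t : Fin n → A) (α : Fin n → ℕ) {N : ℕ}
    (hN : N ≤ ∑ i, α i) : ∏ i, γ.dpow (α i) (t i) ∈ γ.dpPower (Set.range t) N := by
  refine Ideal.subset_span ⟨List.ofFn fun i => (α i, t i), ?_, ?_, ?_⟩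
  · intro q hq
    obtain ⟨i, rfl⟩ := (List.mem_ofFn' _ _).1 hq
    exact ⟨i, rfl⟩
  · rw [List.map_ofFn, List.sum_ofFn]
    exact hN
  · rw [List.map_ofFn, List.prod_ofFn]
    rfl

/-- Each of the `N` factors has positive degree. Thus the ideal of the `γ_m(t_i)` is nilpotent
modulo every ideal that contains some `(t)^[N]`. -/
theorem span_dpow_pow_le_dpPower {ι : Type*} (t : ι → A) (N : ℕ) :
    Ideal.span {y | ∃ i, ∃ m ≠ 0, γ.dpow m (t i) = y} ^ N ≤ γ.dpPower (Set.range t) N := by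
  induction N with
  | zero =>
    rw [pow_zero, Ideal.one_eq_top, ← Ideal.span_singleton_one, Ideal.span_le,
      Set.singleton_subset_iff]
    exact Ideal.subset_span ⟨[], by simp, by simp, by simp⟩
  | succ N ih =>
    rw [pow_succ']
    refine (Ideal.mul_mono_right ih).trans ?_
    rw [dpPower, Ideal.span_mul_span', Ideal.span_le]
    rintro _ ⟨_, ⟨i, m, hm, rfl⟩, _, ⟨l, hl, hN, rfl⟩, rfl⟩
    refine Ideal.subset_span ⟨(m, t i) :: l, ?_, ?_, ?_⟩
    · intro q hq
      rcases List.mem_cons.1 hq with rfl | hq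
      · exact ⟨i, rfl⟩
      · exact hl q hq
    · rw [List.map_cons, List.sum_cons]
      omega
    · simp

end DividedPowers

/-! ### Divided power coordinates and divided power series -/

section coordinates

variable {A : Type u} {R : Type w} [CommRing A] [IsLocalRing A] [TopologicalSpace A] [CommRing R]
  [IsLocalRing R] [TopologicalSpace R] {n : ℕ}

/-- The elements `t i` are divided power coordinates of `R` over `A`. -/
structure IsDPCoordinates (γA : DividedPowers (maximalIdeal A)) (γ : DividedPowers (maximalIdeal R))
    (ψ : A →+* R) (t : Fin n → R) : Prop where
  proDPArtin : IsProDPArtin γ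
  dpMorphism : γA.IsDPMorphism γ ψ
  continuous : Continuous ψ
  exists_comap_le : ∀ J : Ideal A, IsOpen (J : Set A) → ∃ J', γ.IsOpenDPIdeal J' ∧ J'.comap ψ ≤ J
  mem : ∀ i, t i ∈ maximalIdeal R
  nilpotent : ∀ J, γ.IsOpenDPIdeal J → ∃ N, γ.dpPower (Set.range t) N ≤ J
  exists_sub_mem : ∀ J, γ.IsOpenDPIdeal J → ∀ r, ∃ a,
    r - ψ a ∈ Ideal.span {y | ∃ i, ∃ m ≠ 0, γ.dpow m (t i) = y} ⊔ J
  coeff : ∀ β : Fin n → ℕ, ∃ Q : R →+ R, Continuous Q ∧ ∀ a (α : Fin n → ℕ),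
    Q ((∏ j, γ.dpow (α j) (t j)) * ψ a) = if α = β then ψ a else 0

namespace IsDPCoordinates

variable {γA : DividedPowers (maximalIdeal A)} {γ : DividedPowers (maximalIdeal R)} {ψ : A →+* R}
  {t : Fin n → R}

/-- The evaluation of divided power polynomials. -/
theorem exists_eval (h : IsDPCoordinates γA γ ψ t) : ∃ E : DPPolynomial γA n →+* R,
    (DPPolynomial.dp γA n).IsDPMorphism γ E ∧ (∀ a, E (algebraMap A _ a) = ψ a) ∧
      ∀ i, E (DPPolynomial.X γA n i) = t i := by
  have hψ : ∀ a ∈ maximalIdeal A, ψ a ∈ maximalIdeal R := fun a ha =>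
    h.dpMorphism.ideal_comp (Ideal.mem_map_of_mem ψ ha)
  have hg : (maximalIdeal A).map (MvPolynomial.C : A →+* MvPolynomial (Fin n) A) ⊔
      Ideal.span (Set.range MvPolynomial.X) ≤
      (maximalIdeal R).comap (MvPolynomial.eval₂Hom ψ t) := by
    refine sup_le (Ideal.map_le_iff_le_comap.2 fun a ha => ?_) (Ideal.span_le.2 ?_)
    · rw [Ideal.mem_comap, Ideal.mem_comap, MvPolynomial.eval₂Hom_C]
      exact hψ a ha
    · rintro _ ⟨i, rfl⟩
      rw [SetLike.mem_coe, Ideal.mem_comap, MvPolynomial.eval₂Hom_X']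
      exact h.mem i
  have hb : ∀ m, ∀ a ∈ maximalIdeal A,
      γ.dpow m (MvPolynomial.eval₂Hom ψ t (algebraMap A (MvPolynomial (Fin n) A) a)) =
        MvPolynomial.eval₂Hom ψ t (algebraMap A (MvPolynomial (Fin n) A) (γA.dpow m a)) := by
    intro m a ha
    rw [MvPolynomial.algebraMap_eq, MvPolynomial.eval₂Hom_C, MvPolynomial.eval₂Hom_C,
      h.dpMorphism.map_dpow ha]
  refine ⟨DPHull.lift γ _ hg hb, DPHull.lift_isDPMorphism γ _ hg hb, fun a => ?_, fun i => ?_⟩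
  · exact (DPHull.lift_of γ _ hg hb _).trans (MvPolynomial.eval₂Hom_C _ _ a)
  · exact (DPHull.lift_of γ _ hg hb _).trans (MvPolynomial.eval₂Hom_X' _ _ i)

variable {E : DPPolynomial γA n →+* R}

/-- In `R / J` the ideal `K` of the `γ_m(t_i)` is nilpotent, is generated by elements of the image
of `E`, and `A` surjects modulo `K`; successive approximation along its powers ends after finitely
many steps. -/
theorem exists_sub_eval_mem (h : IsDPCoordinates γA γ ψ t)
    (hE : (DPPolynomial.dp γA n).IsDPMorphism γ E) (hEψ : ∀ a, E (algebraMap A _ a) = ψ a)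
    (hEt : ∀ i, E (DPPolynomial.X γA n i) = t i) {J : Ideal R} (hJ : γ.IsOpenDPIdeal J) (r : R) :
    ∃ y, r - E y ∈ J := by
  obtain ⟨N, hN⟩ := h.nilpotent J hJ
  set K := Ideal.span {y | ∃ i, ∃ m ≠ 0, γ.dpow m (t i) = y} with hK
  set K' := Ideal.span {y | ∃ i, ∃ m ≠ 0,
    (DPPolynomial.dp γA n).dpow m (DPPolynomial.X γA n i) = y} with hK'
  have hKK' : K'.map ((Ideal.Quotient.mk J).comp E) = K.map (Ideal.Quotient.mk J) := by
    rw [← Ideal.map_map, hK', Ideal.map_span]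
    congr 2
    ext y
    constructor
    · rintro ⟨_, ⟨i, m, hm, rfl⟩, rfl⟩
      exact ⟨i, m, hm, by rw [hE.map_dpow (DPPolynomial.X_mem γA n i), hEt]⟩
    · rintro ⟨i, m, hm, rfl⟩
      exact ⟨_, ⟨i, m, hm, rfl⟩, by rw [hE.map_dpow (DPPolynomial.X_mem γA n i), hEt]⟩
  obtain ⟨y, hy⟩ := exists_sub_mem_pow (𝔫 := K') (𝔪 := K.map (Ideal.Quotient.mk J))
    ((Ideal.Quotient.mk J).comp E) (by
      intro r
      obtain ⟨r, rfl⟩ := Ideal.Quotient.mk_surjective r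
      obtain ⟨a, ha⟩ := h.exists_sub_mem J hJ r
      refine ⟨algebraMap A _ a, ?_⟩
      have := Ideal.mem_map_of_mem (Ideal.Quotient.mk J) ha
      rwa [Ideal.map_sup, Ideal.map_quotient_self, sup_bot_eq, map_sub, ← hEψ] at this)
    (by rw [hKK']; exact le_sup_left) hKK'.le N (Ideal.Quotient.mk J r)
  refine ⟨y, Ideal.Quotient.eq.1 (sub_eq_zero.1 ?_)⟩
  rw [← Ideal.map_pow] at hy
  have := Ideal.map_mono ((DividedPowers.span_dpow_pow_le_dpPower t N).trans hN) hy
  rwa [Ideal.map_quotient_self] at this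

/-- `E` is surjective modulo `J`, so the quotient by the preimage is `R / J` itself, which is local
and artinian. -/
theorem isAdmissible_comap (h : IsDPCoordinates γA γ ψ t)
    (hE : (DPPolynomial.dp γA n).IsDPMorphism γ E) (hEψ : ∀ a, E (algebraMap A _ a) = ψ a)
    (hEt : ∀ i, E (DPPolynomial.X γA n i) = t i) (J : Ideal R) (hJ : γ.IsOpenDPIdeal J) :
    (DPPolynomial.dp γA n).IsSubDPIdeal (J.comap E) ∧
      DPPolynomial.IsAdmissible γA n (J.comap E) := by
  have hmax : (DPHull.ideal γA ((maximalIdeal A).map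
      (MvPolynomial.C : A →+* MvPolynomial (Fin n) A) ⊔
      Ideal.span (Set.range MvPolynomial.X))).IsMaximal := by
    refine DPHull.ideal_isMaximal ?_ fun a ha => Ideal.mem_sup_left (Ideal.mem_map_of_mem _ ha)
    have h1 : (maximalIdeal A).map (MvPolynomial.C : A →+* MvPolynomial (Fin n) A) ⊔
        Ideal.span (Set.range MvPolynomial.X) =
        (maximalIdeal A).comap (MvPolynomial.constantCoeff (σ := Fin n)) := by
      refine le_antisymm (sup_le (Ideal.map_le_iff_le_comap.2 fun a ha => ?_)
        (Ideal.span_le.2 ?_)) fun f hf => ?_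
      · rwa [Ideal.mem_comap, Ideal.mem_comap, MvPolynomial.constantCoeff_C]
      · rintro _ ⟨i, rfl⟩
        rw [SetLike.mem_coe, Ideal.mem_comap, MvPolynomial.constantCoeff_X]
        exact zero_mem _
      · rw [← sub_add_cancel f (MvPolynomial.C (MvPolynomial.constantCoeff f))]
        exact add_mem (Ideal.mem_sup_right (MvPolynomial.sub_C_constantCoeff_mem f))
          (Ideal.mem_sup_left (Ideal.mem_map_of_mem _ hf))
    rw [h1]
    exact Ideal.comap_isMaximal_of_surjective _ fun a => ⟨MvPolynomial.C a, by simp⟩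
  have hcomap : (maximalIdeal R).comap E = DPHull.ideal γA ((maximalIdeal A).map
      (MvPolynomial.C : A →+* MvPolynomial (Fin n) A) ⊔
      Ideal.span (Set.range MvPolynomial.X)) :=
    (hmax.eq_of_le (Ideal.comap_ne_top _ (maximalIdeal.isMaximal R).ne_top)
      (Ideal.map_le_iff_le_comap.1 hE.ideal_comp)).symm
  have hle : J.comap E ≤ _ := (Ideal.comap_mono hJ.1.isSubideal).trans hcomap.le
  have hsurj : Function.Surjective ((Ideal.Quotient.mk J).comp E) := by
    intro r
    obtain ⟨r, rfl⟩ := Ideal.Quotient.mk_surjective r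
    obtain ⟨y, hy⟩ := h.exists_sub_eval_mem hE hEψ hEt hJ r
    exact ⟨y, (Ideal.Quotient.eq.2 hy).symm⟩
  have hker : RingHom.ker ((Ideal.Quotient.mk J).comp E) = J.comap E := by
    rw [← RingHom.comap_ker, Ideal.mk_ker]
  have e : DPPolynomial γA n ⧸ J.comap E ≃+* R ⧸ J :=
    (Ideal.quotEquivOfEq hker.symm).trans (RingHom.quotientKerEquivOfSurjective hsurj)
  have hart := hJ.2.1
  have : Nontrivial (R ⧸ J) := Ideal.Quotient.nontrivial_iff.2
    (ne_top_of_le_ne_top (maximalIdeal.isMaximal R).ne_top hJ.1.isSubideal)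
  have : IsLocalRing (R ⧸ J) := IsLocalRing.of_surjective' _ Ideal.Quotient.mk_surjective
  refine ⟨⟨hle, fun m hm y hy => ?_⟩, ⟨e.symm.isLocalRing, e.symm.surjective.isArtinianRing⟩, ?_, ?_⟩
  · rw [Ideal.mem_comap, hE.map_dpow (hle hy)]
    exact hJ.1.dpow_mem m hm hy
  · have h1 : ((J.comap E).comap (algebraMap A (DPPolynomial γA n)) : Set A) = ψ ⁻¹' J := by
      ext a
      change E (algebraMap A _ a) ∈ J ↔ ψ a ∈ J
      rw [hEψ]
    rw [h1]
    exact hJ.2.2.preimage h.continuous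
  · obtain ⟨N, hN⟩ := h.nilpotent J hJ
    refine ⟨N, (hE.dpPower_le_comap ?_ ?_ N).trans (Ideal.comap_mono hN)⟩
    · rintro _ ⟨i, rfl⟩
      exact DPPolynomial.X_mem γA n i
    · rintro _ ⟨i, rfl⟩
      exact ⟨i, (hEt i).symm⟩

/-- The coefficients of `y` are read off continuously from `E y`. Monomials with an exponent at
least `N` lie in `K` anyway, so `J` has to control only finitely many coefficients. -/
theorem exists_comap_eval_le (h : IsDPCoordinates γA γ ψ t)
    (hE : (DPPolynomial.dp γA n).IsDPMorphism γ E) (hEψ : ∀ a, E (algebraMap A _ a) = ψ a)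
    (hEt : ∀ i, E (DPPolynomial.X γA n i) = t i) {K : Ideal (DPPolynomial γA n)}
    (hK : DPPolynomial.IsAdmissible γA n K) : ∃ J, γ.IsOpenDPIdeal J ∧ J.comap E ≤ K := by
  obtain ⟨-, hopen, N, hN⟩ := hK
  obtain ⟨J₀, hJ₀, hle⟩ := h.exists_comap_le _ hopen
  choose Q hQ hQ' using h.coeff
  let S : Finset (Fin n → ℕ) := Fintype.piFinset fun _ => Finset.range N
  have h1 : (⋂ β ∈ S, Q β ⁻¹' (J₀ : Set R)) ∈ nhds (0 : R) := by
    rw [Filter.biInter_finset_mem]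
    intro β _
    refine (hJ₀.2.2.preimage (hQ β)).mem_nhds ?_
    rw [Set.mem_preimage, map_zero]
    exact J₀.zero_mem
  obtain ⟨J, hJS, hJ⟩ := h.proDPArtin.basis _ h1
  refine ⟨J, hJ, fun y hy => ?_⟩
  have hspan : y ∈ Submodule.span A (Set.range fun α : Fin n → ℕ =>
      ∏ i, (DPPolynomial.dp γA n).dpow (α i) (DPPolynomial.X γA n i)) := by
    rw [DPPolynomial.span_monomials]; trivial
  obtain ⟨c, rfl⟩ := Finsupp.mem_span_range_iff_exists_finsupp.1 hspan
  have hcoeff : ∀ β, Q β (E (c.sum fun α a => a •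
      ∏ i, (DPPolynomial.dp γA n).dpow (α i) (DPPolynomial.X γA n i))) = ψ (c β) := by
    intro β
    rw [Finsupp.sum, map_sum, map_sum]
    have h2 : ∀ α, Q β (E (c α • ∏ i, (DPPolynomial.dp γA n).dpow (α i)
        (DPPolynomial.X γA n i))) = if α = β then ψ (c α) else 0 := by
      intro α
      rw [Algebra.smul_def, map_mul, hEψ, map_prod, mul_comm, ← hQ' β (c α) α]
      congr 2
      refine Finset.prod_congr rfl fun i _ => ?_
      rw [hE.map_dpow (DPPolynomial.X_mem γA n i), hEt]
    simp only [h2, Finset.sum_ite_eq']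
    split_ifs with h3
    · rfl
    · rw [Finsupp.notMem_support_iff.1 h3, map_zero]
  refine K.sum_mem fun β _ => ?_
  by_cases hβ : β ∈ S
  · have h2 : Q β _ ∈ J₀ := Set.mem_iInter₂.1 (hJS hy) β hβ
    rw [hcoeff] at h2
    beta_reduce
    rw [Algebra.smul_def]
    exact K.mul_mem_right _ (hle h2)
  · obtain ⟨i, hi⟩ : ∃ i, N ≤ β i := by
      by_contra! h2
      exact hβ (Fintype.mem_piFinset.2 fun i => Finset.mem_range.2 (h2 i))
    refine Submodule.smul_of_tower_mem K _ (hN (DividedPowers.prod_dpow_mem_dpPower _ β ?_))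
    exact hi.trans (Finset.single_le_sum (fun j _ => Nat.zero_le (β j)) (Finset.mem_univ i))

end IsDPCoordinates

end coordinates

theorem IsProDPArtin.continuous_of_completion {R : Type w} [CommRing R] [IsLocalRing R]
    [TopologicalSpace R] [IsTopologicalRing R] {γ : DividedPowers (maximalIdeal R)}
    (h : IsProDPArtin γ) {B : Type u} [CommRing B] {I : Ideal B} {δ : DividedPowers I}
    {P : Ideal B → Prop} (φ : δ.Completion P →+* R)
    (hφ : ∀ J, γ.IsOpenDPIdeal J → ∃ K, ∀ f, DividedPowers.Completion.proj K f = 0 → φ f ∈ J) :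
    Continuous φ := by
  refine h.continuous_of φ.toAddMonoidHom fun J hJ => ?_
  obtain ⟨K, hK⟩ := hφ J hJ
  exact Filter.mem_of_superset ((DividedPowers.Completion.isOpen_ker_proj K).mem_nhds
    (zero_mem (RingHom.ker _))) fun f hf => hK f hf

namespace IsDPCoordinates

variable {A : Type u} {R : Type w} [CommRing A] [IsLocalRing A] [TopologicalSpace A] [CommRing R]
  [IsLocalRing R] [TopologicalSpace R] {n : ℕ}
  {γA : DividedPowers (maximalIdeal A)} {γ : DividedPowers (maximalIdeal R)} {ψ : A →+* R}
  {t : Fin n → R}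

variable {E : DPPolynomial γA n →+* R}

/-- The preimages of the open divided power ideals of `R` are cofinal among the admissible ideals,
so both completions agree, and `R` is its own completion. The first clause says that `φ` is computed
by `E` modulo each `J`; the second will give continuity of the inverse. -/
theorem exists_completion_eval (h : IsDPCoordinates γA γ ψ t)
    (hE : (DPPolynomial.dp γA n).IsDPMorphism γ E) (hEψ : ∀ a, E (algebraMap A _ a) = ψ a)
    (hEt : ∀ i, E (DPPolynomial.X γA n i) = t i)
    (hadm : ∀ J, γ.IsOpenDPIdeal J → (DPPolynomial.dp γA n).IsSubDPIdeal (J.comap E) ∧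
      DPPolynomial.IsAdmissible γA n (J.comap E)) :
    ∃ φ : DPSeries γA n ≃+* R,
      (∀ (f : DPSeries γA n) (J : Ideal R) (hJ : γ.IsOpenDPIdeal J) (y : DPPolynomial γA n),
        f.1 ⟨J.comap E, hadm J hJ⟩ = Ideal.Quotient.mk _ y → φ f - E y ∈ J) ∧
      ∀ (K : {K : Ideal (DPPolynomial γA n) // (DPPolynomial.dp γA n).IsSubDPIdeal K ∧
        DPPolynomial.IsAdmissible γA n K}) (J : Ideal R), γ.IsOpenDPIdeal J → J.comap E ≤ K.1 →
        ∀ f : DPSeries γA n, φ f ∈ J → f.1 K = 0 := by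
  have hR := h.proDPArtin
  have hle : ∀ K, DPPolynomial.IsAdmissible γA n K → ∃ J, γ.IsOpenDPIdeal J ∧ J.comap E ≤ K :=
    fun K hK => h.exists_comap_eval_le hE hEψ hEt hK
  let φ : DPSeries γA n →+* R :=
    ((RingEquiv.ofBijective _ hR.complete).symm : _ →+* R).comp
      (DividedPowers.Completion.map E hadm)
  have hφ : ∀ (f : DPSeries γA n) (J : Ideal R) (hJ : γ.IsOpenDPIdeal J) (y : DPPolynomial γA n),
      f.1 ⟨J.comap E, hadm J hJ⟩ = Ideal.Quotient.mk _ y → φ f - E y ∈ J := by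
    intro f J hJ y hy
    have h1 : DividedPowers.Completion.of γ _ (φ f) = DividedPowers.Completion.map E hadm f :=
      (RingEquiv.ofBijective _ hR.complete).apply_symm_apply _
    have h2 : Ideal.Quotient.mk J (φ f) =
        Ideal.quotientMap J E le_rfl (f.1 ⟨J.comap E, hadm J hJ⟩) :=
      congrFun (congrArg Subtype.val h1) ⟨J, hJ⟩
    rw [hy, Ideal.quotientMap_mk] at h2
    exact Ideal.Quotient.eq.1 h2
  have hrep : ∀ (f : DPSeries γA n) (J : Ideal R) (hJ : γ.IsOpenDPIdeal J),
      ∃ y, f.1 ⟨J.comap E, hadm J hJ⟩ = Ideal.Quotient.mk _ y ∧ φ f - E y ∈ J := by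
    intro f J hJ
    obtain ⟨y, hy⟩ := Ideal.Quotient.mk_surjective (f.1 ⟨J.comap E, hadm J hJ⟩)
    exact ⟨y, hy.symm, hφ f J hJ y hy.symm⟩
  have heq : ∀ x y, (∀ J, γ.IsOpenDPIdeal J → x - y ∈ J) → x = y := fun x y hxy =>
    sub_eq_zero.1 (hR.eq_zero hxy)
  -- the components of `f` are controlled by `φ f`
  have hzero : ∀ (K : {K : Ideal (DPPolynomial γA n) // (DPPolynomial.dp γA n).IsSubDPIdeal K ∧
      DPPolynomial.IsAdmissible γA n K}) (J : Ideal R), γ.IsOpenDPIdeal J → J.comap E ≤ K.1 →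
      ∀ f : DPSeries γA n, φ f ∈ J → f.1 K = 0 := by
    intro K J hJ hJK f hf
    obtain ⟨y, hy, hy'⟩ := hrep f J hJ
    rw [← f.2 ⟨_, hadm J hJ⟩ K hJK, hy, Ideal.Quotient.factor_mk, Ideal.Quotient.eq_zero_iff_mem]
    exact hJK ((J.sub_mem_iff_right hf).1 hy')
  have hinj : Function.Injective φ := by
    rw [injective_iff_map_eq_zero]
    intro f hf
    refine DividedPowers.Completion.ext fun K => ?_
    obtain ⟨J, hJ, hJK⟩ := hle K.1 K.2.2
    exact hzero K J hJ hJK f (hf ▸ J.zero_mem)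
  have hsurj : Function.Surjective φ := by
    intro r
    choose! y hy using fun (J : Ideal R) (hJ : γ.IsOpenDPIdeal J) =>
      h.exists_sub_eval_mem hE hEψ hEt hJ r
    -- Approximations of `r` at two levels are compared at a level below both.
    have hyy : ∀ J J', γ.IsOpenDPIdeal J → γ.IsOpenDPIdeal J' → ∀ K, J.comap E ≤ K →
        J'.comap E ≤ K → y J - y J' ∈ K := by
      intro J J' hJ hJ' K hJK hJK'
      obtain ⟨J'', hJJ, hJ''⟩ := hR.basis _ (Filter.inter_mem (hJ.2.2.mem_nhds J.zero_mem)
        (hJ'.2.2.mem_nhds J'.zero_mem))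
      have h1 : y J - y J'' ∈ J.comap E := by
        rw [Ideal.mem_comap, map_sub]
        have := J.sub_mem (hJJ (hy J'' hJ'')).1 (hy J hJ)
        rwa [sub_sub_sub_cancel_left] at this
      have h2 : y J' - y J'' ∈ J'.comap E := by
        rw [Ideal.mem_comap, map_sub]
        have := J'.sub_mem (hJJ (hy J'' hJ'')).2 (hy J' hJ')
        rwa [sub_sub_sub_cancel_left] at this
      have := K.sub_mem (hJK h1) (hJK' h2)
      rwa [sub_sub_sub_cancel_right] at this
    choose! J hJ hJK using hle
    -- The component at `K` is an approximate preimage of `r` modulo an ideal `J` whose preimage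
    -- lies in `K`.
    let f : DPSeries γA n := ⟨fun K => Ideal.Quotient.mk K.1 (y (J K.1)), fun K K' hKK' =>
      Ideal.Quotient.eq.2 (hyy _ _ (hJ _ K.2.2) (hJ _ K'.2.2) K'.1
        ((hJK _ K.2.2).trans hKK') (hJK _ K'.2.2))⟩
    refine ⟨f, heq _ _ fun J' hJ' => ?_⟩
    have h1 := hφ f J' hJ' (y (J (J'.comap E))) rfl
    have h2 := hyy _ _ (hJ _ (hadm J' hJ').2) hJ' _ (hJK _ (hadm J' hJ').2) le_rfl
    rw [Ideal.mem_comap, map_sub] at h2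
    have := J'.sub_mem (J'.add_mem h1 h2) (hy J' hJ')
    convert this using 1
    ring
  exact ⟨RingEquiv.ofBijective φ ⟨hinj, hsurj⟩, hφ, hzero⟩

set_option maxHeartbeats 1000000 in
/-- A ring with divided power coordinates over `A` is a divided power series ring over `A`. -/
theorem exists_equiv [IsTopologicalRing R] (h : IsDPCoordinates γA γ ψ t) :
    ∃ e : DPSeries γA n ≃+* R, Continuous e ∧ Continuous e.symm ∧
      (DPSeries.dp γA n).IsDPMorphism γ e.toRingHom ∧ (∀ a, e (DPSeries.C γA n a) = ψ a) ∧
      ∀ i, e (DPSeries.X γA n i) = t i := by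
  obtain ⟨E, hE, hEψ, hEt⟩ := h.exists_eval
  have hR := h.proDPArtin
  have hadm := h.isAdmissible_comap hE hEψ hEt
  obtain ⟨φ, hφ, hzero⟩ := h.exists_completion_eval hE hEψ hEt hadm
  have heq : ∀ x y, (∀ J, γ.IsOpenDPIdeal J → x - y ∈ J) → x = y := fun x y hxy =>
    sub_eq_zero.1 (hR.eq_zero hxy)
  have hφof : ∀ y, φ (DividedPowers.Completion.of _ _ y) = E y := fun y =>
    heq _ _ fun J hJ => hφ _ J hJ y rfl
  refine ⟨φ, ?_, ?_, ?_, ?_, ?_⟩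
  · refine hR.continuous_of_completion φ.toRingHom fun J hJ => ⟨⟨J.comap E, hadm J hJ⟩, ?_⟩
    intro f hf
    obtain ⟨y, hy⟩ := Ideal.Quotient.mk_surjective (f.1 ⟨J.comap E, hadm J hJ⟩)
    have h1 : y ∈ J.comap E := Ideal.Quotient.eq_zero_iff_mem.1 (hy.trans hf)
    exact (J.sub_mem_iff_left h1).1 (hφ f J hJ y hy.symm)
  · refine continuous_of_continuousAt_zero φ.symm ?_
    rw [ContinuousAt, map_zero, DividedPowers.Completion.tendsto_nhds_zero]
    intro K
    obtain ⟨J, hJ, hJK⟩ := h.exists_comap_eval_le hE hEψ hEt K.2.2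
    filter_upwards [hJ.2.2.mem_nhds J.zero_mem] with r hr
    refine hzero K J hJ hJK _ ?_
    rw [φ.apply_symm_apply]
    exact hr
  · have hmem : ∀ (f : DPSeries γA n), f ∈ DividedPowers.Completion.ideal _ _ → ∀ J,
        ∀ hJ : γ.IsOpenDPIdeal J, ∃ y ∈ DPHull.ideal γA _, f.1 ⟨J.comap E, hadm J hJ⟩ =
          Ideal.Quotient.mk _ y := by
      intro f hf J hJ
      obtain ⟨y, hy, hy'⟩ := (Ideal.mem_map_iff_of_surjective _ Ideal.Quotient.mk_surjective).1
        (hf ⟨J.comap E, hadm J hJ⟩)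
      exact ⟨y, hy, hy'.symm⟩
    have hmax : ∀ f ∈ DividedPowers.Completion.ideal (DPPolynomial.dp γA n)
        (DPPolynomial.IsAdmissible γA n), φ f ∈ maximalIdeal R := by
      intro f hf
      obtain ⟨J, -, hJ⟩ := hR.basis _ Filter.univ_mem
      obtain ⟨y, hy, hfy⟩ := hmem f hf J hJ
      exact ((maximalIdeal R).sub_mem_iff_left (hE.ideal_comp (Ideal.mem_map_of_mem E hy))).1
        (hJ.1.isSubideal (hφ f J hJ y hfy))
    refine ⟨Ideal.map_le_iff_le_comap.2 hmax, fun {m} f hf => heq _ _ fun J hJ => ?_⟩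
    obtain ⟨y, hy, hfy⟩ := hmem f hf J hJ
    -- Congruent elements have congruent divided powers modulo a divided power ideal, so the claim
    -- reduces to `E`.
    have h1 : γ.dpow m (φ f) - γ.dpow m (E y) ∈ J :=
      γ.isSubDPIdeal_inf_iff.1 (DividedPowers.Completion.inf_isSubDPIdeal hJ.1) (hmax f hf)
        (hE.ideal_comp (Ideal.mem_map_of_mem E hy)) (hφ f J hJ y hfy)
    have h2 : φ ((DPSeries.dp γA n).dpow m f) - E ((DPPolynomial.dp γA n).dpow m y) ∈ J := by
      refine hφ _ J hJ _ ?_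
      refine (DividedPowers.Completion.dpow_apply m hf _).trans ?_
      rw [hfy]
      exact DividedPowers.Quotient.dpow_apply _
        (DividedPowers.Completion.inf_isSubDPIdeal (hadm J hJ).1) hy
    rw [hE.map_dpow hy] at h2
    have := J.sub_mem h1 h2
    rwa [sub_sub_sub_cancel_right] at this
  · intro a
    exact (hφof _).trans (hEψ a)
  · intro i
    exact (hφof _).trans (hEt i)

end IsDPCoordinates

/-! ### The ring of invariants of a smooth foliation -/

section foliation

variable {Λ : Type v} {R : Type u} [CommRing Λ] [IsLocalRing Λ] [TopologicalSpace Λ]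
  [CommRing R] [IsLocalRing R] [TopologicalSpace R] [Algebra Λ R]
  {γΛ : DividedPowers (maximalIdeal Λ)} {γ : DividedPowers (maximalIdeal R)}

/-- A retract of an algebra with a section is an algebra with a section. -/
theorem IsDPNilpotentAlgebra.of_retract {π : R →ₐ[Λ] Λ} (h : IsDPNilpotentAlgebra γΛ γ π)
    (A : Subalgebra Λ R) [IsLocalRing A] {γ' : DividedPowers (maximalIdeal A)} {P : R →+* R}
    (hP : Continuous P) (hmem : ∀ r, P r ∈ A) (hfix : ∀ a ∈ A, P a = a)
    (hval : γ'.IsDPMorphism γ A.val.toRingHom) (hQ : γ.IsDPMorphism γ' (P.codRestrict A hmem))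
    (hA : IsProDPArtin γ') : IsDPNilpotentAlgebra γΛ γ' (π.comp A.val) where
  proDPArtin := hA
  continuous_algebraMap := h.continuous_algebraMap.subtype_mk _
  algebraMap_dp := by
    -- The structure map of `A` is that of `R` followed by the projection, hence a divided power
    -- morphism.
    have h1 : algebraMap Λ A = (P.codRestrict A hmem).comp (algebraMap Λ R) :=
      RingHom.ext fun a => Subtype.ext (hfix _ (A.algebraMap_mem a)).symm
    rw [h1]
    exact hQ.comp _ h.algebraMap_dp
  continuous_section := h.continuous_section.comp continuous_subtype_val
  section_dp := h.section_dp.comp _ hval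
  nilpotent J hJ := by
    obtain ⟨N, hN⟩ := h.nilpotent (J.comap (P.codRestrict A hmem))
      (hJ.preimage (hP.subtype_mk hmem))
    refine ⟨N, fun a ha => ?_⟩
    have hle : RingHom.ker (π.comp A.val) ≤ maximalIdeal A :=
      IsLocalRing.le_maximalIdeal (RingHom.ker_ne_top _)
    have h1 := hval.dpPower_le_comap hle (Y := RingHom.ker π) (fun x hx => hx) N ha
    have h2 := hN h1
    have h3 : (P.codRestrict A hmem) (A.val.toRingHom a) = a := Subtype.ext (hfix _ a.2)
    rwa [Ideal.mem_comap, h3] at h2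

/-- The projection to the ring of invariants and the coordinates along the leaves. -/
theorem IsSmoothDPFoliation.exists_projection [IsTopologicalRing R] {π : R →ₐ[Λ] Λ}
    {F : Submodule R (Derivation Λ R R)} (hR : IsDPNilpotentAlgebra γΛ γ π)
    (hF : IsSmoothDPFoliation Λ γ (RingHom.ker π) (maximalIdeal R) F) :
    ∃ (P : R →+* R) (n : ℕ) (t : Fin n → R), Continuous P ∧ γ.IsDPMorphism γ P ∧
      (∀ r, P r ∈ invariants F) ∧ (∀ a ∈ invariants F, P a = a) ∧ (∀ i, t i ∈ RingHom.ker π) ∧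
      (∀ J, γ.IsOpenDPIdeal J → ∀ r,
        r - P r ∈ Ideal.span {y | ∃ i, ∃ m ≠ 0, γ.dpow m (t i) = y} ⊔ J) ∧
      ∀ β : Fin n → ℕ, ∃ Q : R →+ R, Continuous Q ∧ ∀ a ∈ invariants F, ∀ α : Fin n → ℕ,
        Q ((∏ j, γ.dpow (α j) (t j)) * a) = if α = β then a else 0 := by
  have h := hR.proDPArtin
  have hker : RingHom.ker π ≤ maximalIdeal R := IsLocalRing.le_maximalIdeal (RingHom.ker_ne_top π)
  obtain ⟨n, D, t, hFD, htY, hDt⟩ := exists_dual_frame F hF.fg hker hF.inj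
  have ht : ∀ i, t i ∈ maximalIdeal R := fun i => hker (htY i)
  have hDF : ∀ i, D i ∈ F := fun i => hFD ▸ Submodule.subset_span ⟨i, rfl⟩
  have hD : ∀ i, D i ∈ dpTangent Λ γ := fun i => hF.le (hDF i)
  have hcomm := commute_of_dual_frame D t
    (fun i j => hFD ▸ hF.lie _ (hDF i) _ (hDF j)) hDt
  -- The single factor `γ_m(-t_i)` lies in `(ker π)^[N]` as soon as `m ≥ N`.
  have hconv : ∀ i J, γ.IsOpenDPIdeal J → ∃ N, ∀ m ≥ N, γ.dpow m (-t i) ∈ J := by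
    intro i J hJ
    obtain ⟨N, hN⟩ := hR.nilpotent J hJ.2.2
    refine ⟨N, fun m hm => hN (Ideal.subset_span ⟨[(m, -t i)], ?_, by simpa using hm, by simp⟩)⟩
    intro q hq
    rw [List.mem_singleton.1 hq]
    exact neg_mem (htY i)
  obtain ⟨P, hPc, hPfix, hPker, hPzero, hPsub, -⟩ :=
    h.exists_finset_projection hD ht hDt hcomm hconv Finset.univ
  have hinv : ∀ r, r ∈ invariants F ↔ ∀ i, D i r = 0 := by
    refine fun r => ⟨fun hr i => hr _ (hDF i), fun hr E hE => ?_⟩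
    rw [hFD] at hE
    obtain ⟨c, rfl⟩ := (Submodule.mem_span_range_iff_exists_fun R).1 hE
    rw [← Derivation.coeFnAddMonoidHom_apply, map_sum, Finset.sum_apply]
    exact Finset.sum_eq_zero fun i _ => by simp [hr i]
  have hmem : ∀ r, P r ∈ invariants F := fun r =>
    (hinv _).2 fun i => hPker i (Finset.mem_univ i) r
  have hfix : ∀ a ∈ invariants F, P a = a := fun a ha => hPfix a fun i _ => (hinv a).1 ha i
  have hPdp : γ.IsDPMorphism γ P := by
    refine h.isDPMorphism_projection hPc (γ.dpow_span_isSubDPIdeal ht) (Ideal.span_le.2 ?_) hPsub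
      fun m x hx hPx => hPfix _ fun i _ =>
        dpTangent_map_dpow_eq_zero (hD i) hPx (hPker i (Finset.mem_univ i) x) m
    rintro _ ⟨i, m, hm, rfl⟩
    exact hPzero i (Finset.mem_univ i) m hm
  refine ⟨P, n, t, hPc, hPdp, hmem, hfix, htY, hPsub, fun β => ?_⟩
  obtain ⟨Q, hQc, hQ⟩ := exists_dpCoeff hD ht hDt hPc
    (fun r hr => hPfix r fun i _ => hr i) (fun i => hPzero i (Finset.mem_univ i)) β
  exact ⟨Q, hQc, fun a ha α => hQ a ((hinv a).1 ha) α⟩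

theorem IsDPCoordinates.of_retract [IsTopologicalRing R] {π : R →ₐ[Λ] Λ}
    (hR : IsDPNilpotentAlgebra γΛ γ π) (A : Subalgebra Λ R) [IsLocalRing A]
    {γ' : DividedPowers (maximalIdeal A)} {P : R →+* R} (hPc : Continuous P)
    (hmem : ∀ r, P r ∈ A) (hfix : ∀ a ∈ A, P a = a) (hval : γ'.IsDPMorphism γ A.val.toRingHom)
    {n : ℕ} {t : Fin n → R} (ht : ∀ i, t i ∈ RingHom.ker π)
    (hsub : ∀ J, γ.IsOpenDPIdeal J → ∀ r,
      r - P r ∈ Ideal.span {y | ∃ i, ∃ m ≠ 0, γ.dpow m (t i) = y} ⊔ J)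
    (hcoeff : ∀ β : Fin n → ℕ, ∃ Q : R →+ R, Continuous Q ∧ ∀ a ∈ A, ∀ α : Fin n → ℕ,
      Q ((∏ j, γ.dpow (α j) (t j)) * a) = if α = β then a else 0) :
    IsDPCoordinates γ' γ A.val.toRingHom t where
  proDPArtin := hR.proDPArtin
  dpMorphism := hval
  continuous := continuous_subtype_val
  exists_comap_le J hJ := by
    -- The preimage of `J` under the projection is open in `R` and meets `A` in `J`.
    have h1 : (P.codRestrict A hmem) ⁻¹' J ∈ nhds (0 : R) :=
      (hJ.preimage (hPc.subtype_mk hmem)).mem_nhds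
        (Ideal.zero_mem (J.comap (P.codRestrict A hmem)))
    obtain ⟨J', hle, hJ'⟩ := hR.proDPArtin.basis _ h1
    refine ⟨J', hJ', fun a ha => ?_⟩
    have h2 : P.codRestrict A hmem a ∈ J := hle ha
    rwa [show P.codRestrict A hmem a = a from Subtype.ext (hfix _ a.2)] at h2
  mem i := IsLocalRing.le_maximalIdeal (RingHom.ker_ne_top π) (ht i)
  nilpotent J hJ := by
    obtain ⟨N, hN⟩ := hR.nilpotent J hJ.2.2
    refine ⟨N, le_trans (Ideal.span_mono ?_) hN⟩
    rintro _ ⟨l, hl, hlN, rfl⟩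
    refine ⟨l, fun q hq => ?_, hlN, rfl⟩
    obtain ⟨i, hi⟩ := hl q hq
    exact hi ▸ ht i
  exists_sub_mem J hJ r := ⟨⟨P r, hmem r⟩, hsub J hJ r⟩
  coeff β := by
    obtain ⟨Q, hQc, hQ⟩ := hcoeff β
    exact ⟨Q, hQc, fun a α => hQ a a.2 α⟩

theorem IsDPNilpotentAlgebra.exists_equiv_of_retract [IsTopologicalRing R] {π : R →ₐ[Λ] Λ}
    (hR : IsDPNilpotentAlgebra γΛ γ π) (A : Subalgebra Λ R) {P : R →+* R} (hPc : Continuous P)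
    (hPdp : γ.IsDPMorphism γ P)
    (hmem : ∀ r, P r ∈ A) (hfix : ∀ a ∈ A, P a = a)
    {n : ℕ} {t : Fin n → R} (ht : ∀ i, t i ∈ RingHom.ker π)
    (hsub : ∀ J, γ.IsOpenDPIdeal J → ∀ r,
      r - P r ∈ Ideal.span {y | ∃ i, ∃ m ≠ 0, γ.dpow m (t i) = y} ⊔ J)
    (hcoeff : ∀ β : Fin n → ℕ, ∃ Q : R →+ R, Continuous Q ∧ ∀ a ∈ A, ∀ α : Fin n → ℕ,
      Q ((∏ j, γ.dpow (α j) (t j)) * a) = if α = β then a else 0) :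
    ∃ (_ : IsLocalRing A) (γ' : DividedPowers (maximalIdeal A)),
      γ'.IsDPMorphism γ A.val.toRingHom ∧
      IsDPNilpotentAlgebra γΛ γ' (π.comp A.val) ∧
      ∃ (n : ℕ) (e : DPSeries γ' n ≃+* R),
        Continuous e ∧ Continuous e.symm ∧
        (DPSeries.dp γ' n).IsDPMorphism γ e.toRingHom ∧
        (∀ a : A, e (DPSeries.C γ' n a) = a) ∧
        ∀ i, π (e (DPSeries.X γ' n i)) = 0 := by
  refine Exists.elim (hR.proDPArtin.exists_retract A hPc hPdp hmem hfix) fun hloc h1 => ?_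
  refine Exists.elim h1 fun γ' h2 => ?_
  refine ⟨hloc, γ', h2.1, hR.of_retract A hPc hmem hfix h2.1 h2.2.1 h2.2.2, n, ?_⟩
  refine Exists.elim (IsDPCoordinates.of_retract hR A hPc hmem hfix h2.1 ht hsub
    hcoeff).exists_equiv fun e he => ?_
  exact ⟨e, he.1, he.2.1, he.2.2.1, he.2.2.2.1,
    fun i => (congrArg π (he.2.2.2.2 i)).trans (ht i)⟩

end foliation

/-! ### The three parts together -/

theorem mainTheorem10 :
    (∀ (Λ R : Type u) [CommRing Λ] [IsLocalRing Λ] [TopologicalSpace Λ] [IsTopologicalRing Λ]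
      [CommRing R] [IsLocalRing R] [TopologicalSpace R] [IsTopologicalRing R] [Algebra Λ R]
      (γΛ : DividedPowers (maximalIdeal Λ)) (γR : DividedPowers (maximalIdeal R))
      (π : R →ₐ[Λ] Λ) (F : Submodule R (Derivation Λ R R)),
      IsProDPArtin γΛ → IsDPNilpotentAlgebra γΛ γR π →
      IsSmoothDPFoliation Λ γR (RingHom.ker π) (maximalIdeal R) F →
      ∃ (_ : IsLocalRing (invariants F)) (γ' : DividedPowers (maximalIdeal (invariants F))),
        γ'.IsDPMorphism γR (invariants F).val.toRingHom ∧
        IsDPNilpotentAlgebra γΛ γ' (π.comp (invariants F).val) ∧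
        ∃ (n : ℕ) (e : DPSeries γ' n ≃+* R),
          Continuous e ∧ Continuous e.symm ∧
          (DPSeries.dp γ' n).IsDPMorphism γR e.toRingHom ∧
          (∀ a : invariants F, e (DPSeries.C γ' n a) = a) ∧
          ∀ i, π (e (DPSeries.X γ' n i)) = 0) ∧
    (∀ (p : ℕ) [Fact p.Prime] (k : Type v) (Λ : Type u) [Field k] [CharP k p] [PerfectField k]
      [CommRing Λ] [IsLocalRing Λ] [Algebra k Λ] [Module.Finite k (ResidueField Λ)],
      (maximalIdeal Λ).FG →
      IsDPTangentSmooth k ⊥ (DPHull.dividedPowers (dividedPowersBot k) (maximalIdeal Λ)) →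
      IsHeightOneSmooth p k Λ) ∧
    (∀ (Λ₀ : Type u) (R : Type v) (Λ₁ : Type w) [CommRing Λ₀] [IsLocalRing Λ₀]
      [IsNoetherianRing Λ₀] [CommRing R] [IsLocalRing R] [IsNoetherianRing R] [CommRing Λ₁]
      [IsLocalRing Λ₁] [IsNoetherianRing Λ₁] (f : Λ₀ →+* R) (g : R →+* Λ₁) [IsLocalHom f]
      [IsLocalHom g] (hf : (ResidueField.map f).Finite),
      (ResidueField.map g).Finite → Function.Bijective (ResidueField.map f) →
      IsAdicComplete (maximalIdeal Λ₀) Λ₀ → IsAddTorsionFree Λ₀ →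
      IsSlightlyRamified (g.comp f) →
      (ProArtinDP.map f hf).IsDPTangentSmooth
        (DividedPowers.Completion.ideal (localDP Λ₀) IsLocalArtinQuotient)
        (DividedPowers.Completion.dividedPowers (localDP R) IsLocalArtinQuotient) →
      IsAdicFormallySmooth f) := by
  refine ⟨?_, ?_, ?_⟩
  · intro Λ R _ _ _ _ _ _ _ _ _ γΛ γR π F _ hR hF
    exact (hF.exists_projection hR).elim fun P h => h.elim fun n h => h.elim fun t h =>
      hR.exists_equiv_of_retract (invariants F) h.1 h.2.1 h.2.2.1 h.2.2.2.1 h.2.2.2.2.1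
        h.2.2.2.2.2.1 h.2.2.2.2.2.2
  · intro p _ k Λ _ _ _ _ _ _ _ hfg h
    exact h.isHeightOneSmooth p hfg
  · intro Λ₀ R Λ₁ _ _ _ _ _ _ _ _ _ f g _ _ hf hg hbij hc ht hsr h
    exact IsAdicFormallySmooth.of_isDPTangentSmooth f g hf hg hbij hc ht hsr h
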